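/- Let $p$ be a prime, $q$ a power of $p$ (with $q>1$), and let $1\le k<n$ be integers with $\gcd(k,n-k)=1$ (so $n\ge 2$). Put $\ell=q^n$ and, for $m\ge 1$, $\mathrm{Tr}_m(T)=T+T^q+\cdots+T^{q^{m-1}}$. Let $\Omega$ be an algebraically closed field containing $\mathbb F_\ell$, and let $x_1,x_2,\dots\in\Omega$ be such that $x_1$ is transcendental over $\mathbb F_\ell$ and, for all $i\ge1$, $$\sum_{j=0}^{n-k-1}\frac{x_{i+1}^{q^{j}}}{x_i^{q^{k+j}}}+\sum_{j=0}^{k-1}\frac{x_{i+1}^{q^{n-k+j}}}{x_i^{q^{j}}}=1 .$$ Put $z_i=-x_i^{q^n-1}$ and $H_i=\mathbb F_\ell(z_1,\dots,z_i)$ for $i\ge 1$. Let $M\subseteq\Omega$ be the splitting field over $H_1=\mathbb F_\ell(z_1)$ of $$f_1(T)=-z_1^{-1}\,\mathrm{Tr}_{n-k}(T)+\mathrm{Tr}_k(T)^{q^{n-k}},$$ and for $i\ge2$ let $H'_i=M\cdot H_i$ be the composite field inside $\Omega$. Then for every $i>1$ the extension $H'_{i+1}/H'_i$ is a 2-bounded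 Galois $p$-extension. That is, it is a finite Galois extension whose Galois group is a $p$-group, and for every place $P$ of $H'_i$ and every place $Q$ of $H'_{i+1}$ lying above $P$, the ramification index $e(Q|P)$ and the different exponent $d(Q|P)$ satisfy $$d(Q|P)=2\,\bigl(e(Q|P)-1\bigr).$$ -/

import Mathlib

open Polynomial

namespace GaloisTower

noncomputable section

section Ramification

variable {F E : Type*} [Field F] [Field E] [Algebra F E]

/-- `Q` is (the valuation ring of) a place of the function field `E` over the constant field `K`:
a valuation ring of `E` with `K ⊆ Q` and `Q ≠ E`. -/
def IsPlace (K : Type*) [Field K] [Algebra K E] (Q : ValuationSubring E) : Prop :=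
  (∀ c : K, algebraMap K E c ∈ Q) ∧ Q ≠ ⊤

/-- The restriction `Q ∩ F` of a valuation ring of `E` to the subfield `F`. -/
abbrev below (F : Type*) [Field F] [Algebra F E] (Q : ValuationSubring E) : ValuationSubring F :=
  Q.comap (algebraMap F E)

/-- The integral closure in `E` of a valuation ring `P` of `F`. -/
abbrev intClosure (E : Type*) [Field E] [Algebra F E] (P : ValuationSubring F) : Subalgebra P E :=
  integralClosure P E

theorem mem_of_mem_intClosure (Q : ValuationSubring E) {b : E}
    (hb : b ∈ intClosure E (below F Q)) : b ∈ Q := by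
  obtain ⟨g, hg, hb0⟩ := hb
  let φ : below F Q →+* Q :=
    { toFun := fun c => ⟨algebraMap F E c, c.2⟩
      map_one' := by ext; simp
      map_mul' := fun c d => by ext; simp
      map_zero' := by ext; simp
      map_add' := fun c d => by ext; simp }
  have hint : IsIntegral Q b := by
    refine ⟨g.map φ, hg.map φ, ?_⟩
    rw [Polynomial.eval₂_map]
    exact hb0
  obtain ⟨y, hy⟩ := IsIntegrallyClosed.isIntegral_iff.mp hint
  rw [← hy]
  exact y.2

/-- The prime ideal, in the integral closure of `Q ∩ F` in `E`, that corresponds to `Q`: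
the elements lying in the maximal ideal of `Q`. -/
def center (F : Type*) [Field F] [Algebra F E] (Q : ValuationSubring E) :
    Ideal (intClosure E (below F Q)) where
  carrier := {b | (b : E) ∈ Q.nonunits}
  add_mem' := fun ha hb => Q.nonunits.add_mem ha hb
  zero_mem' := Q.nonunits.zero_mem
  smul_mem' := fun c b hb => by
    have hc : Q.valuation (c : E) ≤ 1 :=
      (Q.valuation_le_one_iff _).mpr (mem_of_mem_intClosure Q c.2)
    have hb' : Q.valuation (b : E) < 1 := hb
    change Q.valuation ((c : E) * (b : E)) < 1
    rw [map_mul]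
    exact mul_lt_one_of_nonneg_of_lt_one_right hc zero_le hb'

/-- The complementary module `{z ∈ E | Tr_{E/F}(z b) ∈ P for all b in the integral closure of P}`
of a valuation ring `P` of `F`. -/
def complementaryModule (E : Type*) [Field E] [Algebra F E] (P : ValuationSubring F) :
    Submodule (intClosure E P) E :=
  Submodule.traceDual P F 1

/-- The different of (the integral closure in `E` of) `P`: the inverse of the complementary
module. -/
def different (E : Type*) [Field E] [Algebra F E] (P : ValuationSubring F) :
    Ideal (intClosure E P) :=
  (1 / complementaryModule E P).comap (Algebra.linearMap (intClosure E P) E)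

/-- The ramification index `e(Q|P)`, where `P = Q ∩ F`. -/
def ramIdx (F : Type*) [Field F] [Algebra F E] (Q : ValuationSubring E) : ℕ :=
  (center F Q).ramificationIdx (below F Q)

/-- The different exponent `d(Q|P)`, where `P = Q ∩ F`: the exponent of the prime ideal
corresponding to `Q` in the different. -/
def diffExponent (F : Type*) [Field F] [Algebra F E] (Q : ValuationSubring E) : ℕ∞ :=
  emultiplicity (center F Q) (different E (below F Q))

/-- `d(Q|P) = 2 (e(Q|P) - 1)` for all places `Q` of `E`, with `P = Q ∩ F`. -/
def IsTwoBounded (K F E : Type*) [Field K] [Field F] [Field E] [Algebra K E] [Algebra F E] :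
    Prop :=
  ∀ Q : ValuationSubring E, IsPlace K Q →
    diffExponent F Q = ((2 * (ramIdx F Q - 1) : ℕ) : ℕ∞)

/-- `E / F` is a finite Galois extension whose Galois group is a `p`-group. -/
def IsGaloisPExtension (p : ℕ) (F E : Type*) [Field F] [Field E] [Algebra F E] : Prop :=
  FiniteDimensional F E ∧ IsGalois F E ∧ IsPGroup p (E ≃ₐ[F] E)

end Ramification

section Tower

variable (𝔽 : Type*) {Ω : Type*} [Field 𝔽] [Field Ω] [Algebra 𝔽 Ω]

/-- The trace polynomial `Tr_m(T) = T + T^q + ⋯ + T^(q^(m-1))`. -/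
def trPoly (Ω : Type*) [Field Ω] (q m : ℕ) : Polynomial Ω :=
  ∑ j ∈ Finset.range m, X ^ q ^ j

/-- The recursive equation relating two consecutive generators `x`, `y`. -/
def TowerEquation (q n k : ℕ) (x y : Ω) : Prop :=
  ∑ j ∈ Finset.range (n - k), y ^ q ^ j / x ^ q ^ (k + j) +
    ∑ j ∈ Finset.range k, y ^ q ^ (n - k + j) / x ^ q ^ j = 1

/-- `x 1, x 2, …` generate a tower `F_i = 𝔽(x 1, …, x i)` satisfying the recursive equation,
with `F_1` a rational function field. The value `x 0` plays no role. -/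
structure IsTowerSequence (q n k : ℕ) (x : ℕ → Ω) : Prop where
  transcendental : Transcendental 𝔽 (x 1)
  equation : ∀ i, 1 ≤ i → TowerEquation q n k (x i) (x (i + 1))

/-- `z_i = - x_i ^ (q^n - 1)`. -/
def z (q n : ℕ) (x : ℕ → Ω) (i : ℕ) : Ω := -(x i) ^ (q ^ n - 1)

/-- `H_i = 𝔽(z_1, …, z_i)`. -/
def H (q n : ℕ) (x : ℕ → Ω) (i : ℕ) : IntermediateField 𝔽 Ω :=
  IntermediateField.adjoin 𝔽 (z q n x '' Set.Icc 1 i)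

/-- `f_1(T) = - z_1⁻¹ Tr_{n-k}(T) + Tr_k(T)^(q^(n-k))`. -/
def f₁ (q n k : ℕ) (x : ℕ → Ω) : Polynomial Ω :=
  -C ((z q n x 1)⁻¹) * trPoly Ω q (n - k) + trPoly Ω q k ^ q ^ (n - k)

/-- The splitting field `M` of `f_1` over `H_1` inside `Ω` (to be used with `Ω` algebraically
closed): the field generated over `H_1` by the roots of `f_1`. -/
def M (q n k : ℕ) (x : ℕ → Ω) : IntermediateField 𝔽 Ω :=
  H 𝔽 q n x 1 ⊔ IntermediateField.adjoin 𝔽 {t | (f₁ q n k x).IsRoot t}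

/-- The composite `H'_i = M · H_i`, used for `i ≥ 2`. -/
def H' (q n k : ℕ) (x : ℕ → Ω) (i : ℕ) : IntermediateField 𝔽 Ω :=
  M 𝔽 q n k x ⊔ H 𝔽 q n x i

theorem H'_le_succ (q n k : ℕ) (x : ℕ → Ω) (i : ℕ) :
    H' 𝔽 q n k x i ≤ H' 𝔽 q n k x (i + 1) :=
  sup_le_sup_left (IntermediateField.adjoin.mono _ _ _
    (Set.image_mono (Set.Icc_subset_Icc_right (Nat.le_succ i)))) _

/-- `H'_{i+1}`, regarded as an extension field of `H'_i`. -/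
abbrev H'Step (q n k : ℕ) (x : ℕ → Ω) (i : ℕ) : IntermediateField (H' 𝔽 q n k x i) Ω :=
  IntermediateField.extendScalars (H'_le_succ 𝔽 q n k x i)

end Tower

end

end GaloisTower

/-!
The steps of the tower are built from extensions that are *weakly ramified* at every place `Q`: an
automorphism in the inertia group of `Q` that moves every element of the valuation ring by an
element of the cube of the maximal ideal is trivial (`IsWeaklyRamifiedAt`). For a Galois
`p`-extension all inertia is wild, so weak ramification says that every nontrivial inertial
automorphism moves a uniformizer to order exactly `2`. The different exponent at `Q` is the order of
`g'(θ)` for a suitable local generator `θ` with minimal polynomial `g`, that is the sum of the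
orders of `θ - σ θ`, and equals `2 (e - 1)` (`diffExponent_eq_of_isWeaklyRamifiedAt`). Weak
ramification passes to the upper part of a tower and, which is the main local fact, to composites of
Galois `p`-extensions (`IsWeaklyRamifiedAt.composite`). The latter rests on an inequality of Tate
(`sum_ord_apply_sub_le`): for `N` a group of inertial automorphisms in a `p`-group, `t` a
uniformizer and `ζ` fixed by `N`, the orders of `σ h t - t` for `h` in `N` add up to at most the
order of `σ ζ - ζ`. If `σ` moves `t` to the maximal order, which is at least `3`, this gives
`2 |N| + 1 ≤ ord (σ ζ - ζ)` (`two_mul_card_lt_ord_apply_sub`).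

Put `j = n - k`, and choose integers with `j α + k β = 1`. The elements
`r = x_{i+1} / x_i ^ (q ^ k)` and `s = - x_{i+1} ^ (q ^ j) / x_i` satisfy `Tr_j(r) - Tr_k(s) = 1`,
and since `j` and `k` are coprime the Euclidean algorithm gives an element `u_i` with
`r = Tr_k(u_i) + α` and `s = Tr_j(u_i) - β` (`exists_isLink`). With `w = 1 / z_i` and
`w' = 1 / z_{i+1}` one has `r ^ (q ^ j) = w s` and `r = w' s ^ (q ^ k)`, so that `u_i` is a root of
`Tr_k(T) ^ (q ^ j) - w Tr_j(T) + α + β w`, whose roots differ by the kernel `V_i` of its linear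
part; `V_1` is the set of roots of `f₁`. Let `M_i = 𝔽(z_i, V_i)`. Three facts relate consecutive
indices. The field `M_i(u_i)` contains `M_{i+1}` (`IsLink.baseField_le`). The situation is symmetric
under exchanging `j` with `k` and inverting `w` and `w'`, because the kernel of the adjoint operator
generates the same field (`baseField_inv`, by means of a pairing of the two kernels); hence
`M_i(u_i) = M_{i+1}(u_i)`. Finally `z_{i+1}` generates `M_i(u_i)` over `M_i`
(`IsLink.mem_of_mem_right`), so that `H'_i = M_1(u_1, …, u_{i-1})`.

The extensions `M_i(u_i) / M_i` and, by symmetry, `M_i(u_i) / M_{i+1}` are elementary abelian and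
weakly ramified (`IsLink.isWeakStep`). At places where `w` does not vanish there is an integral root
of the step polynomial, and the kernel meets the maximal ideal trivially, so nothing ramifies. At a
zero of `w` the order of `w` is at most the order of the inertia group over `𝔽(z_i)`, which is
bounded in terms of the order of a stabilizer, and a violation of weak ramification would contradict
`2 |N| + 1 ≤ ord (σ ζ - ζ)` for a suitable `ζ` (`eq_one_of_mem_nonunits`).

The fields `K(a, m) = M_a(u_a, …, u_{a+m-1})` form a pyramid in which `K(a, m + 2)` is the composite
of `K(a, m + 1)` and `K(a + 1, m + 1)` over `K(a + 1, m)`. By induction all its edges are weakly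
ramified Galois `p`-extensions (`isWeakStep_pyramid`); the edges along its left side are the
extensions `H'_{i+1} / H'_i`.
-/

namespace GaloisTower

/-! ### The order function of a discrete valuation subring -/

section Order

variable {E : Type*} [Field E] (Q : ValuationSubring E)

/-- The normalized order function of a discrete valuation ring `Q` of the field `E`, extended by the
junk value `0` outside `Q`. The order of `0` is `⊤`. -/
noncomputable def ord [IsDiscreteValuationRing Q] (x : E) : ℕ∞ :=
  open Classical in if h : x ∈ Q then IsDiscreteValuationRing.addVal Q ⟨x, h⟩ else 0

variable {Q} [IsDiscreteValuationRing Q] {x y : E}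

theorem ord_of_mem (h : x ∈ Q) : ord Q x = IsDiscreteValuationRing.addVal Q ⟨x, h⟩ :=
  dif_pos h

theorem ord_mul (hx : x ∈ Q) (hy : y ∈ Q) : ord Q (x * y) = ord Q x + ord Q y := by
  rw [ord_of_mem hx, ord_of_mem hy, ord_of_mem (Q.mul_mem _ _ hx hy),
    ← IsDiscreteValuationRing.addVal_mul]
  rfl

theorem ord_one : ord Q (1 : E) = 0 := by
  rw [ord_of_mem Q.one_mem]; exact IsDiscreteValuationRing.addVal_one

theorem ord_zero : ord Q (0 : E) = ⊤ := by
  rw [ord_of_mem Q.zero_mem]; exact IsDiscreteValuationRing.addVal_zero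

theorem ord_pow (hx : x ∈ Q) (n : ℕ) : ord Q (x ^ n) = n * ord Q x := by
  induction n with
  | zero => simp [ord_one]
  | succ n ih => rw [pow_succ, ord_mul (pow_mem hx n) hx, ih]; push_cast; ring

theorem ord_prod {ι : Type*} (s : Finset ι) (f : ι → E) (hf : ∀ i ∈ s, f i ∈ Q) :
    ord Q (∏ i ∈ s, f i) = ∑ i ∈ s, ord Q (f i) := by
  classical
  induction s using Finset.induction_on with
  | empty => simp [ord_one]
  | insert a s ha ih =>
    rw [Finset.prod_insert ha, Finset.sum_insert ha, ord_mul (hf a (by simp))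
      (prod_mem fun i hi => hf i (by simp [hi])), ih fun i hi => hf i (by simp [hi])]

theorem ord_eq_top_iff : ord Q x = ⊤ ↔ x = 0 := by
  by_cases h : x ∈ Q
  · rw [ord_of_mem h, IsDiscreteValuationRing.addVal_eq_top_iff, ← Subtype.coe_inj]; rfl
  · have : x ≠ 0 := fun h0 => h (h0 ▸ Q.zero_mem)
    simp [ord, h, this]

theorem one_le_ord_iff : 1 ≤ ord Q x ↔ x ∈ Q.nonunits := by
  by_cases h : x ∈ Q
  · rw [ord_of_mem h, Order.one_le_iff_ne_zero, Ne, IsDiscreteValuationRing.addVal_eq_zero_iff]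
    exact (ValuationSubring.coe_mem_nonunits_iff (a := ⟨x, h⟩)).symm
  · have : x ∉ Q.nonunits := fun hx => h (Q.nonunits_subset hx)
    simp [ord, h, this]

theorem ord_eq_zero_iff : ord Q x = 0 ↔ x ∉ Q.nonunits := by
  rw [← one_le_ord_iff, Order.one_le_iff_ne_zero, not_not]

theorem ord_le_ord_iff (hx : x ∈ Q) (hy : y ∈ Q) : ord Q x ≤ ord Q y ↔ ∃ c ∈ Q, y = x * c := by
  rw [ord_of_mem hx, ord_of_mem hy, IsDiscreteValuationRing.addVal_le_iff_dvd]
  constructor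
  · rintro ⟨c, hc⟩; exact ⟨c, c.2, congrArg Subtype.val hc⟩
  · rintro ⟨c, hc, h⟩; exact ⟨⟨c, hc⟩, Subtype.ext h⟩

theorem min_le_ord_add (hx : x ∈ Q) (hy : y ∈ Q) : min (ord Q x) (ord Q y) ≤ ord Q (x + y) := by
  rw [ord_of_mem hx, ord_of_mem hy, ord_of_mem (Q.add_mem _ _ hx hy)]
  exact IsDiscreteValuationRing.addVal_add (a := (⟨x, hx⟩ : Q)) (b := ⟨y, hy⟩)

theorem ord_neg : ord Q (-x) = ord Q x := by
  by_cases h : x ∈ Q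
  · refine le_antisymm ((ord_le_ord_iff (neg_mem h) h).2 ⟨-1, neg_mem Q.one_mem, by ring⟩)
      ((ord_le_ord_iff h (neg_mem h)).2 ⟨-1, neg_mem Q.one_mem, by ring⟩)
  · have : -x ∉ Q := fun h' => h (neg_neg x ▸ neg_mem h')
    simp [ord, h, this]

theorem ord_sub_comm : ord Q (x - y) = ord Q (y - x) := by
  rw [← ord_neg, neg_sub]

theorem min_le_ord_sub (hx : x ∈ Q) (hy : y ∈ Q) : min (ord Q x) (ord Q y) ≤ ord Q (x - y) := by
  rw [sub_eq_add_neg, ← ord_neg (x := y)]; exact min_le_ord_add hx (neg_mem hy)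

theorem ord_add_eq (hx : x ∈ Q) (hy : y ∈ Q) (h : ord Q x < ord Q y) :
    ord Q (x + y) = ord Q x := by
  refine le_antisymm ?_ (by simpa [h.le] using min_le_ord_add hx hy)
  by_contra! h'
  have := min_le_ord_sub (Q.add_mem _ _ hx hy) hy
  rw [add_sub_cancel_right] at this
  exact absurd this (not_le.2 (lt_min h' h))

theorem ord_sub_eq (hx : x ∈ Q) (hy : y ∈ Q) (h : ord Q x < ord Q y) :
    ord Q (x - y) = ord Q x := by
  rw [sub_eq_add_neg]; exact ord_add_eq hx (neg_mem hy) (by rwa [ord_neg])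

/-- If the order of `y` is finite and at most that of `x`, the quotient `x / y` is integral. -/
theorem div_mem_and_ord_div (hx : x ∈ Q) (hy : y ∈ Q) (hy0 : y ≠ 0) (h : ord Q y ≤ ord Q x) :
    x / y ∈ Q ∧ ord Q (x / y) + ord Q y = ord Q x := by
  obtain ⟨c, hc, rfl⟩ := (ord_le_ord_iff hy hx).1 h
  rw [mul_div_cancel_left₀ c hy0]
  exact ⟨hc, by rw [ord_mul hy hc, add_comm]⟩

theorem exists_ord_eq_one (Q : ValuationSubring E) [IsDiscreteValuationRing Q] :
    ∃ t ∈ Q, ord Q t = 1 := by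
  obtain ⟨t, ht⟩ := IsDiscreteValuationRing.exists_irreducible Q
  exact ⟨t, t.2, by rw [ord_of_mem t.2]; exact IsDiscreteValuationRing.addVal_uniformizer ht⟩

theorem natCast_le_ord_iff {t : E} (ht : t ∈ Q) (ht1 : ord Q t = 1) (hx : x ∈ Q) (n : ℕ) :
    (n : ℕ∞) ≤ ord Q x ↔ ∃ c ∈ Q, x = t ^ n * c := by
  rw [← ord_le_ord_iff (pow_mem ht n) hx, ord_pow ht, ht1, mul_one]

theorem mem_of_one_le_ord (h : 1 ≤ ord Q x) : x ∈ Q := Q.nonunits_subset (one_le_ord_iff.1 h)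

theorem three_le_ord_iff : 3 ≤ ord Q x ↔
    ∃ a ∈ Q.nonunits, ∃ b ∈ Q.nonunits, ∃ c ∈ Q.nonunits, x = a * b * c := by
  constructor
  · intro h
    have hx : x ∈ Q := mem_of_one_le_ord (le_trans (by norm_num) h)
    obtain ⟨t, ht, ht1⟩ := exists_ord_eq_one Q
    have htn : t ∈ Q.nonunits := one_le_ord_iff.1 ht1.ge
    obtain ⟨c, hc, rfl⟩ := (natCast_le_ord_iff ht ht1 hx 3).1 (by exact_mod_cast h)
    refine ⟨t, htn, t, htn, t * c, one_le_ord_iff.1 ?_, by ring⟩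
    rw [ord_mul ht hc, ht1]; exact le_self_add
  · rintro ⟨a, ha, b, hb, c, hc, rfl⟩
    have ha' := Q.nonunits_subset ha
    have hb' := Q.nonunits_subset hb
    rw [ord_mul (Q.mul_mem _ _ ha' hb') (Q.nonunits_subset hc), ord_mul ha' hb']
    calc (3 : ℕ∞) = 1 + 1 + 1 := by norm_num
      _ ≤ _ := add_le_add (add_le_add (one_le_ord_iff.2 ha) (one_le_ord_iff.2 hb))
        (one_le_ord_iff.2 hc)

theorem ord_ne_top (hx : x ≠ 0) : ord Q x ≠ ⊤ := fun h => hx (ord_eq_top_iff.1 h)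

end Order

section Below

variable {F E : Type*} [Field F] [Field E] [Algebra F E] (Q : ValuationSubring E)

theorem algebraMap_mem_nonunits_iff {x : F} :
    algebraMap F E x ∈ Q.nonunits ↔ x ∈ (below F Q).nonunits := by
  rw [ValuationSubring.mem_nonunits_iff_or, ValuationSubring.mem_nonunits_iff_or,
    ValuationSubring.mem_comap, map_inv₀, map_eq_zero]

theorem below_ne_top [Algebra.IsAlgebraic F E] (hQ : Q ≠ ⊤) : below F Q ≠ ⊤ := by
  intro h
  apply hQ
  rw [eq_top_iff]
  intro b _
  apply mem_of_mem_intClosure (F := F) Q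
  obtain ⟨g, hg, hb⟩ := Algebra.IsIntegral.isIntegral (R := F) b
  have hlift : g.map (algebraMap F F) ∈ Polynomial.lifts (algebraMap (below F Q) F) := by
    rw [Polynomial.lifts_iff_coeff_lifts]
    intro n
    exact ⟨⟨_, h ▸ ValuationSubring.mem_top _⟩, rfl⟩
  obtain ⟨g', hg', -, hm⟩ := Polynomial.lifts_and_natDegree_eq_and_monic hlift (hg.map _)
  refine ⟨g', hm, ?_⟩
  rw [IsScalarTower.algebraMap_eq (below F Q) F E, ← Polynomial.eval₂_map, hg']
  simpa using hb

theorem ne_top_of_isDVR [IsDiscreteValuationRing Q] : Q ≠ ⊤ := by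
  intro h
  obtain ⟨t, ht, ht1⟩ := exists_ord_eq_one Q
  have : t ∈ Q.nonunits := one_le_ord_iff.1 ht1.ge
  rw [ValuationSubring.mem_nonunits_iff_or, h] at this
  rcases this with h0 | h0
  · rw [h0, ord_zero] at ht1; exact absurd ht1 (by simp)
  · exact h0 (ValuationSubring.mem_top _)

/-- The restriction of a discrete valuation ring to a subfield over which the field is algebraic is
again a discrete valuation ring: an element of least positive order is a uniformizer. -/
theorem isDVR_below [Algebra.IsAlgebraic F E] [IsDiscreteValuationRing Q] :
    IsDiscreteValuationRing (below F Q) := by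
  classical
  have hne := below_ne_top (F := F) Q (ne_top_of_isDVR Q)
  obtain ⟨x, hx⟩ : ∃ x : F, x ∉ below F Q := by
    by_contra! h
    exact hne (eq_top_iff.2 fun x _ => h x)
  have hx0 : x ≠ 0 := fun h => hx (h ▸ (below F Q).zero_mem)
  have hord : ∀ y : F, y ∈ (below F Q).nonunits → y ≠ 0 →
      ∃ n : ℕ, ord Q (algebraMap F E y) = n ∧ 1 ≤ n := by
    intro y hy hy0
    have hfin := ord_ne_top (Q := Q) (x := algebraMap F E y) (by simpa using hy0)
    obtain ⟨n, hn⟩ := ENat.ne_top_iff_exists.1 hfin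
    refine ⟨n, hn.symm, ?_⟩
    have := one_le_ord_iff.2 ((algebraMap_mem_nonunits_iff Q).2 hy)
    rw [← hn] at this
    exact_mod_cast this
  let S : Set ℕ := {n | ∃ y ∈ (below F Q).nonunits, y ≠ 0 ∧ ord Q (algebraMap F E y) = n}
  have hS : S.Nonempty := by
    have hxn : x⁻¹ ∈ (below F Q).nonunits :=
      (ValuationSubring.inv_mem_nonunits_iff _).2 (Or.inr hx)
    obtain ⟨n, hn, -⟩ := hord _ hxn (inv_ne_zero hx0)
    exact ⟨n, _, hxn, inv_ne_zero hx0, hn⟩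
  -- an element of least positive order
  obtain ⟨π, hπ, hπ0, hπn⟩ := Nat.sInf_mem hS
  have hmin : ∀ y ∈ (below F Q).nonunits, y ≠ 0 →
      ord Q (algebraMap F E π) ≤ ord Q (algebraMap F E y) := by
    intro y hy hy0
    obtain ⟨n, hn, -⟩ := hord y hy hy0
    rw [hπn, hn]
    exact_mod_cast Nat.sInf_le (show n ∈ S from ⟨y, hy, hy0, hn⟩)
  have hπm : π ∈ below F Q := (below F Q).nonunits_subset hπ
  have hdiv : ∀ y ∈ (below F Q).nonunits, ∃ c ∈ below F Q, y = π * c := by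
    intro y hy
    by_cases hy0 : y = 0
    · exact ⟨0, zero_mem _, by simp [hy0]⟩
    refine ⟨y / π, ?_, by field_simp⟩
    have := (div_mem_and_ord_div (Q := Q) (Q.nonunits_subset ((algebraMap_mem_nonunits_iff Q).2 hy))
      hπm (by simpa using hπ0) (hmin y hy hy0)).1
    rw [ValuationSubring.mem_comap, map_div₀]
    exact this
  have hfact : ∀ n : ℕ, ∀ y ∈ below F Q, y ≠ 0 → ord Q (algebraMap F E y) ≤ n →
      ∃ m : ℕ, ∃ c ∈ below F Q, c ∉ (below F Q).nonunits ∧ y = π ^ m * c := by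
    intro n
    induction n with
    | zero =>
      intro y hy _ h
      refine ⟨0, y, hy, fun hn => ?_, by simp⟩
      have := one_le_ord_iff.2 ((algebraMap_mem_nonunits_iff Q).2 hn)
      exact absurd (this.trans h) (by simp)
    | succ n ih =>
      intro y hy hy0 h
      by_cases hn : y ∈ (below F Q).nonunits
      · obtain ⟨c, hc, rfl⟩ := hdiv y hn
        have hc0 : c ≠ 0 := right_ne_zero_of_mul hy0
        have hle : ord Q (algebraMap F E c) ≤ n := by
          rw [map_mul, ord_mul (show _ ∈ Q from hπm) (show _ ∈ Q from hc)] at h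
          have h1 := one_le_ord_iff.2 ((algebraMap_mem_nonunits_iff Q).2 hπ)
          have h2 : 1 + ord Q (algebraMap F E c) ≤ 1 + n := by
            rw [add_comm 1 (n : ℕ∞)]
            exact (by gcongr : _ ≤ _).trans (h.trans_eq (by push_cast; rfl))
          exact (ENat.add_le_add_iff_left (by simp)).1 h2
        obtain ⟨m, d, hd, hdn, rfl⟩ := ih c hc hc0 hle
        exact ⟨m + 1, d, hd, hdn, by ring⟩
      · exact ⟨0, y, hy, hn, by simp⟩
  apply IsDiscreteValuationRing.ofHasUnitMulPowIrreducibleFactorization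
  refine ⟨⟨π, hπm⟩, ?_, ?_⟩
  · rw [irreducible_iff]
    refine ⟨(ValuationSubring.coe_mem_nonunits_iff (A := below F Q) (a := ⟨π, hπm⟩)).1 hπ, ?_⟩
    rintro ⟨a, ha⟩ ⟨b, hb⟩ hab
    by_contra! hn
    have hab' : π = a * b := congrArg Subtype.val hab
    have ha' : a ∈ (below F Q).nonunits :=
      (ValuationSubring.coe_mem_nonunits_iff (A := below F Q) (a := ⟨a, ha⟩)).2 hn.1
    have hb' : b ∈ (below F Q).nonunits :=
      (ValuationSubring.coe_mem_nonunits_iff (A := below F Q) (a := ⟨b, hb⟩)).2 hn.2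
    have h1 := hmin a ha' (fun h => hπ0 (by simp [hab', h]))
    rw [hab', map_mul, ord_mul (show _ ∈ Q from ha) (show _ ∈ Q from hb)] at h1
    obtain ⟨m, hm, -⟩ := hord a ha' (fun h => hπ0 (by simp [hab', h]))
    obtain ⟨l, hl, hl1⟩ := hord b hb' (fun h => hπ0 (by simp [hab', h]))
    rw [hm, hl] at h1
    have : m + l ≤ m := by exact_mod_cast h1
    omega
  · rintro ⟨y, hy⟩ hy0
    have hy0' : y ≠ 0 := fun h => hy0 (Subtype.ext h)
    obtain ⟨n, hn⟩ := ENat.ne_top_iff_exists.1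
      (ord_ne_top (Q := Q) (x := algebraMap F E y) (by simpa using hy0'))
    obtain ⟨m, c, hc, hcn, hyc⟩ := hfact n y hy hy0' hn.symm.le
    have hu : IsUnit (⟨c, hc⟩ : below F Q) := by
      by_contra h
      exact hcn ((ValuationSubring.coe_mem_nonunits_iff (A := below F Q) (a := ⟨c, hc⟩)).2 h)
    refine ⟨m, hu.unit, Subtype.ext ?_⟩
    simpa using hyc.symm

end Below

/-! ### Inertia -/

section Inertia

variable {E : Type*} [Field E]

/-- `Q` has residue field contained in the field with `p ^ m` elements, for some `m ≥ 1`. -/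
def HasFiniteResidue (p : ℕ) (Q : ValuationSubring E) : Prop :=
  ∃ m : ℕ, 1 ≤ m ∧ ∀ a ∈ Q, a ^ p ^ m - a ∈ Q.nonunits

variable (F : Type*) [Field F] [Algebra F E]

theorem HasFiniteResidue.below {p : ℕ} {Q : ValuationSubring E} (h : HasFiniteResidue p Q) :
    HasFiniteResidue p (below F Q) := by
  obtain ⟨m, hm, h⟩ := h
  refine ⟨m, hm, fun a ha => ?_⟩
  rw [← algebraMap_mem_nonunits_iff, map_sub, map_pow]
  exact h _ ha

/-- The inertia group of `Q` over `F`: the automorphisms that stabilize `Q` and act trivially on its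
residue field. -/
def inertiaAt (Q : ValuationSubring E) : Subgroup (E ≃ₐ[F] E) where
  carrier := {σ | (∀ a, σ a ∈ Q ↔ a ∈ Q) ∧ ∀ a ∈ Q, σ a - a ∈ Q.nonunits}
  one_mem' := ⟨fun a => Iff.rfl, fun a _ => by simp⟩
  mul_mem' := by
    rintro σ τ ⟨h1, h2⟩ ⟨h3, h4⟩
    refine ⟨fun a => (h1 _).trans (h3 a), fun a ha => ?_⟩
    have := Q.nonunits.add_mem (h2 (τ a) ((h3 a).2 ha)) (h4 a ha)
    simpa using this
  inv_mem' := by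
    rintro σ ⟨h1, h2⟩
    have h : ∀ a, σ (σ⁻¹ a) = a := fun a => AlgEquiv.apply_symm_apply σ a
    refine ⟨fun a => by rw [← h1, h], fun a ha => ?_⟩
    have := Q.nonunits.neg_mem (h2 (σ⁻¹ a) (by rwa [← h1, h]))
    rwa [h, neg_sub] at this

variable {F} {Q : ValuationSubring E}

variable [IsDiscreteValuationRing Q] {σ τ : E ≃ₐ[F] E}

theorem ord_apply_of_mem_inertiaAt (hσ : σ ∈ inertiaAt F Q) (x : E) :
    ord Q (σ x) = ord Q x := by
  by_cases hx : x ∈ Q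
  swap
  · have : σ x ∉ Q := fun h => hx ((hσ.1 x).1 h)
    simp [ord, hx, this]
  have key : ∀ τ ∈ inertiaAt F Q, ∀ y ∈ Q, ord Q y ≤ ord Q (τ y) := by
    intro τ hτ y hy
    obtain ⟨t, ht, ht1⟩ := exists_ord_eq_one Q
    have hτt : 1 ≤ ord Q (τ t) := by
      have h1 := one_le_ord_iff.2 (Q.nonunits.add_mem (hτ.2 t ht) (one_le_ord_iff.1 ht1.ge))
      simpa using h1
    refine ENat.forall_natCast_le_iff_le.1 fun n hn => ?_
    obtain ⟨c, hc, rfl⟩ := (natCast_le_ord_iff ht ht1 hy n).1 hn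
    rw [map_mul, map_pow, ord_mul (pow_mem ((hτ.1 t).2 ht) n) ((hτ.1 c).2 hc),
      ord_pow ((hτ.1 t).2 ht)]
    calc (n : ℕ∞) = n * 1 := by simp
      _ ≤ n * ord Q (τ t) := by gcongr
      _ ≤ _ := le_self_add
  refine le_antisymm ?_ (key σ hσ x hx)
  have := key σ⁻¹ (inv_mem hσ) (σ x) ((hσ.1 x).2 hx)
  rwa [show σ⁻¹ (σ x) = x from AlgEquiv.symm_apply_apply σ x] at this

end Inertia

/-! ### Residues and uniformizers in totally ramified `p`-extensions -/

section Congruence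

variable {E : Type*} [Field E] {Q : ValuationSubring E} {a b c : E}

theorem mul_mem_nonunits (ha : a ∈ Q) (hb : b ∈ Q.nonunits) : a * b ∈ Q.nonunits :=
  Q.mem_nonunits_iff.2 <| by
    rw [map_mul]
    exact mul_lt_one_of_nonneg_of_lt_one_right ((Q.valuation_le_one_iff _).2 ha) zero_le hb

theorem mem_nonunits_or_of_mul (ha : a ∈ Q) (hb : b ∈ Q) (h : a * b ∈ Q.nonunits) :
    a ∈ Q.nonunits ∨ b ∈ Q.nonunits := by
  simp only [ValuationSubring.mem_nonunits_iff] at h ⊢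
  by_contra! h'
  have h1 := le_antisymm ((Q.valuation_le_one_iff _).2 ha) h'.1
  have h2 := le_antisymm ((Q.valuation_le_one_iff _).2 hb) h'.2
  rw [map_mul, h1, h2, mul_one] at h
  exact lt_irrefl _ h

theorem mem_nonunits_of_pow {n : ℕ} (h : a ^ n ∈ Q.nonunits) : a ∈ Q.nonunits := by
  simp only [ValuationSubring.mem_nonunits_iff, map_pow] at h ⊢
  by_contra! h'
  exact absurd h (not_lt.2 (one_le_pow₀ h'))

theorem one_notMem_nonunits : (1 : E) ∉ Q.nonunits := fun h => by
  have := Q.mem_nonunits_iff.1 h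
  simp at this

theorem sub_mem_nonunits_trans (h1 : a - b ∈ Q.nonunits) (h2 : b - c ∈ Q.nonunits) :
    a - c ∈ Q.nonunits := by
  have := Q.nonunits.add_mem h1 h2
  rwa [sub_add_sub_cancel] at this

theorem sub_mem_nonunits_symm (h1 : a - b ∈ Q.nonunits) : b - a ∈ Q.nonunits := by
  have := Q.nonunits.neg_mem h1
  rwa [neg_sub] at this

theorem mul_sub_mul_mem_nonunits {d : E} (hb : b ∈ Q) (hc : c ∈ Q)
    (h1 : a - b ∈ Q.nonunits) (h2 : c - d ∈ Q.nonunits) : a * c - b * d ∈ Q.nonunits := by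
  have := Q.nonunits.add_mem (mul_mem_nonunits hc h1) (mul_mem_nonunits hb h2)
  convert this using 1
  ring

theorem pow_sub_pow_mem_nonunits (ha : a ∈ Q) (hb : b ∈ Q) (h : a - b ∈ Q.nonunits) (n : ℕ) :
    a ^ n - b ^ n ∈ Q.nonunits := by
  obtain ⟨c, hc⟩ := sub_dvd_pow_sub_pow (⟨a, ha⟩ : Q) ⟨b, hb⟩ n
  have hc' : a ^ n - b ^ n = (a - b) * c := congrArg Subtype.val hc
  rw [hc', mul_comm]
  exact mul_mem_nonunits c.2 h

theorem pow_iterate_sub_mem_nonunits {N : ℕ} (hN : ∀ a ∈ Q, a ^ N - a ∈ Q.nonunits) (ha : a ∈ Q)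
    (r : ℕ) : a ^ N ^ r - a ∈ Q.nonunits := by
  induction r with
  | zero => simp
  | succ r ih =>
    rw [pow_succ, pow_mul]
    exact sub_mem_nonunits_trans (hN _ (pow_mem ha _)) ih

theorem prod_sub_pow_card_mem_nonunits {ι : Type*} (s : Finset ι) (f : ι → E) (ha : a ∈ Q)
    (hf : ∀ i ∈ s, f i ∈ Q) (h : ∀ i ∈ s, f i - a ∈ Q.nonunits) :
    ∏ i ∈ s, f i - a ^ s.card ∈ Q.nonunits := by
  classical
  induction s using Finset.induction_on with
  | empty => simp
  | insert i s hi ih =>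
    rw [Finset.prod_insert hi, Finset.card_insert_of_notMem hi, pow_succ']
    exact mul_sub_mul_mem_nonunits ha (prod_mem fun j hj => hf j (by simp [hj])) (h i (by simp))
      (ih (fun j hj => hf j (by simp [hj])) fun j hj => h j (by simp [hj]))

end Congruence

section Totally

variable {F E : Type*} [Field F] [Field E] [Algebra F E] {Q : ValuationSubring E} {p : ℕ}

/-- An element of `p`-power order in the inertia group is wildly ramified: the residue of `σ t / t`
has `p`-power order in the multiplicative group of a finite field of characteristic `p`. -/
theorem two_le_ord_apply_sub [IsDiscreteValuationRing Q]
    (hres : HasFiniteResidue p Q) {σ : E ≃ₐ[F] E} (hσ : σ ∈ inertiaAt F Q) {r : ℕ}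
    (hr : σ ^ p ^ r = 1) {t : E} (ht : t ∈ Q) (ht1 : ord Q t = 1) : 2 ≤ ord Q (σ t - t) := by
  obtain ⟨m, hm, hN⟩ := hres
  have ht0 : t ≠ 0 := by rintro rfl; rw [ord_zero] at ht1; exact absurd ht1 (by simp)
  have hσt : σ t ∈ Q := (hσ.1 t).2 ht
  obtain ⟨u, hu, hut⟩ := (ord_le_ord_iff ht hσt).1 (ord_apply_of_mem_inertiaAt hσ t).ge
  have hiter : ∀ n : ℕ, ∃ c ∈ Q, (σ ^ n) t = t * c ∧ c - u ^ n ∈ Q.nonunits := by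
    intro n
    induction n with
    | zero => exact ⟨1, Q.one_mem, by simp, by simp⟩
    | succ n ih =>
      obtain ⟨c, hc, h1, h2⟩ := ih
      refine ⟨u * σ c, Q.mul_mem _ _ hu ((hσ.1 c).2 hc), ?_, ?_⟩
      · rw [pow_succ', AlgEquiv.mul_apply, h1, map_mul, hut, mul_assoc]
      · rw [pow_succ']
        exact mul_sub_mul_mem_nonunits hu ((hσ.1 c).2 hc) (by simp)
          (sub_mem_nonunits_trans (hσ.2 c hc) h2)
  obtain ⟨c, hc, h1, h2⟩ := hiter (p ^ r)
  rw [hr, AlgEquiv.one_apply] at h1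
  have hc1 : c = 1 := mul_left_cancel₀ ht0 (by rw [← h1, mul_one])
  rw [hc1] at h2
  have h3 := pow_sub_pow_mem_nonunits Q.one_mem (pow_mem hu _) h2 (p ^ (m * r - r))
  have hmr : r ≤ m * r := Nat.le_mul_of_pos_left r hm
  rw [one_pow, ← pow_mul, ← pow_add, Nat.add_sub_cancel' hmr, pow_mul] at h3
  have h4 := sub_mem_nonunits_trans h3 (pow_iterate_sub_mem_nonunits hN hu r)
  have h5 : σ t - t = t * (u - 1) := by rw [hut]; ring
  rw [h5, ord_mul ht (Q.sub_mem hu Q.one_mem), ht1]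
  have := one_le_ord_iff.2 (sub_mem_nonunits_symm h4)
  calc (2 : ℕ∞) = 1 + 1 := by norm_num
    _ ≤ _ := by gcongr

/-- An element whose conjugates all lie in `Q` is integral over the ring below `Q`. -/
theorem isIntegral_of_forall_apply_mem [FiniteDimensional F E] [IsGalois F E]
    {a : E} (hσ : ∀ σ : E ≃ₐ[F] E, σ a ∈ Q) : IsIntegral (below F Q) a := by
  let g : E[X] := ∏ σ : E ≃ₐ[F] E, (X - C (σ a))
  have hg : g.Monic := monic_prod_of_monic _ _ fun σ _ => monic_X_sub_C _
  have hgQ : g = (∏ σ : E ≃ₐ[F] E, (X - C (⟨σ a, hσ σ⟩ : Q))).map (algebraMap Q E) := by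
    rw [Polynomial.map_prod]
    refine Finset.prod_congr rfl fun σ _ => ?_
    rw [Polynomial.map_sub, map_X, map_C]
    rfl
  have hgF : ∀ n, ∃ c : below F Q, algebraMap (below F Q) E c = g.coeff n := by
    intro n
    obtain ⟨c, hc⟩ : g.coeff n ∈ Set.range (algebraMap F E) := by
      rw [IsGalois.mem_range_algebraMap_iff_fixed]
      intro τ
      have : g.map (τ : E →+* E) = g := by
        rw [Polynomial.map_prod]
        refine (Finset.prod_congr rfl fun σ _ => ?_).trans
          (Equiv.prod_comp (Equiv.mulLeft τ) fun σ : E ≃ₐ[F] E => X - C (σ a))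
        rw [Polynomial.map_sub, map_X, map_C]
        rfl
      conv_rhs => rw [← this]
      rw [coeff_map]
      rfl
    have hcQ : algebraMap F E c ∈ Q := by
      rw [hc, hgQ, coeff_map]
      exact Subtype.property _
    exact ⟨⟨c, hcQ⟩, hc⟩
  have hlift : g ∈ Polynomial.lifts (algebraMap (below F Q) E) := by
    rw [Polynomial.lifts_iff_coeff_lifts]; exact hgF
  obtain ⟨g', hg', -, hm⟩ := Polynomial.lifts_and_natDegree_eq_and_monic hlift hg
  refine ⟨g', hm, ?_⟩
  rw [← eval_map, hg', eval_prod]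
  exact Finset.prod_eq_zero (Finset.mem_univ 1) (by simp)

/-- If the Galois group is a `p`-group acting by inertia at `Q`, then `Q` is generated over the ring
below it by a uniformizer. Residues are lifted by norms of suitable `p`-powers, and Nakayama's lemma
applies as the norm of the uniformizer has order the degree. -/
theorem mem_adjoin_uniformizer [FiniteDimensional F E] [IsGalois F E] [IsDiscreteValuationRing Q]
    (hp : p.Prime) (hres : HasFiniteResidue p Q) (hI : inertiaAt F Q = ⊤)
    (hG : IsPGroup p (E ≃ₐ[F] E)) {t : E} (ht : t ∈ Q) (ht1 : ord Q t = 1) {a : E} (ha : a ∈ Q) :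
    a ∈ Algebra.adjoin (below F Q) {t} := by
  have := isDVR_below (F := F) Q
  have : Fact p.Prime := ⟨hp⟩
  have hmem : ∀ σ : E ≃ₐ[F] E, σ ∈ inertiaAt F Q := fun σ => hI ▸ Subgroup.mem_top σ
  have hσ : ∀ σ : E ≃ₐ[F] E, ∀ b ∈ Q, σ b ∈ Q := fun σ b hb => ((hmem σ).1 b).2 hb
  obtain ⟨m, hm, hN⟩ := hres
  obtain ⟨r, hr⟩ := IsPGroup.iff_card.1 hG
  have hr' : (Finset.univ : Finset (E ≃ₐ[F] E)).card = p ^ r := by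
    rw [Finset.card_univ, ← Nat.card_eq_fintype_card, hr]
  -- Every residue is the residue of a norm.
  have hlift : ∀ a ∈ Q, ∃ c : below F Q, a - algebraMap F E c ∈ Q.nonunits := by
    intro a ha
    have hb : a ^ p ^ (m * r - r) ∈ Q := pow_mem ha _
    have hn := Algebra.norm_eq_prod_automorphisms F (a ^ p ^ (m * r - r))
    refine ⟨⟨Algebra.norm F (a ^ p ^ (m * r - r)), ?_⟩, ?_⟩
    · rw [ValuationSubring.mem_comap, hn]
      exact prod_mem fun σ _ => hσ σ _ hb
    · change a - algebraMap F E (Algebra.norm F (a ^ p ^ (m * r - r))) ∈ _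
      rw [hn]
      have h1 := prod_sub_pow_card_mem_nonunits Finset.univ
        (fun σ : E ≃ₐ[F] E => σ (a ^ p ^ (m * r - r))) hb (fun σ _ => hσ σ _ hb)
        (fun σ _ => (hmem σ).2 _ hb)
      have hmr : r ≤ m * r := Nat.le_mul_of_pos_left r hm
      rw [hr', ← pow_mul, ← pow_add, Nat.sub_add_cancel hmr, pow_mul] at h1
      exact sub_mem_nonunits_symm
        (sub_mem_nonunits_trans h1 (pow_iterate_sub_mem_nonunits hN ha r))
  -- expansions in powers of `t`
  have hexp : ∀ B : ℕ, ∀ a ∈ Q, ∃ s ∈ Algebra.adjoin (below F Q) {t}, ∃ b ∈ Q,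
      a = s + t ^ B * b := by
    intro B
    induction B with
    | zero => exact fun a ha => ⟨0, zero_mem _, a, ha, by simp⟩
    | succ B ih =>
      intro a ha
      obtain ⟨s, hs, b, hb, rfl⟩ := ih a ha
      obtain ⟨c, hc⟩ := hlift b hb
      obtain ⟨d, hd, hbd⟩ := (ord_le_ord_iff ht (Q.nonunits_subset hc)).1
        (ht1.le.trans (one_le_ord_iff.2 hc))
      have htB : t ^ B ∈ Algebra.adjoin (below F Q) {t} :=
        pow_mem (Algebra.subset_adjoin (Set.mem_singleton t)) B
      have hcA : algebraMap F E c ∈ Algebra.adjoin (below F Q) {t} :=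
        Subalgebra.algebraMap_mem (Algebra.adjoin (below F Q) {t}) c
      refine ⟨s + t ^ B * algebraMap F E c,
        Subalgebra.add_mem _ hs (Subalgebra.mul_mem _ htB hcA), d, hd, ?_⟩
      rw [pow_succ, mul_assoc, ← hbd]; ring
  have hint : ∀ b ∈ Q, IsIntegral (below F Q) b := fun b hb =>
    isIntegral_of_forall_apply_mem fun σ => hσ σ b hb
  let N : Submodule (below F Q) E := Subalgebra.toSubmodule (intClosure E (below F Q))
  let S : Submodule (below F Q) E := Subalgebra.toSubmodule (Algebra.adjoin (below F Q) {t})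
  have hfin : Module.Finite (below F Q) (intClosure E (below F Q)) :=
    IsIntegralClosure.finite (below F Q) F E (intClosure E (below F Q))
  have hNfg : N.FG := by
    have h : N = (⊤ : Submodule (below F Q) (intClosure E (below F Q))).map
        (intClosure E (below F Q)).val.toLinearMap := by
      ext x
      simp [N]
    rw [h]
    exact hfin.fg_top.map _
  have hNS : N ≤ S := by
    refine Submodule.le_of_le_smul_of_le_jacobson_bot
      (I := IsLocalRing.maximalIdeal (below F Q)) hNfg
      (IsLocalRing.maximalIdeal_le_jacobson _) ?_
    intro a ha
    have haQ : a ∈ Q := mem_of_mem_intClosure Q ha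
    -- `t ^ (p ^ r)` is divisible by the norm of `t`, which lies in the maximal ideal below
    obtain ⟨s, hs, b, hb, rfl⟩ := hexp (p ^ r) a haQ
    refine Submodule.add_mem_sup hs ?_
    have hn := Algebra.norm_eq_prod_automorphisms F t
    have hnQ : algebraMap F E (Algebra.norm F t) ∈ Q := by
      rw [hn]; exact prod_mem fun σ _ => hσ σ _ ht
    have hnord : ord Q (algebraMap F E (Algebra.norm F t)) = (p ^ r : ℕ) := by
      rw [hn, ord_prod _ _ fun σ _ => hσ σ _ ht]
      simp only [ord_apply_of_mem_inertiaAt (hmem _), ht1, Finset.sum_const, hr', nsmul_eq_mul,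
        mul_one]
    obtain ⟨d, hd, htd⟩ := (ord_le_ord_iff hnQ (Q.mul_mem _ _ (pow_mem ht (p ^ r)) hb)).1 (by
      rw [hnord, ord_mul (pow_mem ht _) hb, ord_pow ht, ht1, mul_one]; exact le_self_add)
    have hnm : (⟨Algebra.norm F t, hnQ⟩ : below F Q) ∈
        IsLocalRing.maximalIdeal (below F Q) := by
      rw [← ValuationSubring.coe_mem_nonunits_iff]
      refine (algebraMap_mem_nonunits_iff Q).1 (one_le_ord_iff.1 ?_)
      rw [hnord]
      exact_mod_cast Nat.one_le_iff_ne_zero.2 (pow_ne_zero r hp.ne_zero)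
    rw [htd]
    have hdN : d ∈ N := hint d hd
    have hsm : algebraMap F E (Algebra.norm F t) * d =
        (⟨Algebra.norm F t, hnQ⟩ : below F Q) • d := (Algebra.smul_def _ _).symm
    rw [hsm]
    exact Submodule.smul_mem_smul hnm hdN
  exact hNS (hint a ha)

/-- If `Γ` is a `p`-group of inertial automorphisms, every element of `Q` is a polynomial in a
uniformizer with coefficients that are integral at `Q` and fixed by `Γ`. -/
theorem exists_polynomial_uniformizer [FiniteDimensional F E] [IsGalois F E]
    [IsDiscreteValuationRing Q] (hp : p.Prime) (hres : HasFiniteResidue p Q)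
    {Γ : Subgroup (E ≃ₐ[F] E)} (hΓI : Γ ≤ inertiaAt F Q) (hΓ : IsPGroup p Γ)
    {t : E} (ht : t ∈ Q) (ht1 : ord Q t = 1) {a : E} (ha : a ∈ Q) :
    ∃ g : Q[X], (∀ σ ∈ Γ, ∀ n, σ (g.coeff n) = g.coeff n) ∧ g.eval ⟨t, ht⟩ = ⟨a, ha⟩ := by
  let L := IntermediateField.fixedField Γ
  have hL : L.fixingSubgroup = Γ := IntermediateField.fixingSubgroup_fixedField Γ
  have hmem : ∀ σ : E ≃ₐ[L] E, σ.restrictScalars F ∈ Γ := by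
    intro σ
    rw [← hL]
    exact ((IntermediateField.fixingSubgroupEquiv L).symm σ).2
  have hI : inertiaAt L Q = ⊤ := by
    refine eq_top_iff.2 fun σ _ => ?_
    exact hΓI (hmem σ)
  have hG : IsPGroup p (E ≃ₐ[L] E) :=
    (hL ▸ hΓ : IsPGroup p L.fixingSubgroup).of_equiv (IntermediateField.fixingSubgroupEquiv L)
  have h := mem_adjoin_uniformizer hp hres hI hG ht ht1 ha
  rw [Algebra.adjoin_singleton_eq_range_aeval] at h
  obtain ⟨g, hg⟩ := h
  let φ : below L Q →+* Q := (algebraMap L E).restrict (below L Q) Q fun x hx => hx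
  refine ⟨g.map φ, fun σ hσ n => ?_, ?_⟩
  · rw [coeff_map]
    exact ((g.coeff n : L)).2 ⟨σ, hσ⟩
  · apply Subtype.ext
    change algebraMap Q E ((g.map φ).eval ⟨t, ht⟩) = a
    rw [← hg, eval_map, hom_eval₂]
    rfl

/-- The element `σ t - t`, for a uniformizer `t`, divides every `σ a - a` with `a` integral. -/
theorem ord_apply_uniformizer_sub_le [FiniteDimensional F E] [IsGalois F E]
    [IsDiscreteValuationRing Q] (hp : p.Prime) (hres : HasFiniteResidue p Q)
    {Γ : Subgroup (E ≃ₐ[F] E)} (hΓI : Γ ≤ inertiaAt F Q) (hΓ : IsPGroup p Γ)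
    {t : E} (ht : t ∈ Q) (ht1 : ord Q t = 1) {σ : E ≃ₐ[F] E} (hσ : σ ∈ Γ) {a : E} (ha : a ∈ Q) :
    ord Q (σ t - t) ≤ ord Q (σ a - a) := by
  obtain ⟨g, hg, hga⟩ := exists_polynomial_uniformizer hp hres hΓI hΓ ht ht1 ha
  have hσt : σ t ∈ Q := ((hΓI hσ).1 t).2 ht
  have hσa : σ a ∈ Q := ((hΓI hσ).1 a).2 ha
  obtain ⟨c, hc⟩ := sub_dvd_eval_sub (⟨σ t, hσt⟩ : Q) ⟨t, ht⟩ g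
  have h1 : ((g.eval ⟨t, ht⟩ : Q) : E) = a := by rw [hga]
  have h2 : ((g.eval ⟨σ t, hσt⟩ : Q) : E) = σ a := by
    have e1 : ∀ x : Q, ((g.eval x : Q) : E) = g.sum fun n c => (c : E) * (x : E) ^ n := by
      intro x
      rw [eval_eq_sum, Polynomial.sum, Polynomial.sum]
      push_cast
      rfl
    rw [← h1, e1, e1, Polynomial.sum, Polynomial.sum, map_sum]
    refine Finset.sum_congr rfl fun n _ => ?_
    rw [map_mul, map_pow, hg σ hσ]
  refine (ord_le_ord_iff (Q.sub_mem hσt ht) (Q.sub_mem hσa ha)).2 ⟨c, c.2, ?_⟩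
  rw [← h2, ← h1]
  exact congrArg Subtype.val hc

end Totally

/-! ### Tate's inequality for inertial automorphisms -/

section Tate

variable {F E : Type*} [Field F] [Field E] [Algebra F E] {Q : ValuationSubring E} {p : ℕ}
  [FiniteDimensional F E] [IsGalois F E] [IsDiscreteValuationRing Q]

/-- An inertial automorphism in a `p`-group that fixes a uniformizer is trivial. -/
theorem eq_one_of_apply_uniformizer_eq (hp : p.Prime) (hres : HasFiniteResidue p Q)
    {Γ : Subgroup (E ≃ₐ[F] E)} (hΓI : Γ ≤ inertiaAt F Q) (hΓ : IsPGroup p Γ)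
    {t : E} (ht : t ∈ Q) (ht1 : ord Q t = 1) {σ : E ≃ₐ[F] E} (hσ : σ ∈ Γ) (h : σ t = t) :
    σ = 1 := by
  have key : ∀ a ∈ Q, σ a = a := by
    intro a ha
    have := ord_apply_uniformizer_sub_le hp hres hΓI hΓ ht ht1 hσ ha
    rw [h, sub_self, ord_zero, top_le_iff, ord_eq_top_iff, sub_eq_zero] at this
    exact this
  ext a
  rcases Q.mem_or_inv_mem a with ha | ha
  · exact key a ha
  · have := key _ ha
    rw [map_inv₀] at this
    exact inv_injective this

/-- Tate's argument: the contributions of a coset `σ N` at the uniformizer add up to at most the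
order of `σ ζ - ζ`, for every integral `ζ` fixed by `N`. Writing `ζ = g(t)`, the product of the
`X - h t` with `h ∈ N` divides `g - ζ`; apply `σ` to the coefficients and evaluate at `t`. -/
theorem sum_ord_apply_sub_le (hp : p.Prime) (hres : HasFiniteResidue p Q)
    {Γ : Subgroup (E ≃ₐ[F] E)} (hΓI : Γ ≤ inertiaAt F Q) (hΓ : IsPGroup p Γ)
    {t : E} (ht : t ∈ Q) (ht1 : ord Q t = 1) {σ : E ≃ₐ[F] E} (hσ : σ ∈ Γ)
    (N : Finset (E ≃ₐ[F] E)) (hN : ∀ h ∈ N, h ∈ Γ)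
    {ζ : E} (hζ : ζ ∈ Q) (hNζ : ∀ h ∈ N, h ζ = ζ) :
    ∑ h ∈ N, ord Q (σ (h t) - t) ≤ ord Q (σ ζ - ζ) := by
  obtain ⟨g, hg, hgζ⟩ := exists_polynomial_uniformizer hp hres hΓI hΓ ht ht1 hζ
  have hmem : ∀ τ ∈ Γ, ∀ a ∈ Q, τ a ∈ Q := fun τ hτ a ha => ((hΓI hτ).1 a).2 ha
  have heval : ∀ τ ∈ Γ, ∀ (x : E) (hx : x ∈ Q) (hτx : τ x ∈ Q),
      ((g.eval ⟨τ x, hτx⟩ : Q) : E) = τ ((g.eval ⟨x, hx⟩ : Q) : E) := by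
    intro τ hτ x hx hτx
    have e1 : ∀ x : Q, ((g.eval x : Q) : E) = g.sum fun n c => (c : E) * (x : E) ^ n := by
      intro x
      rw [eval_eq_sum, Polynomial.sum, Polynomial.sum]
      push_cast
      rfl
    rw [e1, e1, Polynomial.sum, Polynomial.sum, map_sum]
    refine Finset.sum_congr rfl fun n _ => ?_
    rw [map_mul, map_pow, hg τ hτ]
  -- The conjugates of the uniformizer under `N`, as elements of `Q`.
  let c : (E ≃ₐ[F] E) → Q := fun h =>
    open Classical in if hh : h ∈ Γ then ⟨h t, hmem h hh t ht⟩ else 0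
  have hc : ∀ h ∈ Γ, (c h : E) = h t := fun h hh => by simp [c, hh]
  have hcinj : ∀ h ∈ N, ∀ h' ∈ N, c h = c h' → h = h' := by
    intro h hh h' hh' heq
    have h1 : h t = h' t := by rw [← hc h (hN h hh), ← hc h' (hN h' hh'), heq]
    have h2 := eq_one_of_apply_uniformizer_eq hp hres hΓI hΓ ht ht1
      (Γ.mul_mem (Γ.inv_mem (hN h hh)) (hN h' hh'))
      (by rw [AlgEquiv.mul_apply, ← h1]; exact AlgEquiv.symm_apply_apply h t)
    exact inv_mul_eq_one.1 h2
  obtain ⟨k, hk⟩ : (∏ h ∈ N, (X - C (c h))) ∣ g - C ⟨ζ, hζ⟩ := by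
    by_cases h0 : g - C ⟨ζ, hζ⟩ = 0
    · rw [h0]; exact dvd_zero _
    have : (∏ h ∈ N, (X - C (c h))) = ((N.val.map c).map fun a => X - C a).prod := by
      rw [Multiset.map_map]; rfl
    rw [this, Multiset.prod_X_sub_C_dvd_iff_le_roots h0, Multiset.le_iff_subset
      ((Multiset.nodup_map_iff_inj_on N.nodup).2 hcinj)]
    intro a ha
    obtain ⟨h, hh, rfl⟩ := Multiset.mem_map.1 ha
    rw [mem_roots h0, IsRoot.def, eval_sub, eval_C, sub_eq_zero]
    apply Subtype.ext
    have hhΓ := hN h hh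
    have e : c h = ⟨h t, hmem h hhΓ t ht⟩ := Subtype.ext (hc h hhΓ)
    rw [e, heval h hhΓ t ht, hgζ]
    exact hNζ h hh
  -- Evaluate the image of the factorization under `σ` at `t`.
  have hσt := hmem σ hσ t ht
  have hk' := congrArg (fun f : Q[X] => (f.map (algebraMap Q E)).map (σ : E →+* E)) hk
  simp only [Polynomial.map_sub, Polynomial.map_mul, Polynomial.map_prod, map_C, map_X] at hk'
  have hk2 := congrArg (fun f : E[X] => f.eval t) hk'
  simp only [eval_sub, eval_mul, eval_prod, eval_C, eval_X] at hk2
  have hgmap : (g.map (algebraMap Q E)).map (σ : E →+* E) = g.map (algebraMap Q E) := by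
    ext n
    rw [coeff_map, coeff_map]
    exact hg σ hσ n
  have hgt : (g.map (algebraMap Q E)).eval t = ζ := by
    have h1 : t = algebraMap Q E ⟨t, ht⟩ := rfl
    rw [h1, eval_map_algebraMap, aeval_algebraMap_apply, coe_aeval_eq_eval, hgζ]
    rfl
  have hkmem : ((k.map (algebraMap Q E)).map (σ : E →+* E)).eval t ∈ Q := by
    rw [eval_eq_sum_range]
    refine sum_mem fun n _ => Q.mul_mem _ _ ?_ (pow_mem ht n)
    rw [coeff_map, coeff_map]
    exact hmem σ hσ _ (k.coeff n).2
  rw [hgmap, hgt] at hk2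
  have hfac : ∀ h ∈ N, t - σ (c h) ∈ Q := fun h hh =>
    Q.sub_mem ht (hmem σ hσ _ (c h).2)
  have hprod : ∏ h ∈ N, (t - σ (c h)) ∈ Q := prod_mem hfac
  have hk3 : ζ - σ ζ = (∏ h ∈ N, (t - σ (c h))) *
      ((k.map (algebraMap Q E)).map (σ : E →+* E)).eval t := hk2
  rw [ord_sub_comm (x := σ ζ), hk3, ord_mul hprod hkmem, ord_prod N _ hfac]
  refine le_trans (le_of_eq ?_) le_self_add
  refine Finset.sum_congr rfl fun h hh => ?_
  rw [ord_sub_comm, hc h (hN h hh)]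

/-- If some nontrivial element of a `p`-group `Γ` of inertial automorphisms moves the uniformizer to
order at least `3`, and `σ` does so to the highest possible order, then `σ` moves every integral
element fixed by a subset `N` of `Γ` to order more than `2 |N|`. -/
theorem two_mul_card_lt_ord_apply_sub (hp : p.Prime) (hres : HasFiniteResidue p Q)
    {Γ : Subgroup (E ≃ₐ[F] E)} (hΓI : Γ ≤ inertiaAt F Q) (hΓ : IsPGroup p Γ)
    {t : E} (ht : t ∈ Q) (ht1 : ord Q t = 1) {σ : E ≃ₐ[F] E} (hσ : σ ∈ Γ)
    (h3 : 3 ≤ ord Q (σ t - t))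
    (hmax : ∀ τ ∈ Γ, τ ≠ 1 → ord Q (τ t - t) ≤ ord Q (σ t - t))
    (N : Finset (E ≃ₐ[F] E)) (hN : ∀ h ∈ N, h ∈ Γ) (hN1 : 1 ∈ N)
    {ζ : E} (hζ : ζ ∈ Q) (hNζ : ∀ h ∈ N, h ζ = ζ) :
    ((2 * N.card + 1 : ℕ) : ℕ∞) ≤ ord Q (σ ζ - ζ) := by
  classical
  refine le_trans ?_ (sum_ord_apply_sub_le hp hres hΓI hΓ ht ht1 hσ N hN hζ hNζ)
  have hterm : ∀ h ∈ N.erase 1, 2 ≤ ord Q (σ (h t) - t) := by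
    intro h hh
    have hhΓ := hN h (Finset.mem_of_mem_erase hh)
    have h1 : h ≠ 1 := Finset.ne_of_mem_erase hh
    have hht : h t ∈ Q := ((hΓI hhΓ).1 t).2 ht
    obtain ⟨r, hr⟩ := hΓ ⟨h, hhΓ⟩
    have h2 := two_le_ord_apply_sub hres (hΓI hhΓ) (r := r) (congrArg Subtype.val hr) ht ht1
    have e : σ (h t) - t = σ (h t - t) + (σ t - t) := by rw [map_sub]; ring
    have hσt : σ t ∈ Q := ((hΓI hσ).1 t).2 ht
    rw [e]
    refine le_trans ?_ (min_le_ord_add (((hΓI hσ).1 _).2 (Q.sub_mem hht ht)) (Q.sub_mem hσt ht))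
    rw [ord_apply_of_mem_inertiaAt (hΓI hσ), min_eq_left (hmax h hhΓ h1)]
    exact h2
  rw [← Finset.add_sum_erase N _ hN1]
  have hsum : ((2 * (N.card - 1) : ℕ) : ℕ∞) ≤ ∑ h ∈ N.erase 1, ord Q (σ (h t) - t) := by
    refine le_trans (le_of_eq ?_) (Finset.sum_le_sum hterm)
    rw [Finset.sum_const, Finset.card_erase_of_mem hN1, nsmul_eq_mul]
    push_cast
    ring
  have hpos : 1 ≤ N.card := Finset.card_pos.2 ⟨1, hN1⟩
  calc ((2 * N.card + 1 : ℕ) : ℕ∞) = ((3 + 2 * (N.card - 1) : ℕ) : ℕ∞) := by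
        congr 1; omega
    _ = 3 + ((2 * (N.card - 1) : ℕ) : ℕ∞) := by push_cast; rfl
    _ ≤ _ := add_le_add (by simpa using h3) hsum

end Tate

section Maximal

variable {F E : Type*} [Field F] [Field E] [Algebra F E] {Q : ValuationSubring E}
  [FiniteDimensional F E] [IsDiscreteValuationRing Q]

/-- In a finite `p`-group of inertial automorphisms with an element violating weak ramification
there is one that moves the uniformizer to the highest order among the nontrivial elements. -/
theorem exists_maximal_ord_apply_sub {Γ : Subgroup (E ≃ₐ[F] E)}
    {t : E} {σ₀ : E ≃ₐ[F] E} (hσ₀ : σ₀ ∈ Γ) (h1 : σ₀ ≠ 1) (h3 : 3 ≤ ord Q (σ₀ t - t)) :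
    ∃ σ ∈ Γ, σ ≠ 1 ∧ 3 ≤ ord Q (σ t - t) ∧
      ∀ τ ∈ Γ, τ ≠ 1 → ord Q (τ t - t) ≤ ord Q (σ t - t) := by
  obtain ⟨σ, ⟨hσ, hσ1⟩, hmax⟩ := (Set.toFinite {τ : E ≃ₐ[F] E | τ ∈ Γ ∧ τ ≠ 1}).exists_maximalFor
    (fun τ => ord Q (τ t - t)) _ ⟨σ₀, hσ₀, h1⟩
  have hmax' : ∀ τ ∈ Γ, τ ≠ 1 → ord Q (τ t - t) ≤ ord Q (σ t - t) := fun τ hτ hτ1 => by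
    rcases le_total (ord Q (τ t - t)) (ord Q (σ t - t)) with h | h
    · exact h
    · exact hmax ⟨hτ, hτ1⟩ h
  exact ⟨σ, hσ, hσ1, h3.trans (hmax' σ₀ hσ₀ h1), hmax'⟩

end Maximal

/-! ### Discrete valuation rings as localizations of Dedekind domains -/

section Dedekind

open IsDedekindDomain

variable {B E : Type*} [CommRing B] [IsDedekindDomain B] [Field E] [Algebra B E]
  [IsFractionRing B E] {Q : ValuationSubring E}

/-- A proper valuation ring of the fraction field of a Dedekind domain `B` that contains `B` is the
localization of `B` at a nonzero prime ideal. -/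
theorem exists_eq_valuationSubringAtPrime (hB : ∀ b : B, algebraMap B E b ∈ Q) (hQ : Q ≠ ⊤) :
    ∃ v : HeightOneSpectrum B, (∀ b, b ∈ v.asIdeal ↔ algebraMap B E b ∈ Q.nonunits) ∧
      v.valuationSubringAtPrime E = Q := by
  let I : Ideal B :=
    { carrier := {b | algebraMap B E b ∈ Q.nonunits}
      add_mem' := fun {a b} ha hb => by
        change algebraMap B E (a + b) ∈ Q.nonunits
        rw [map_add]; exact Q.nonunits.add_mem ha hb
      zero_mem' := by simp
      smul_mem' := fun c b hb => by
        change algebraMap B E (c * b) ∈ Q.nonunits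
        rw [map_mul]; exact mul_mem_nonunits (hB c) hb }
  have hmem : ∀ b, b ∈ I ↔ algebraMap B E b ∈ Q.nonunits := fun b => Iff.rfl
  have hprime : I.IsPrime := by
    refine Ideal.isPrime_iff.2 ⟨fun h => ?_, fun {a b} h => ?_⟩
    · have := (hmem 1).1 (h ▸ Submodule.mem_top)
      rw [map_one] at this
      exact one_notMem_nonunits this
    · rw [hmem, map_mul] at h
      exact mem_nonunits_or_of_mul (hB a) (hB b) h
  have hinv : ∀ b, b ∉ I → (algebraMap B E b)⁻¹ ∈ Q := by
    intro b hb
    by_contra h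
    rw [hmem, ValuationSubring.mem_nonunits_iff_or] at hb
    exact hb (Or.inr h)
  have hne : I ≠ ⊥ := by
    intro h
    apply hQ
    rw [eq_top_iff]
    intro x _
    obtain ⟨a, b, hb, rfl⟩ := IsFractionRing.div_surjective B x
    have hb0 : b ∉ I := by
      rw [h, Ideal.mem_bot]; exact nonZeroDivisors.ne_zero hb
    rw [div_eq_mul_inv]
    exact Q.mul_mem _ _ (hB a) (hinv b hb0)
  let v : HeightOneSpectrum B := ⟨I, hprime, hne⟩
  refine ⟨v, hmem, ?_⟩
  refine ValuationSubring.eq_of_le_of_ne_top _ ?_ hQ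
  rintro x ⟨a, s, hs, rfl⟩
  exact Q.mul_mem _ _ (hB a) (hinv s hs)

theorem isDVR_of_dedekind (hB : ∀ b : B, algebraMap B E b ∈ Q) (hQ : Q ≠ ⊤) :
    IsDiscreteValuationRing Q := by
  obtain ⟨v, -, rfl⟩ := exists_eq_valuationSubringAtPrime hB hQ
  have : IsLocalization.AtPrime (v.valuationSubringAtPrime E) v.asIdeal :=
    inferInstanceAs (IsLocalization v.asIdeal.primeCompl _)
  exact IsLocalization.AtPrime.isDiscreteValuationRing_of_dedekind_domain B v.ne_bot _

theorem exists_mul_eq_of_dedekind (hB : ∀ b : B, algebraMap B E b ∈ Q) (hQ : Q ≠ ⊤) {a : E}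
    (ha : a ∈ Q) : ∃ b c : B, algebraMap B E c ∉ Q.nonunits ∧
      a * algebraMap B E c = algebraMap B E b := by
  obtain ⟨v, hv, rfl⟩ := exists_eq_valuationSubringAtPrime hB hQ
  obtain ⟨b, s, hs, rfl⟩ := ha
  refine ⟨b, s, fun h => hs ((hv s).2 h), ?_⟩
  have hs0 : s ≠ 0 := fun h => hs (h ▸ v.asIdeal.zero_mem)
  have : algebraMap B E s ≠ 0 := by
    simpa using hs0
  field_simp

/-- The powers of the prime ideal of `B` below `Q` are cut out by the order function. -/
theorem mem_pow_iff_le_ord [IsDiscreteValuationRing Q] (hB : ∀ b : B, algebraMap B E b ∈ Q)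
    {I : Ideal B} (hI : ∀ b, b ∈ I ↔ algebraMap B E b ∈ Q.nonunits) (n : ℕ) (b : B) :
    b ∈ I ^ n ↔ (n : ℕ∞) ≤ ord Q (algebraMap B E b) := by
  have hQ := ne_top_of_isDVR Q
  obtain ⟨v, hv, -⟩ := exists_eq_valuationSubringAtPrime hB hQ
  have hIv : I = v.asIdeal := Ideal.ext fun b => (hI b).trans (hv b).symm
  have hIp : I.IsPrime := hIv ▸ v.isPrime
  obtain ⟨t, ht, ht1⟩ := exists_ord_eq_one Q
  constructor
  · intro hb
    induction n generalizing b with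
    | zero => simp
    | succ n ih =>
      rw [pow_succ] at hb
      refine Submodule.mul_induction_on hb (fun x hx y hy => ?_) fun x y hx hy => ?_
      · rw [map_mul, ord_mul (hB _) (hB _)]
        push_cast
        exact add_le_add (ih x hx) (one_le_ord_iff.2 ((hI y).1 hy))
      · rw [map_add]
        exact (le_min hx hy).trans (min_le_ord_add (hB _) (hB _))
  · intro hb
    obtain ⟨a, ha, hba⟩ := (natCast_le_ord_iff ht ht1 (hB b) n).1 hb
    obtain ⟨t', c, hc, htc⟩ := exists_mul_eq_of_dedekind hB hQ ht
    obtain ⟨a', d, hd, had⟩ := exists_mul_eq_of_dedekind hB hQ ha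
    have ht' : t' ∈ I := by
      rw [hI, ← htc, mul_comm]
      exact mul_mem_nonunits (hB c) (one_le_ord_iff.1 ht1.ge)
    have h1 : c ^ n * d * b = t' ^ n * a' := by
      apply IsFractionRing.injective B E
      simp only [map_mul, map_pow, ← htc, ← had, hba]
      ring
    have h2 : c ^ n * d * b ∈ I ^ n := h1 ▸ Ideal.mul_mem_right _ _ (Ideal.pow_mem_pow ht' n)
    refine (Ideal.IsPrime.mul_mem_pow I h2).resolve_left fun h => ?_
    rcases hIp.mem_or_mem h with h | h
    · exact hc ((hI c).1 (hIp.mem_of_pow_mem n h))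
    · exact hd ((hI d).1 h)

end Dedekind

theorem HasFiniteResidue.finite {K : Type*} [Field K] {P : ValuationSubring K} {p : ℕ}
    (hp : p.Prime) (hres : HasFiniteResidue p P) : Finite (IsLocalRing.ResidueField P) := by
  obtain ⟨m, hm, hN⟩ := hres
  have hf : (X ^ p ^ m - X : (IsLocalRing.ResidueField P)[X]) ≠ 0 :=
    FiniteField.X_pow_card_pow_sub_X_ne_zero _ (by omega) hp.one_lt
  refine Set.finite_univ_iff.1 ((Multiset.finite_toSet
    (X ^ p ^ m - X : (IsLocalRing.ResidueField P)[X]).roots).subset fun x _ => ?_)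
  obtain ⟨a, rfl⟩ := IsLocalRing.residue_surjective x
  rw [Set.mem_ofPred_eq, mem_roots hf, IsRoot.def, eval_sub, eval_pow, eval_X, ← map_pow,
    ← map_sub, IsLocalRing.residue_eq_zero_iff, ← ValuationSubring.coe_mem_nonunits_iff]
  exact hN a a.2

theorem HasFiniteResidue.finite_residueField {K : Type*} [Field K] {P : ValuationSubring K} {p : ℕ}
    (hp : p.Prime) (hres : HasFiniteResidue p P) :
    Finite (IsLocalRing.maximalIdeal P).ResidueField := by
  have hfin : Finite (P ⧸ IsLocalRing.maximalIdeal P) := hres.finite hp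
  exact Finite.of_surjective _
    (Ideal.bijective_algebraMap_quotient_residueField (IsLocalRing.maximalIdeal P)).2

/-! ### The semilocal ring of integers above a place -/

section Semilocal

variable {F E : Type*} [Field F] [Field E] [Algebra F E]
  {Q : ValuationSubring E}

theorem mem_center_iff {b : intClosure E (below F Q)} :
    b ∈ center F Q ↔ algebraMap (intClosure E (below F Q)) E b ∈ Q.nonunits := Iff.rfl

theorem algebraMap_intClosure_mem (b : intClosure E (below F Q)) :
    algebraMap (intClosure E (below F Q)) E b ∈ Q := mem_of_mem_intClosure Q b.2

variable (F Q) in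
theorem center_isPrime : (center F Q).IsPrime := by
  refine Ideal.isPrime_iff.2 ⟨fun h => ?_, fun {a b} h => ?_⟩
  · have : (1 : intClosure E (below F Q)) ∈ center F Q := h ▸ Submodule.mem_top
    exact one_notMem_nonunits this
  · exact mem_nonunits_or_of_mul (algebraMap_intClosure_mem a) (algebraMap_intClosure_mem b) h

variable (F Q) in
theorem center_liesOver : (center F Q).LiesOver (IsLocalRing.maximalIdeal (below F Q)) := by
  refine ⟨Ideal.ext fun x => ?_⟩
  rw [← ValuationSubring.coe_mem_nonunits_iff, ← algebraMap_mem_nonunits_iff]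
  rfl

variable [FiniteDimensional F E]

variable (F Q) in
theorem isFractionRing_intClosure : IsFractionRing (intClosure E (below F Q)) E :=
  integralClosure.isFractionRing_of_finite_extension F E

variable [IsGalois F E]

variable (F Q) in
theorem isDedekindDomain_intClosure [IsDiscreteValuationRing Q] :
    IsDedekindDomain (intClosure E (below F Q)) := by
  have := isDVR_below (F := F) Q
  exact integralClosure.isDedekindDomain (below F Q) F E

variable (F Q) in
theorem isGaloisGroup_intClosure :
    IsGaloisGroup (E ≃ₐ[F] E) (below F Q) (intClosure E (below F Q)) := by
  have := isFractionRing_intClosure F Q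
  exact IsGaloisGroup.of_isFractionRing _ _ _ F E

variable (F Q) in
theorem moduleFinite_intClosure [IsDiscreteValuationRing Q] :
    Module.Finite (below F Q) (intClosure E (below F Q)) := by
  have := isDVR_below (F := F) Q
  exact IsIntegralClosure.finite (below F Q) F E (intClosure E (below F Q))

variable [IsDiscreteValuationRing Q]

theorem exists_mul_eq_intClosure {a : E} (ha : a ∈ Q) :
    ∃ b c : intClosure E (below F Q), c ∉ center F Q ∧
      a * algebraMap (intClosure E (below F Q)) E c =
        algebraMap (intClosure E (below F Q)) E b := by
  have := isDedekindDomain_intClosure F Q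
  have := isFractionRing_intClosure F Q
  exact exists_mul_eq_of_dedekind algebraMap_intClosure_mem (ne_top_of_isDVR Q) ha

theorem mem_center_pow_iff (n : ℕ) (b : intClosure E (below F Q)) : b ∈ center F Q ^ n ↔
    (n : ℕ∞) ≤ ord Q (algebraMap (intClosure E (below F Q)) E b) := by
  have := isDedekindDomain_intClosure F Q
  have := isFractionRing_intClosure F Q
  have h := mem_pow_iff_le_ord (B := intClosure E (below F Q)) (E := E) (Q := Q)
    (I := center F Q) algebraMap_intClosure_mem (fun b => mem_center_iff) n b
  exact h

/-- The inertia group of the prime ideal below `Q` is the inertia group of `Q`. -/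
theorem inertia_center_eq : (center F Q).inertia (E ≃ₐ[F] E) = inertiaAt F Q := by
  have key : ∀ σ ∈ (center F Q).inertia (E ≃ₐ[F] E), ∀ a ∈ Q,
      σ a ∈ Q ∧ σ a - a ∈ Q.nonunits := by
    intro σ hσ a ha
    obtain ⟨b, c, hc, hac⟩ := exists_mul_eq_intClosure (F := F) ha
    set ι := algebraMap (intClosure E (below F Q)) E
    have hσb : σ (ι b) - ι b ∈ Q.nonunits := hσ b
    have hσc : σ (ι c) - ι c ∈ Q.nonunits := hσ c
    have hc' : ι c ∉ Q.nonunits := hc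
    have hσc' : σ (ι c) ∉ Q.nonunits := fun h => hc' (by
      have := Q.nonunits.sub_mem h hσc
      rwa [sub_sub_cancel] at this)
    have hinv : ∀ x, x ∉ Q.nonunits → x ≠ 0 ∧ x⁻¹ ∈ Q := by
      intro x hx
      rw [ValuationSubring.mem_nonunits_iff_or] at hx
      push Not at hx
      exact hx
    obtain ⟨h0, hi⟩ := hinv _ hc'
    obtain ⟨h0', hi'⟩ := hinv _ hσc'
    have e1 : σ a * σ (ι c) = σ (ι b) := by rw [← map_mul, hac]
    have hσa : σ a ∈ Q := by
      have : σ a = σ (ι b) * (σ (ι c))⁻¹ := by rw [← e1]; field_simp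
      rw [this]
      exact Q.mul_mem _ _ (algebraMap_intClosure_mem (σ • b)) hi'
    refine ⟨hσa, ?_⟩
    have e2 : σ a - a = (ι c)⁻¹ * ((σ (ι b) - ι b) - σ a * (σ (ι c) - ι c)) := by
      rw [← e1, ← hac]
      field_simp
      ring
    rw [e2]
    exact mul_mem_nonunits hi (Q.nonunits.sub_mem hσb (mul_mem_nonunits hσa hσc))
  ext σ
  constructor
  · intro hσ
    refine ⟨fun a => ⟨fun h => ?_, fun h => (key σ hσ a h).1⟩, fun a ha => (key σ hσ a ha).2⟩
    have := (key σ⁻¹ (inv_mem hσ) _ h).1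
    rwa [show σ⁻¹ (σ a) = a from AlgEquiv.symm_apply_apply σ a] at this
  · intro hσ b
    exact hσ.2 _ (algebraMap_intClosure_mem b)

theorem ramIdx_eq_card_inertiaAt {p : ℕ} (hp : p.Prime) (hres : HasFiniteResidue p Q) :
    ramIdx F Q = Nat.card (inertiaAt F Q) := by
  have := isDVR_below (F := F) Q
  have := isDedekindDomain_intClosure F Q
  have := isFractionRing_intClosure F Q
  have := isGaloisGroup_intClosure F Q
  have := moduleFinite_intClosure F Q
  have := center_isPrime F Q
  have := center_liesOver F Q
  have := (hres.below (F := F)).finite_residueField hp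
  rw [ramIdx, ← inertia_center_eq, Ideal.card_inertia_eq_ramificationIdxIn
    (IsLocalRing.maximalIdeal (below F Q)), Ideal.ramificationIdxIn_eq_ramificationIdx
    (IsLocalRing.maximalIdeal (below F Q)) (center F Q) (E ≃ₐ[F] E)]

/-- The order function at `Q` restricts to `e(Q|P)` times the order function of the ring below. -/
theorem ord_algebraMap [IsDiscreteValuationRing (below F Q)] {c : F} (hc : c ∈ below F Q) :
    ord Q (algebraMap F E c) = ramIdx F Q * ord (below F Q) c := by
  have := isDedekindDomain_intClosure F Q
  have := center_isPrime F Q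
  have := center_liesOver F Q
  let P := below F Q
  obtain ⟨π, hπ, hπ1⟩ := exists_ord_eq_one P
  have hirr : IsLocalRing.maximalIdeal P = Ideal.span {⟨π, hπ⟩} := by
    ext x
    rw [Ideal.mem_span_singleton', ← ValuationSubring.coe_mem_nonunits_iff, ← one_le_ord_iff,
      ← hπ1, ord_le_ord_iff hπ x.2]
    constructor
    · rintro ⟨c, hc, h⟩; exact ⟨⟨c, hc⟩, Subtype.ext (by rw [h]; exact mul_comm _ _)⟩
    · rintro ⟨c, h⟩; exact ⟨c, c.2, by rw [← h]; exact mul_comm _ _⟩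
  have hπ0 : π ≠ 0 := by rintro rfl; rw [ord_zero] at hπ1; exact absurd hπ1 (by simp)
  have hπE : algebraMap F E π ≠ 0 := by simpa using hπ0
  obtain ⟨n, hn⟩ := ENat.ne_top_iff_exists.1 (ord_ne_top (Q := Q) hπE)
  have hn' : ord Q (algebraMap (intClosure E P) E (algebraMap P (intClosure E P) ⟨π, hπ⟩)) = n :=
    hn.symm
  have hram : ramIdx F Q = n := by
    rw [ramIdx, ← Ideal.ramificationIdx'_eq_ramificationIdx (IsLocalRing.maximalIdeal P)
      (center F Q) (IsDiscreteValuationRing.not_a_field P)]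
    apply Ideal.ramificationIdx'_spec
    · rw [hirr, Ideal.map_span, Set.image_singleton, Ideal.span_singleton_le_iff_mem,
        mem_center_pow_iff, hn']
    · rw [hirr, Ideal.map_span, Set.image_singleton, Ideal.span_singleton_le_iff_mem,
        mem_center_pow_iff, hn']
      norm_cast
      omega
  by_cases hc0 : c = 0
  · have hpos : n ≠ 0 := by
      rintro rfl
      have h1 := one_le_ord_iff.2 ((algebraMap_mem_nonunits_iff Q).2 (one_le_ord_iff.1 hπ1.ge))
      rw [← hn] at h1
      exact absurd h1 (by simp)
    rw [hc0, map_zero, ord_zero, ord_zero, hram, ENat.mul_top (by exact_mod_cast hpos)]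
  obtain ⟨m, hm⟩ := ENat.ne_top_iff_exists.1 (ord_ne_top (Q := P) hc0)
  obtain ⟨d, hd, hcd⟩ := (natCast_le_ord_iff hπ hπ1 hc m).1 hm.le
  have hdu : d ∉ P.nonunits := by
    intro h
    have h1 := one_le_ord_iff.2 h
    rw [hcd, ord_mul (pow_mem hπ m) hd, ord_pow hπ, hπ1, mul_one] at hm
    have h2 : (m : ℕ∞) + 1 ≤ m := by
      conv_rhs => rw [hm]
      gcongr
    exact absurd h2 (by norm_cast; omega)
  have hdE : ord Q (algebraMap F E d) = 0 := by
    rw [ord_eq_zero_iff, algebraMap_mem_nonunits_iff]; exact hdu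
  rw [← hm, hcd, map_mul, map_pow, ord_mul (pow_mem (show algebraMap F E π ∈ Q from hπ) m)
    (show algebraMap F E d ∈ Q from hd), ord_pow (show algebraMap F E π ∈ Q from hπ), hdE, ← hn,
    hram, add_zero, mul_comm]

end Semilocal

/-! ### Weakly ramified extensions -/

section Weak

variable {E : Type*} [Field E]

/-- The second ramification group of `Q` over `F` is trivial: no nontrivial inertial automorphism
moves all elements of `Q` by elements of the cube of the maximal ideal. -/
def IsWeaklyRamifiedAt (F : Type*) [Field F] [Algebra F E] (Q : ValuationSubring E) : Prop :=
  ∀ σ ∈ inertiaAt F Q, (∀ a ∈ Q, ∃ b ∈ Q.nonunits, ∃ c ∈ Q.nonunits, ∃ d ∈ Q.nonunits,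
    σ a - a = b * c * d) → σ = 1

variable {F : Type*} [Field F] [Algebra F E] {Q : ValuationSubring E}

theorem isWeaklyRamifiedAt_iff [IsDiscreteValuationRing Q] : IsWeaklyRamifiedAt F Q ↔
    ∀ σ ∈ inertiaAt F Q, (∀ a ∈ Q, 3 ≤ ord Q (σ a - a)) → σ = 1 := by
  simp only [three_le_ord_iff]
  rfl

/-- Weak ramification is inherited by the upper part of a tower. -/
theorem IsWeaklyRamifiedAt.tower_top {L : Type*} [Field L] [Algebra F L] [Algebra L E]
    [IsScalarTower F L E] (h : IsWeaklyRamifiedAt F Q) : IsWeaklyRamifiedAt L Q := by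
  intro σ hσ h3
  have := h (σ.restrictScalars F) hσ h3
  ext x
  exact DFunLike.congr_fun this x

section Tower

variable {L : Type*} [Field L] [Algebra F L] [Algebra L E] [IsScalarTower F L E]

theorem restrictNormal_mem_inertiaAt [Normal F L] {σ : E ≃ₐ[F] E} (hσ : σ ∈ inertiaAt F Q) :
    σ.restrictNormal L ∈ inertiaAt F (below L Q) := by
  refine ⟨fun a => ?_, fun a ha => ?_⟩
  · rw [ValuationSubring.mem_comap, ValuationSubring.mem_comap, AlgEquiv.restrictNormal_commutes]
    exact hσ.1 _
  · rw [← algebraMap_mem_nonunits_iff, map_sub, AlgEquiv.restrictNormal_commutes]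
    exact hσ.2 _ ha

variable [FiniteDimensional F E] [IsGalois F E]

/-- If `E/F` is a Galois `p`-extension and `L/F` is weakly ramified below `Q`, then an inertial
automorphism that violates weak ramification at `Q` to the highest possible order is trivial on `L`:
otherwise it would move an element of `L` to order at most `2 e(Q|Q ∩ L)`, and the ramification
index is the order of the inertia group over `L`. -/
theorem apply_algebraMap_eq_of_maximal [IsDiscreteValuationRing Q] {p : ℕ} (hp : p.Prime)
    (hres : HasFiniteResidue p Q) (hG : IsPGroup p (E ≃ₐ[F] E)) [IsGalois F L]
    (hL : IsWeaklyRamifiedAt F (below L Q)) {t : E} (ht : t ∈ Q) (ht1 : ord Q t = 1)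
    {σ : E ≃ₐ[F] E} (hσ : σ ∈ inertiaAt F Q) (h3 : 3 ≤ ord Q (σ t - t))
    (hmax : ∀ τ ∈ inertiaAt F Q, τ ≠ 1 → ord Q (τ t - t) ≤ ord Q (σ t - t)) (x : L) :
    σ (algebraMap L E x) = algebraMap L E x := by
  classical
  have := FiniteDimensional.right F L E
  have := IsGalois.tower_top_of_isGalois F L E
  have := isDVR_below (F := L) Q
  by_contra hx
  have hne : σ.restrictNormal L ≠ 1 := by
    intro h
    apply hx
    rw [← AlgEquiv.restrictNormal_commutes, h, AlgEquiv.one_apply]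
  have h1 := mt (isWeaklyRamifiedAt_iff.1 hL _ (restrictNormal_mem_inertiaAt hσ)) hne
  push Not at h1
  obtain ⟨a, ha, hlt⟩ := h1
  have haQ : algebraMap L E a ∈ Q := ha
  have hrest : algebraMap L E (σ.restrictNormal L a - a) =
      σ (algebraMap L E a) - algebraMap L E a := by
    rw [map_sub, AlgEquiv.restrictNormal_commutes]
  let N : Finset (E ≃ₐ[F] E) :=
    Finset.univ.image fun h : inertiaAt L Q => (h : E ≃ₐ[L] E).restrictScalars F
  have hcard : N.card = Nat.card (inertiaAt L Q) := by
    rw [Finset.card_image_of_injective _ fun h h' hh => Subtype.ext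
      (AlgEquiv.restrictScalars_injective F hh), Finset.card_univ, Nat.card_eq_fintype_card]
  have hN : ∀ h ∈ N, h ∈ inertiaAt F Q ∧ h (algebraMap L E a) = algebraMap L E a := by
    intro h hh
    obtain ⟨τ, -, rfl⟩ := Finset.mem_image.1 hh
    exact ⟨τ.2, (τ : E ≃ₐ[L] E).commutes a⟩
  have hbig := two_mul_card_lt_ord_apply_sub hp hres le_rfl (hG.to_subgroup _) ht ht1 hσ h3 hmax N
    (fun h hh => (hN h hh).1) (Finset.mem_image.2 ⟨1, Finset.mem_univ _, rfl⟩) haQ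
    fun h hh => (hN h hh).2
  have hmemL : σ.restrictNormal L a - a ∈ below L Q :=
    sub_mem (((restrictNormal_mem_inertiaAt hσ).1 a).2 ha) ha
  rw [← hrest, ord_algebraMap hmemL, ramIdx_eq_card_inertiaAt hp hres, hcard] at hbig
  obtain ⟨m, hm⟩ := ENat.ne_top_iff_exists.1 hlt.ne_top
  rw [← hm] at hlt hbig
  have hm2 : m < 3 := by exact_mod_cast hlt
  have hb2 : 2 * Nat.card (inertiaAt L Q) + 1 ≤ Nat.card (inertiaAt L Q) * m := by
    exact_mod_cast hbig
  have hm3 : m ≤ 2 := by omega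
  nlinarith

/-- The composite of two weakly ramified Galois `p`-extensions is weakly ramified. -/
theorem IsWeaklyRamifiedAt.composite [IsDiscreteValuationRing Q] {p : ℕ} (hp : p.Prime)
    (hres : HasFiniteResidue p Q) (hG : IsPGroup p (E ≃ₐ[F] E)) [IsGalois F L]
    {L' : Type*} [Field L'] [Algebra F L'] [Algebra L' E] [IsScalarTower F L' E] [IsGalois F L']
    (hL : IsWeaklyRamifiedAt F (below L Q)) (hL' : IsWeaklyRamifiedAt F (below L' Q))
    (hgen : ∀ σ : E ≃ₐ[F] E, (∀ x : L, σ (algebraMap L E x) = algebraMap L E x) →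
      (∀ x : L', σ (algebraMap L' E x) = algebraMap L' E x) → σ = 1) :
    IsWeaklyRamifiedAt F Q := by
  rw [isWeaklyRamifiedAt_iff]
  intro σ₀ hσ₀ h3
  by_contra hne
  obtain ⟨t, ht, ht1⟩ := exists_ord_eq_one Q
  obtain ⟨σ, hσ, hσ1, hσ3, hmax⟩ := exists_maximal_ord_apply_sub hσ₀ hne (h3 t ht)
  exact hσ1 (hgen σ
    (apply_algebraMap_eq_of_maximal hp hres hG hL ht ht1 hσ hσ3 hmax)
    (apply_algebraMap_eq_of_maximal hp hres hG hL' ht ht1 hσ hσ3 hmax))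

end Tower

/-- In a weakly ramified Galois `p`-extension every nontrivial inertial automorphism moves a
uniformizer to order exactly `2`. -/
theorem ord_apply_uniformizer_sub_eq_two [FiniteDimensional F E] [IsGalois F E]
    [IsDiscreteValuationRing Q] {p : ℕ} (hp : p.Prime) (hres : HasFiniteResidue p Q)
    (hG : IsPGroup p (E ≃ₐ[F] E)) (hw : IsWeaklyRamifiedAt F Q) {t : E} (ht : t ∈ Q)
    (ht1 : ord Q t = 1) {σ : E ≃ₐ[F] E} (hσ : σ ∈ inertiaAt F Q) (hne : σ ≠ 1) :
    ord Q (σ t - t) = 2 := by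
  obtain ⟨r, hr⟩ := hG σ
  refine le_antisymm ?_ (two_le_ord_apply_sub hres hσ hr ht ht1)
  by_contra! h
  refine hne (isWeaklyRamifiedAt_iff.1 hw σ hσ fun a ha => ?_)
  refine le_trans ?_ (ord_apply_uniformizer_sub_le hp hres le_rfl (hG.to_subgroup _) ht ht1 hσ ha)
  have := Order.add_one_le_of_lt h
  calc (3 : ℕ∞) = 2 + 1 := by norm_num
    _ ≤ _ := this

end Weak

/-! ### The different exponent of a weakly ramified extension -/

section

variable {F E : Type*} [Field F] [Field E] [Algebra F E] [FiniteDimensional F E] [IsGalois F E]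
  (Q : ValuationSubring E)

theorem different_eq_differentIdeal [IsDedekindDomain (below F Q)]
    [IsDedekindDomain (intClosure E (below F Q))] :
    different E (below F Q) = differentIdeal (below F Q) (intClosure E (below F Q)) := by
  have := isFractionRing_intClosure F Q
  have h := coeSubmodule_differentIdeal (A := below F Q) F (L := E) (intClosure E (below F Q))
  rw [different, complementaryModule, ← h]
  exact Submodule.comap_map_eq_of_injective
    (IsFractionRing.injective (intClosure E (below F Q)) E) _

end

section Different

variable {F E : Type*} [Field F] [Field E] [Algebra F E] [FiniteDimensional F E] [IsGalois F E]
  {Q : ValuationSubring E} [IsDiscreteValuationRing Q]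

/-- Every residue class of `Q` is represented in the semilocal ring. -/
theorem exists_intClosure_sub_mem_nonunits {N : ℕ} (hN2 : 2 ≤ N)
    (hN : ∀ a ∈ Q, a ^ N - a ∈ Q.nonunits) {a : E} (ha : a ∈ Q) :
    ∃ b : intClosure E (below F Q),
      a - algebraMap (intClosure E (below F Q)) E b ∈ Q.nonunits := by
  obtain ⟨b, c, hc, hac⟩ := exists_mul_eq_intClosure (F := F) ha
  refine ⟨b * c ^ (N - 2), ?_⟩
  have hcQ := algebraMap_intClosure_mem c
  rw [map_mul, map_pow, ← hac]
  set γ := algebraMap (intClosure E (below F Q)) E c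
  have h1 : γ * (1 - γ ^ (N - 1)) ∈ Q.nonunits := by
    have := sub_mem_nonunits_symm (hN γ hcQ)
    convert this using 1
    rw [mul_sub, mul_one, ← pow_succ', show N - 1 + 1 = N by omega]
  have h2 := (mem_nonunits_or_of_mul hcQ (Q.sub_mem Q.one_mem (pow_mem hcQ _)) h1).resolve_left hc
  have h3 : a - a * γ * γ ^ (N - 2) = a * (1 - γ ^ (N - 1)) := by
    rw [show N - 1 = N - 2 + 1 by omega]; ring
  rw [h3]
  exact mul_mem_nonunits ha h2

/-- There is an element `θ` of the semilocal ring above `Q ∩ F` whose residue at `Q` generates the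
multiplicative group of the residue field, for which `θ ^ N - θ` is a uniformizer at `Q`, and which
lies in all the conjugates of the prime ideal of `Q` other than itself. -/
theorem exists_local_generator {p : ℕ} [CharP E p] (hp : p.Prime) (hres : HasFiniteResidue p Q) :
    ∃ (m : ℕ) (θ : E), 2 ≤ p ^ m ∧ θ ∈ intClosure E (below F Q) ∧ θ ∉ Q.nonunits ∧
      ord Q (θ ^ p ^ m - θ) = 1 ∧
      (∀ a ∈ Q, a ∈ Q.nonunits ∨ ∃ i : ℕ, a - θ ^ i ∈ Q.nonunits) ∧
      ∀ σ : E ≃ₐ[F] E, (∀ b ∈ intClosure E (below F Q), σ b ∈ Q.nonunits ↔ b ∈ Q.nonunits) ∨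
        σ θ ∈ Q.nonunits := by
  classical
  have := Fact.mk hp
  have : ExpChar E p := ExpChar.prime hp
  have := isDedekindDomain_intClosure F Q
  have := hres.finite hp
  obtain ⟨m, hm, hN⟩ := id hres
  have hN2 : 2 ≤ p ^ m := hp.two_le.trans (Nat.le_self_pow (by omega) p)
  let B := intClosure E (below F Q)
  -- a representative of a generator of the multiplicative group of the residue field
  obtain ⟨g, hg⟩ := IsCyclic.exists_generator (α := (IsLocalRing.ResidueField Q)ˣ)
  obtain ⟨g', hg'⟩ := IsLocalRing.residue_surjective (g : IsLocalRing.ResidueField Q)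
  obtain ⟨τ₀, hτ₀⟩ := exists_intClosure_sub_mem_nonunits (F := F) hN2 hN g'.2
  obtain ⟨t, ht, ht1⟩ := exists_ord_eq_one Q
  -- correct it so that `τ ^ N - τ` becomes a uniformizer
  obtain ⟨τ, hτ, hτ1⟩ : ∃ τ : B, (g' : E) - (τ : E) ∈ Q.nonunits ∧
      ord Q ((τ : E) ^ p ^ m - τ) = 1 := by
    by_cases h1 : ord Q ((τ₀ : E) ^ p ^ m - τ₀) = 1
    · exact ⟨τ₀, hτ₀, h1⟩
    obtain ⟨t', c, hc, htc⟩ := exists_mul_eq_intClosure (F := F) ht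
    have hcQ := algebraMap_intClosure_mem c
    have ht'Q : (t' : E) ∈ Q := algebraMap_intClosure_mem t'
    have ht' : ord Q (t' : E) = 1 := by
      have h := congrArg (ord Q) htc
      have hc0 : ord Q (algebraMap (intClosure E (below F Q)) E c) = 0 := ord_eq_zero_iff.2 hc
      rw [ord_mul ht hcQ, ht1, hc0] at h
      exact h.symm
    refine ⟨τ₀ + t', ?_, ?_⟩
    · have h2 := Q.nonunits.sub_mem hτ₀ (one_le_ord_iff.1 ht'.ge)
      convert h2 using 1
      push_cast
      exact (sub_sub _ _ _).symm
    · push_cast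
      have hτQ : (τ₀ : E) ∈ Q := algebraMap_intClosure_mem τ₀
      have e : ((τ₀ : E) + t') ^ p ^ m - (τ₀ + t') =
          (t' ^ p ^ m - t') + ((τ₀ : E) ^ p ^ m - τ₀) := by
        rw [add_pow_char_pow]; ring
      have h2 : ord Q ((t' : E) ^ p ^ m - t') = 1 := by
        rw [ord_sub_comm, ord_sub_eq ht'Q (pow_mem ht'Q _), ht']
        rw [ord_pow ht'Q, ht', mul_one]
        exact_mod_cast hN2
      have h3 : 1 < ord Q ((τ₀ : E) ^ p ^ m - τ₀) :=
        lt_of_le_of_ne (one_le_ord_iff.2 (hN _ hτQ)) (Ne.symm h1)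
      rw [e, ord_add_eq (Q.sub_mem (pow_mem ht'Q _) ht'Q) (Q.sub_mem (pow_mem hτQ _) hτQ)
        (by rw [h2]; exact h3), h2]
  -- the conjugate prime ideals
  let conj : (E ≃ₐ[F] E) → Ideal B := fun σ =>
    (center F Q).comap (MulSemiringAction.toRingHom (E ≃ₐ[F] E) B σ)
  have hconj : ∀ σ (b : B), b ∈ conj σ ↔ σ (b : E) ∈ Q.nonunits := fun σ b => Iff.rfl
  have hcenter : conj 1 = center F Q := Ideal.ext fun b => Iff.rfl
  have hprime : ∀ σ, Prime (conj σ) := by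
    intro σ
    have := center_isPrime F Q
    refine Ideal.prime_of_isPrime (fun h => ?_) (Ideal.comap_isPrime _ _)
    obtain ⟨t', c, hc, htc⟩ := exists_mul_eq_intClosure (F := F) ht
    have ht'0 : t' ≠ 0 := by
      rintro rfl
      rw [map_zero, mul_eq_zero] at htc
      rcases htc with h | h
      · rw [h, ord_zero] at ht1; exact absurd ht1 (by simp)
      · exact hc (by rw [mem_center_iff, h]; exact Q.nonunits.zero_mem)
    have ht'n : (t' : E) ∈ Q.nonunits := by
      have : (t' : E) = algebraMap B E c * t := by rw [mul_comm]; exact htc.symm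
      rw [this]
      exact mul_mem_nonunits (algebraMap_intClosure_mem c) (one_le_ord_iff.1 ht1.ge)
    have hmem : σ⁻¹ • t' ∈ conj σ := by
      rw [hconj]
      change σ (σ⁻¹ (t' : E)) ∈ _
      rwa [show σ (σ⁻¹ (t' : E)) = t' from AlgEquiv.apply_symm_apply σ _]
    rw [h, Ideal.mem_bot] at hmem
    exact ht'0 (by simpa using congrArg (σ • ·) hmem)
  -- the Chinese remainder theorem; the exponent `2` keeps the order of `τ ^ N - τ`
  obtain ⟨θ, hθ⟩ := IsDedekindDomain.exists_forall_sub_mem_ideal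
    (s := Finset.univ.image conj) (fun I => I) (fun _ => 2)
    (fun I hI => by obtain ⟨σ, -, rfl⟩ := Finset.mem_image.1 hI; exact hprime σ)
    (fun I _ J _ h => h) (fun I => if I.1 = center F Q then τ else 0)
  have hθ1 := hθ (center F Q) (Finset.mem_image.2 ⟨1, Finset.mem_univ _, hcenter⟩)
  rw [if_pos rfl, mem_center_pow_iff] at hθ1
  have hτQ : (τ : E) ∈ Q := algebraMap_intClosure_mem τ
  have hθQ : (θ : E) ∈ Q := algebraMap_intClosure_mem θ
  have hδ : (2 : ℕ∞) ≤ ord Q ((θ : E) - τ) := by exact_mod_cast hθ1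
  have hθτ : (θ : E) - τ ∈ Q.nonunits := one_le_ord_iff.1 (le_trans (by norm_num) hδ)
  have hθg : (g' : E) - θ ∈ Q.nonunits :=
    sub_mem_nonunits_trans hτ (sub_mem_nonunits_symm hθτ)
  have hresθ : ∀ i : ℕ, (g' : E) ^ i - (θ : E) ^ i ∈ Q.nonunits := fun i =>
    pow_sub_pow_mem_nonunits g'.2 hθQ hθg i
  refine ⟨m, θ, hN2, θ.2, ?_, ?_, ?_, ?_⟩
  · intro h
    have h1 : (g' : E) ∈ Q.nonunits := by
      have := Q.nonunits.add_mem hθg h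
      rwa [sub_add_cancel] at this
    rw [ValuationSubring.coe_mem_nonunits_iff, ← IsLocalRing.residue_eq_zero_iff, hg'] at h1
    exact g.ne_zero h1
  · have e : (θ : E) ^ p ^ m - θ = ((τ : E) ^ p ^ m - τ) +
        (((θ : E) - τ) ^ p ^ m - ((θ : E) - τ)) := by
      rw [sub_pow_char_pow]; ring
    have hδQ : (θ : E) - τ ∈ Q := Q.sub_mem hθQ hτQ
    have h2 : (2 : ℕ∞) ≤ ord Q (((θ : E) - τ) ^ p ^ m - ((θ : E) - τ)) := by
      refine le_trans ?_ (min_le_ord_sub (pow_mem hδQ _) hδQ)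
      refine le_min ?_ hδ
      rw [ord_pow hδQ]
      refine hδ.trans (le_mul_of_one_le_left' ?_)
      exact_mod_cast (by omega : 1 ≤ p ^ m)
    rw [e, ord_add_eq (Q.sub_mem (pow_mem hτQ _) hτQ) (Q.sub_mem (pow_mem hδQ _) hδQ), hτ1]
    rw [hτ1]
    exact lt_of_lt_of_le (by norm_num) h2
  · intro a ha
    by_cases hau : a ∈ Q.nonunits
    · exact Or.inl hau
    right
    have hne : IsLocalRing.residue Q ⟨a, ha⟩ ≠ 0 := by
      rwa [Ne, IsLocalRing.residue_eq_zero_iff, ← ValuationSubring.coe_mem_nonunits_iff]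
    obtain ⟨i, hi⟩ := (mem_powers_iff_mem_zpowers.2 (hg (Units.mk0 _ hne)))
    refine ⟨i, sub_mem_nonunits_trans ?_ (hresθ i)⟩
    have h1 : IsLocalRing.residue Q (⟨a, ha⟩ - g' ^ i) = 0 := by
      rw [map_sub, map_pow, hg', sub_eq_zero]
      have := congrArg Units.val hi
      simpa using this.symm
    rw [IsLocalRing.residue_eq_zero_iff, ← ValuationSubring.coe_mem_nonunits_iff] at h1
    exact h1
  · intro σ
    by_cases h : conj σ = center F Q
    · left
      intro b hb
      have h1 : (⟨b, hb⟩ : B) ∈ conj σ ↔ (⟨b, hb⟩ : B) ∈ center F Q := by rw [h]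
      exact h1
    · right
      have h1 := hθ (conj σ) (Finset.mem_image.2 ⟨σ, Finset.mem_univ _, rfl⟩)
      rw [if_neg h, sub_zero] at h1
      exact (hconj σ θ).1 (Ideal.pow_le_self two_ne_zero h1)

theorem adjoin_eq_top_of_apply_ne {θ : E} (hθ : ∀ σ : E ≃ₐ[F] E, σ ≠ 1 → σ θ ≠ θ) :
    Algebra.adjoin F {θ} = ⊤ := by
  have h1 : IntermediateField.adjoin F {θ} = ⊤ := by
    rw [← IsGalois.fixedField_fixingSubgroup (IntermediateField.adjoin F {θ}),
      ← IntermediateField.fixedField_bot]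
    congr 1
    rw [eq_bot_iff]
    intro σ hσ
    by_contra hne
    exact hθ σ hne (hσ ⟨θ, IntermediateField.mem_adjoin_simple_self F θ⟩)
  rw [← IntermediateField.adjoin_simple_toSubalgebra_of_isAlgebraic
    (Algebra.IsAlgebraic.isAlgebraic θ), h1, IntermediateField.top_toSubalgebra]

/-- The derivative of the minimal polynomial of a primitive element `θ` takes at `θ` the value
`∏ (θ - σ θ)`, over the nontrivial automorphisms `σ`. -/
theorem aeval_derivative_minpoly_eq_prod [DecidableEq (E ≃ₐ[F] E)] {θ : E}
    (hθ : ∀ σ : E ≃ₐ[F] E, σ ≠ 1 → σ θ ≠ θ) :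
    aeval θ (derivative (minpoly F θ)) =
      ∏ σ ∈ Finset.univ.erase (1 : E ≃ₐ[F] E), (θ - σ θ) := by
  have hint : IsIntegral F θ := Algebra.IsIntegral.isIntegral θ
  have hinj : ∀ σ τ : E ≃ₐ[F] E, σ θ = τ θ → σ = τ := by
    intro σ τ h
    by_contra hne
    refine hθ (σ⁻¹ * τ) (fun h1 => hne (inv_mul_eq_one.1 h1)) ?_
    rw [AlgEquiv.mul_apply, ← h]
    exact AlgEquiv.symm_apply_apply σ θ
  have hdeg : (minpoly F θ).natDegree = Fintype.card (E ≃ₐ[F] E) := by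
    have h1 : IntermediateField.adjoin F {θ} = ⊤ := by
      rw [← IntermediateField.toSubalgebra_inj,
        IntermediateField.adjoin_simple_toSubalgebra_of_isAlgebraic
          (Algebra.IsAlgebraic.isAlgebraic θ), adjoin_eq_top_of_apply_ne hθ,
        IntermediateField.top_toSubalgebra]
    rw [← IntermediateField.adjoin.finrank hint, h1, IntermediateField.finrank_top',
      ← Nat.card_eq_fintype_card, IsGalois.card_aut_eq_finrank]
  have hmap0 : (minpoly F θ).map (algebraMap F E) ≠ 0 :=
    ((minpoly.monic hint).map _).ne_zero
  have hprod : (minpoly F θ).map (algebraMap F E) = ∏ σ : E ≃ₐ[F] E, (X - C (σ θ)) := by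
    symm
    refine eq_of_monic_of_associated (monic_prod_of_monic _ _ fun σ _ => monic_X_sub_C _)
      ((minpoly.monic hint).map _) (associated_of_dvd_of_natDegree_le ?_ hmap0 ?_)
    · refine Finset.prod_dvd_of_coprime
        (fun σ _ τ _ hne => pairwise_coprime_X_sub_C (fun σ τ h => hinj σ τ h) hne)
        fun σ _ => ?_
      rw [dvd_iff_isRoot, IsRoot.def, eval_map_algebraMap]
      have := minpoly.aeval F θ
      rw [aeval_algEquiv, AlgHom.comp_apply, this]
      exact map_zero _
    · rw [natDegree_map, hdeg, natDegree_prod_of_monic _ _ fun σ _ => monic_X_sub_C _]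
      simp
  rw [← eval_map_algebraMap, ← derivative_map, hprod,
    ← Finset.mul_prod_erase Finset.univ _ (Finset.mem_univ (1 : E ≃ₐ[F] E)), derivative_mul]
  simp [eval_prod]

/-- The powers of `θ` generate the semilocal ring up to an element prime to `Q`. With `d` the
discriminant of the powers of `θ` and `M` the order of `d`, an integral element `b` agrees with a
polynomial `g` in `θ` modulo the `M`-th power of the prime ideal of `Q`, and `θ ^ M * (b - g) / d`
is integral. -/
theorem exists_mem_conductor {N : ℕ} {θ : intClosure E (below F Q)}
    (hθ : (θ : E) ∉ Q.nonunits) (hθ1 : ord Q ((θ : E) ^ N - θ) = 1)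
    (hgen : ∀ a ∈ Q, a ∈ Q.nonunits ∨ ∃ i : ℕ, a - (θ : E) ^ i ∈ Q.nonunits)
    (hconj : ∀ σ : E ≃ₐ[F] E,
      (∀ b ∈ intClosure E (below F Q), σ b ∈ Q.nonunits ↔ b ∈ Q.nonunits) ∨
        σ (θ : E) ∈ Q.nonunits)
    (htop : Algebra.adjoin F {(θ : E)} = ⊤) :
    ∃ c ∈ conductor (below F Q) θ, c ∉ center F Q := by
  let P := below F Q
  let B := intClosure E P
  let A : Subalgebra P E := Algebra.adjoin P {(θ : E)}
  have hθA : (θ : E) ∈ A := Algebra.subset_adjoin (Set.mem_singleton _)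
  have hθQ : (θ : E) ∈ Q := algebraMap_intClosure_mem θ
  -- the discriminant
  obtain ⟨d, hd0, hdP, hdA⟩ : ∃ d : F, d ≠ 0 ∧ d ∈ P ∧
      ∀ b : E, IsIntegral P b → algebraMap F E d * b ∈ A := by
    let pb := (Algebra.adjoin.powerBasis' (Algebra.IsIntegral.isIntegral (R := F) (θ : E))).map
      ((Subalgebra.equivOfEq _ _ htop).trans (Subalgebra.topEquiv))
    have pbgen : pb.gen = (θ : E) := by simp [pb]
    have hint : IsIntegral P pb.gen := by rw [pbgen]; exact θ.2
    refine ⟨Algebra.discr F pb.basis, Algebra.discr_not_zero_of_basis F pb.basis, ?_, ?_⟩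
    · have h1 : IsIntegral P (Algebra.discr F pb.basis) :=
        Algebra.discr_isIntegral F fun i => by
          rw [pb.basis_eq_pow]; exact hint.pow _
      obtain ⟨y, hy⟩ := IsIntegrallyClosed.isIntegral_iff.1 h1
      rw [← hy]
      exact y.2
    · intro b hb
      have := Algebra.discr_mul_isIntegral_mem_adjoin F hint hb
      rw [pbgen, Algebra.smul_def] at this
      exact this
  obtain ⟨M, hM⟩ := ENat.ne_top_iff_exists.1
    (ord_ne_top (Q := Q) (x := algebraMap F E d) (by simpa using hd0))
  have hdQ : algebraMap F E d ∈ Q := hdP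
  -- expansions in powers of the uniformizer `θ ^ N - θ`
  have htA : (θ : E) ^ N - θ ∈ A := Subalgebra.sub_mem _ (Subalgebra.pow_mem _ hθA N) hθA
  have htQ : (θ : E) ^ N - θ ∈ Q := Q.sub_mem (pow_mem hθQ N) hθQ
  have hexp : ∀ k : ℕ, ∀ a ∈ Q, ∃ s ∈ A, ∃ b ∈ Q, a = s + ((θ : E) ^ N - θ) ^ k * b := by
    intro k
    induction k with
    | zero => exact fun a ha => ⟨0, Subalgebra.zero_mem _, a, ha, by simp⟩
    | succ k ih =>
      intro a ha
      obtain ⟨s, hs, b, hb, rfl⟩ := ih a ha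
      obtain ⟨r, hr, hbr⟩ : ∃ r ∈ A, b - r ∈ Q.nonunits := by
        rcases hgen b hb with h | ⟨i, hi⟩
        · exact ⟨0, Subalgebra.zero_mem _, by rwa [sub_zero]⟩
        · exact ⟨(θ : E) ^ i, Subalgebra.pow_mem _ hθA i, hi⟩
      obtain ⟨e, he, hbe⟩ := (ord_le_ord_iff htQ (Q.nonunits_subset hbr)).1
        (hθ1.le.trans (one_le_ord_iff.2 hbr))
      refine ⟨s + ((θ : E) ^ N - θ) ^ k * r, Subalgebra.add_mem _ hs
        (Subalgebra.mul_mem _ (Subalgebra.pow_mem _ htA k) hr), e, he, ?_⟩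
      rw [pow_succ, mul_assoc, ← hbe]; ring
  have hAint : ∀ x ∈ A, IsIntegral P x := by
    have : A ≤ integralClosure P E := Algebra.adjoin_le (by
      rintro _ rfl; exact θ.2)
    exact this
  have hmain : ∀ b : E, IsIntegral P b → (θ : E) ^ M * b ∈ A := by
    intro b hb
    obtain ⟨s, hs, e, he, hbe⟩ := hexp M b (mem_of_mem_intClosure Q hb)
    have hsub : IsIntegral P (b - s) := hb.sub (hAint s hs)
    have hord : (M : ℕ∞) ≤ ord Q (b - s) := by
      rw [hbe, add_sub_cancel_left, ord_mul (pow_mem htQ M) he, ord_pow htQ, hθ1, mul_one]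
      exact le_self_add
    have hdE : algebraMap F E d ≠ 0 := by simpa using hd0
    have hy : IsIntegral P ((θ : E) ^ M * (b - s) / algebraMap F E d) := by
      refine isIntegral_of_forall_apply_mem fun σ => ?_
      rw [map_div₀, map_mul, map_pow, AlgEquiv.commutes]
      have hσθ : σ (θ : E) ∈ Q := algebraMap_intClosure_mem (σ • θ)
      have hσb : σ (b - s) ∈ Q := algebraMap_intClosure_mem (σ • (⟨b - s, hsub⟩ : B))
      refine (div_mem_and_ord_div (Q.mul_mem _ _ (pow_mem hσθ M) hσb) hdQ hdE ?_).1
      rw [← hM, ord_mul (pow_mem hσθ M) hσb]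
      -- either `σ` preserves the prime ideal of `Q`, or `σ θ` lies in it
      rcases hconj σ with h | h
      · refine le_trans ?_ le_add_self
        have hle : center F Q ≤
            (center F Q).comap (MulSemiringAction.toRingHom (E ≃ₐ[F] E) B σ) :=
          fun x hx => (h x x.2).2 hx
        have h1 : (⟨b - s, hsub⟩ : B) ∈ center F Q ^ M := (mem_center_pow_iff M _).2 hord
        have h2 := Ideal.le_comap_pow (K := center F Q)
          (MulSemiringAction.toRingHom (E ≃ₐ[F] E) B σ) M (Ideal.pow_right_mono hle M h1)
        exact (mem_center_pow_iff M _).1 h2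
      · refine le_trans ?_ le_self_add
        rw [ord_pow hσθ]
        exact le_mul_of_one_le_right' (one_le_ord_iff.2 h)
    have h3 := hdA _ hy
    rw [mul_div_cancel₀ _ hdE] at h3
    have h4 : (θ : E) ^ M * b = (θ : E) ^ M * (b - s) + (θ : E) ^ M * s := by ring
    rw [h4]
    exact Subalgebra.add_mem _ h3 (Subalgebra.mul_mem _ (Subalgebra.pow_mem _ hθA M) hs)
  refine ⟨θ ^ M, ?_, fun h => hθ (mem_nonunits_of_pow h)⟩
  rw [mem_conductor_iff]
  intro b
  have h1 := hmain b b.2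
  have h2 : A = (Algebra.adjoin P {θ}).map B.val := by
    rw [AlgHom.map_adjoin, Set.image_singleton]; rfl
  rw [h2] at h1
  obtain ⟨x, hx, hxe⟩ := h1
  have : x = θ ^ M * b := Subtype.ext hxe
  rw [← this]
  exact hx

end Different

section DifferentExponent

variable {F E : Type*} [Field F] [Field E] [Algebra F E] [FiniteDimensional F E] [IsGalois F E]
  {Q : ValuationSubring E} [IsDiscreteValuationRing Q]

/-- A nontrivial automorphism moves the local generator `θ` to order `2` if it is inertial, and
otherwise by a unit. -/
theorem ord_local_generator_sub {p m : ℕ} [CharP E p] (hp : p.Prime) (hres : HasFiniteResidue p Q)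
    (hG : IsPGroup p (E ≃ₐ[F] E)) (hw : IsWeaklyRamifiedAt F Q) (hN2 : 2 ≤ p ^ m) {θ : E}
    (hθB : θ ∈ intClosure E (below F Q)) (hθ : θ ∉ Q.nonunits) (hθ1 : ord Q (θ ^ p ^ m - θ) = 1)
    (hgen : ∀ a ∈ Q, a ∈ Q.nonunits ∨ ∃ i : ℕ, a - θ ^ i ∈ Q.nonunits)
    (hconj : ∀ σ : E ≃ₐ[F] E,
      (∀ b ∈ intClosure E (below F Q), σ b ∈ Q.nonunits ↔ b ∈ Q.nonunits) ∨ σ θ ∈ Q.nonunits)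
    {σ : E ≃ₐ[F] E} (hσ : σ ≠ 1) :
    (σ ∈ inertiaAt F Q → ord Q (θ - σ θ) = 2) ∧
      (σ ∉ inertiaAt F Q → ord Q (θ - σ θ) = 0) := by
  have := ExpChar.prime (R := E) hp
  have hθQ : θ ∈ Q := mem_of_mem_intClosure Q hθB
  have hσθQ : σ θ ∈ Q := algebraMap_intClosure_mem (σ • (⟨θ, hθB⟩ : intClosure E (below F Q)))
  refine ⟨fun hI => ?_, fun hI => ?_⟩
  · have htQ : θ ^ p ^ m - θ ∈ Q := Q.sub_mem (pow_mem hθQ _) hθQ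
    have h2 := ord_apply_uniformizer_sub_eq_two hp hres hG hw htQ hθ1 hI hσ
    have hx : σ θ - θ ∈ Q.nonunits := hI.2 θ hθQ
    have hxQ := Q.nonunits_subset hx
    have e : σ (θ ^ p ^ m - θ) - (θ ^ p ^ m - θ) = (σ θ - θ) ^ p ^ m - (σ θ - θ) := by
      rw [map_sub, map_pow, sub_pow_expChar_pow]; ring
    have hx0 : σ θ - θ ≠ 0 := by
      intro h0
      rw [e, h0, zero_pow (by omega), sub_zero, ord_zero] at h2
      exact absurd h2 (by simp)
    obtain ⟨l, hl⟩ := ENat.ne_top_iff_exists.1 (ord_ne_top (Q := Q) hx0)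
    have h1 := one_le_ord_iff.2 hx
    rw [← hl] at h1
    have hl1 : 1 ≤ l := by exact_mod_cast h1
    rw [e, ord_sub_comm, ord_sub_eq hxQ (pow_mem hxQ _)] at h2
    · rw [ord_sub_comm, h2]
    · rw [ord_pow hxQ, ← hl]
      exact_mod_cast (by nlinarith : l < p ^ m * l)
  · rw [ord_eq_zero_iff]
    intro hx
    rcases hconj σ with h | h
    · apply hI
      rw [← inertia_center_eq]
      intro b
      have hbQ : (b : E) ∈ Q := algebraMap_intClosure_mem b
      change σ (b : E) - b ∈ Q.nonunits
      rcases hgen b hbQ with hb | ⟨i, hi⟩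
      · exact Q.nonunits.sub_mem ((h b b.2).2 hb) hb
      · have h1 : σ ((b : E) - θ ^ i) ∈ Q.nonunits :=
          (h _ (b.2.sub (IsIntegral.pow hθB i))).2 hi
        rw [map_sub, map_pow] at h1
        have h2 := pow_sub_pow_mem_nonunits hθQ hσθQ hx i
        have h3 := Q.nonunits.sub_mem h1 (Q.nonunits.add_mem hi h2)
        convert h3 using 1
        ring
    · have := Q.nonunits.add_mem hx h
      rw [sub_add_cancel] at this
      exact hθ this

/-- In a weakly ramified Galois `p`-extension the different exponent is `2 (e - 1)`: up to an
element prime to `Q`, the different is generated by the derivative at the local generator of its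
minimal polynomial, and this is the product of the differences of the generator and its
conjugates. -/
theorem diffExponent_eq_of_isWeaklyRamifiedAt {p : ℕ} [CharP E p] (hp : p.Prime)
    (hres : HasFiniteResidue p Q) (hG : IsPGroup p (E ≃ₐ[F] E)) (hw : IsWeaklyRamifiedAt F Q) :
    diffExponent F Q = ((2 * (ramIdx F Q - 1) : ℕ) : ℕ∞) := by
  classical
  obtain ⟨m, θ', hN2, hθB, hθ, hθ1, hgen, hconj⟩ := exists_local_generator (F := F) hp hres
  have hord := fun σ (hσ : σ ≠ (1 : E ≃ₐ[F] E)) =>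
    ord_local_generator_sub hp hres hG hw hN2 hθB hθ hθ1 hgen hconj hσ
  have hne : ∀ σ : E ≃ₐ[F] E, σ ≠ 1 → σ θ' ≠ θ' := by
    intro σ hσ h
    have := hord σ hσ
    rw [h, sub_self, ord_zero] at this
    by_cases hI : σ ∈ inertiaAt F Q
    · exact absurd (this.1 hI) (by simp)
    · exact absurd (this.2 hI) (by simp)
  have := isDVR_below (F := F) Q
  have := isDedekindDomain_intClosure F Q
  have := isFractionRing_intClosure F Q
  have := center_isPrime F Q
  have htop := adjoin_eq_top_of_apply_ne hne
  let θ : intClosure E (below F Q) := ⟨θ', hθB⟩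
  obtain ⟨c, hc, hcn⟩ := exists_mem_conductor (θ := θ) hθ hθ1 hgen hconj htop
  have hmul := conductor_mul_differentIdeal (below F Q) F E θ htop
  set δ : intClosure E (below F Q) := aeval θ (derivative (minpoly (below F Q) θ)) with hδ
  have hδE : (δ : E) = ∏ σ ∈ Finset.univ.erase (1 : E ≃ₐ[F] E), (θ' - σ θ') := by
    rw [← aeval_derivative_minpoly_eq_prod hne]
    have hint : IsIntegral (below F Q) θ' := hθB
    have h1 : minpoly (below F Q) θ = minpoly (below F Q) θ' :=
      (minpoly.algebraMap_eq (B := intClosure E (below F Q)) (B' := E)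
        Subtype.val_injective θ).symm
    rw [minpoly.isIntegrallyClosed_eq_field_fractions' F hint, derivative_map,
      aeval_map_algebraMap, ← h1, hδ]
    exact (aeval_algebraMap_apply E θ _).symm
  have hσQ : ∀ σ : E ≃ₐ[F] E, θ' - σ θ' ∈ Q := fun σ =>
    Q.sub_mem (mem_of_mem_intClosure Q hθB) (algebraMap_intClosure_mem (σ • θ))
  -- each of the `e - 1` nontrivial inertial automorphisms contributes `2`
  have hcount : ord Q (δ : E) = ((2 * (ramIdx F Q - 1) : ℕ) : ℕ∞) := by
    rw [hδE, ord_prod _ _ fun σ _ => hσQ σ, ramIdx_eq_card_inertiaAt hp hres]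
    rw [← Finset.sum_filter_add_sum_filter_not _ (fun σ => σ ∈ inertiaAt F Q)]
    have h1 : ∑ σ ∈ Finset.filter (fun σ => σ ∈ inertiaAt F Q)
        (Finset.univ.erase (1 : E ≃ₐ[F] E)), ord Q (θ' - σ θ') =
        ((2 * (Nat.card (inertiaAt F Q) - 1) : ℕ) : ℕ∞) := by
      rw [Finset.sum_congr rfl (g := fun _ => (2 : ℕ∞)) fun σ hσ => ?_, Finset.sum_const,
        Finset.filter_erase, Finset.card_erase_of_mem (by simp [one_mem]),
        Nat.card_eq_fintype_card, Fintype.card_subtype, nsmul_eq_mul, mul_comm 2]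
      · push_cast
        rfl
      · simp only [Finset.mem_filter, Finset.mem_erase] at hσ
        exact (hord σ hσ.1.1).1 hσ.2
    rw [h1, Finset.sum_eq_zero, add_zero]
    intro σ hσ
    simp only [Finset.mem_filter, Finset.mem_erase] at hσ
    exact (hord σ hσ.1.1).2 hσ.2
  have hpow : ∀ n : ℕ, center F Q ^ n ∣ Ideal.span {δ} ↔ (n : ℕ∞) ≤ ord Q (δ : E) := by
    intro n
    rw [Ideal.dvd_span_singleton, mem_center_pow_iff]
    rfl
  have hprime : Prime (center F Q) := by
    refine Ideal.prime_of_isPrime (fun h => ?_) this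
    have h4 : (⟨θ', hθB⟩ ^ p ^ m - ⟨θ', hθB⟩ : intClosure E (below F Q)) ∈ center F Q :=
      one_le_ord_iff.1 hθ1.ge
    rw [h, Ideal.mem_bot] at h4
    have h5 : θ' ^ p ^ m - θ' = 0 := congrArg Subtype.val h4
    rw [h5, ord_zero] at hθ1
    exact absurd hθ1 (by simp)
  -- the conductor is prime to `Q`
  have h0 : emultiplicity (center F Q) (conductor (below F Q) θ) = 0 := by
    rw [emultiplicity_eq_zero, Ideal.dvd_iff_le]
    exact fun h => hcn (h hc)
  have h1 : emultiplicity (center F Q) (Ideal.span {δ}) = ord Q (δ : E) := by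
    refine ENat.eq_of_forall_natCast_le_iff fun n => ?_
    rw [← pow_dvd_iff_le_emultiplicity, hpow]
  rw [diffExponent, different_eq_differentIdeal, ← hcount, ← h1, ← hmul, emultiplicity_mul hprime,
    h0, zero_add]

end DifferentExponent

/-! ### Places of function fields over finite fields -/

section FunctionField

variable {𝔽 E : Type*} [Field 𝔽] [Field E] [Algebra 𝔽 E]

theorem inv_mem_of_notMem {Q : ValuationSubring E} {t : E} (ht : t ∉ Q) : t⁻¹ ∈ Q :=
  (Q.mem_or_inv_mem t).resolve_left ht

theorem adjoin_simple_inv (t : E) :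
    IntermediateField.adjoin 𝔽 {t⁻¹} = IntermediateField.adjoin 𝔽 {t} := by
  refine le_antisymm ?_ ?_ <;> rw [IntermediateField.adjoin_simple_le_iff]
  · exact inv_mem (IntermediateField.mem_adjoin_simple_self 𝔽 t)
  · simpa using inv_mem (IntermediateField.mem_adjoin_simple_self 𝔽 t⁻¹)

open scoped IntermediateField.algebraAdjoinAdjoin in
/-- At a place where `t` is finite, `Q` is the localization at a prime ideal of the integral closure
of `𝔽[t]`, a Dedekind domain of finite type over `𝔽`. -/
theorem isDVR_and_hasFiniteResidue_of_mem [Finite 𝔽] {p s : ℕ} (hs : 1 ≤ s)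
    (hcard : Nat.card 𝔽 = p ^ s) {t : E} (ht : Transcendental 𝔽 t)
    [FiniteDimensional (IntermediateField.adjoin 𝔽 {t}) E]
    [Algebra.IsSeparable (IntermediateField.adjoin 𝔽 {t}) E] {Q : ValuationSubring E}
    (hQ : IsPlace 𝔽 Q) (htQ : t ∈ Q) :
    IsDiscreteValuationRing Q ∧ HasFiniteResidue p Q := by
  have := Fintype.ofFinite 𝔽
  let A := Algebra.adjoin 𝔽 {t}
  have : IsPrincipalIdealRing A :=
    IsPrincipalIdealRing.of_surjective (Polynomial.algEquivOfTranscendental 𝔽 t ht).toRingHom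
      (Polynomial.algEquivOfTranscendental 𝔽 t ht).surjective
  let B := integralClosure A E
  have : IsDedekindDomain B := integralClosure.isDedekindDomain A (IntermediateField.adjoin 𝔽 {t}) E
  have : IsFractionRing B E :=
    integralClosure.isFractionRing_of_finite_extension (IntermediateField.adjoin 𝔽 {t}) E
  have hA : ∀ a : A, (a : E) ∈ Q := by
    intro a
    have h : A ≤ ({ Q.toSubring with algebraMap_mem' := hQ.1 } : Subalgebra 𝔽 E) :=
      Algebra.adjoin_le (by rintro _ rfl; exact htQ)
    exact h a.2
  have hB : ∀ b : B, algebraMap B E b ∈ Q := by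
    rintro ⟨b, g, hg, hb⟩
    let φ : A →+* Q :=
      Subring.inclusion (S := A.toSubring) (T := Q.toSubring) fun a ha => hA ⟨a, ha⟩
    have hint : IsIntegral Q b := by
      refine ⟨g.map φ, hg.map φ, ?_⟩
      rw [Polynomial.eval₂_map]
      exact hb
    obtain ⟨y, hy⟩ := IsIntegrallyClosed.isIntegral_iff.mp hint
    change b ∈ Q
    rw [← hy]
    exact y.2
  refine ⟨isDVR_of_dedekind hB hQ.2, ?_⟩
  obtain ⟨v, hv, -⟩ := exists_eq_valuationSubringAtPrime hB hQ.2
  have : v.asIdeal.IsMaximal := v.isPrime.isMaximal v.ne_bot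
  let _ : Field (B ⧸ v.asIdeal) := Ideal.Quotient.field _
  have : Module.Finite A B := IsIntegralClosure.finite A (IntermediateField.adjoin 𝔽 {t}) E B
  have : Algebra.FiniteType 𝔽 A :=
    (Subalgebra.fg_iff_finiteType _).1 ⟨{t}, by simp [A]⟩
  have : Algebra.FiniteType 𝔽 B := Algebra.FiniteType.trans (S := A) ‹_› inferInstance
  have : Algebra.FiniteType 𝔽 (B ⧸ v.asIdeal) := inferInstance
  have : Module.Finite 𝔽 (B ⧸ v.asIdeal) := finite_of_finite_type_of_isJacobsonRing _ _
  have : Finite (B ⧸ v.asIdeal) := Module.finite_of_finite 𝔽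
  have := Fintype.ofFinite (B ⧸ v.asIdeal)
  have hcardB : Fintype.card (B ⧸ v.asIdeal) =
      p ^ (s * Module.finrank 𝔽 (B ⧸ v.asIdeal)) := by
    rw [Module.card_eq_pow_finrank (K := 𝔽), ← Nat.card_eq_fintype_card, hcard, ← pow_mul]
  set m := s * Module.finrank 𝔽 (B ⧸ v.asIdeal)
  have hm : 1 ≤ m := Nat.mul_pos hs Module.finrank_pos
  have hBm : ∀ b : B, algebraMap B E b ^ p ^ m - algebraMap B E b ∈ Q.nonunits := by
    intro b
    rw [← map_pow, ← map_sub, ← hv, ← Ideal.Quotient.eq_zero_iff_mem, map_sub, map_pow, ← hcardB,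
      FiniteField.pow_card, sub_self]
  refine ⟨m, hm, fun a ha => ?_⟩
  obtain ⟨b, c, hc, hac⟩ := exists_mul_eq_of_dedekind hB hQ.2 ha
  have h1 := hBm b
  have h2 := mul_mem_nonunits (pow_mem ha (p ^ m)) (hBm c)
  rw [← hac] at h1
  have h3 := Q.nonunits.sub_mem h1 h2
  have h4 : algebraMap B E c * (a ^ p ^ m - a) ∈ Q.nonunits := by
    convert h3 using 1
    ring
  exact (mem_nonunits_or_of_mul (hB c) (sub_mem (pow_mem ha _) ha) h4).resolve_left hc

/-- The places of a function field over a finite field are discrete, with finite residue fields. -/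
theorem IsPlace.isDVR_and_hasFiniteResidue [Finite 𝔽] {p s : ℕ} (hs : 1 ≤ s)
    (hcard : Nat.card 𝔽 = p ^ s) {t : E} (ht : Transcendental 𝔽 t)
    [FiniteDimensional (IntermediateField.adjoin 𝔽 {t}) E]
    [Algebra.IsSeparable (IntermediateField.adjoin 𝔽 {t}) E] {Q : ValuationSubring E}
    (hQ : IsPlace 𝔽 Q) : IsDiscreteValuationRing Q ∧ HasFiniteResidue p Q := by
  by_cases htQ : t ∈ Q
  · exact isDVR_and_hasFiniteResidue_of_mem hs hcard ht hQ htQ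
  · have h := adjoin_simple_inv (𝔽 := 𝔽) t
    have : FiniteDimensional (IntermediateField.adjoin 𝔽 {t⁻¹}) E := by rw [h]; infer_instance
    have : Algebra.IsSeparable (IntermediateField.adjoin 𝔽 {t⁻¹}) E := by rw [h]; infer_instance
    exact isDVR_and_hasFiniteResidue_of_mem hs hcard
      (fun h => ht (by simpa using h.inv)) hQ (inv_mem_of_notMem htQ)

end FunctionField

/-! ### Trace operators -/

section Trace

variable {R : Type*} [CommRing R]

/-- The operator `a ↦ a + a ^ q + ⋯ + a ^ (q ^ (m - 1))`. -/
def tr (q m : ℕ) (a : R) : R := ∑ i ∈ Finset.range m, a ^ q ^ i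

theorem tr_zero_left (q : ℕ) (a : R) : tr q 0 a = 0 := by simp [tr]

theorem tr_one_left (q : ℕ) (a : R) : tr q 1 a = a := by simp [tr]

theorem tr_add_left (q m l : ℕ) (a : R) : tr q (m + l) a = tr q m a + tr q l (a ^ q ^ m) := by
  simp only [tr, Finset.sum_range_add, ← pow_mul, ← pow_add]

theorem map_tr {S : Type*} [CommRing S] (f : R →+* S) (q m : ℕ) (a : R) :
    f (tr q m a) = tr q m (f a) := by
  simp [tr]

theorem pow_pow_eq_of_pow_eq {q : ℕ} {c : R} (hc : c ^ q = c) (i : ℕ) : c ^ q ^ i = c := by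
  induction i with
  | zero => simp
  | succ i ih => rw [pow_succ, pow_mul, ih, hc]

theorem tr_mul_of_pow_eq {q : ℕ} {c : R} (hc : c ^ q = c) (m : ℕ) (a : R) :
    tr q m (c * a) = c * tr q m a := by
  simp only [tr, mul_pow, pow_pow_eq_of_pow_eq hc, Finset.mul_sum]

variable {p s q : ℕ} [ExpChar R p]

theorem add_pow_q (hq : q = p ^ s) (i : ℕ) (a b : R) :
    (a + b) ^ q ^ i = a ^ q ^ i + b ^ q ^ i := by
  rw [hq, ← pow_mul]
  exact add_pow_expChar_pow a b p _

theorem sub_pow_q (hq : q = p ^ s) (i : ℕ) (a b : R) :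
    (a - b) ^ q ^ i = a ^ q ^ i - b ^ q ^ i := by
  rw [hq, ← pow_mul]
  exact sub_pow_expChar_pow a b _

theorem neg_pow_q (hq : q = p ^ s) (i : ℕ) (a : R) : (-a) ^ q ^ i = -a ^ q ^ i := by
  have h0 : (0 : R) ^ q ^ i = 0 := by
    have := sub_pow_q (R := R) hq i 0 0
    simpa using this
  have := sub_pow_q hq i 0 a
  simpa [h0] using this

theorem sum_pow_q {ι : Type*} (hq : q = p ^ s) (i : ℕ) (t : Finset ι) (f : ι → R) :
    (∑ x ∈ t, f x) ^ q ^ i = ∑ x ∈ t, f x ^ q ^ i := by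
  rw [hq, ← pow_mul]
  exact sum_pow_char_pow p (s * i) t f

theorem intCast_pow_q (hq : q = p ^ s) (i : ℕ) (c : ℤ) : (c : R) ^ q ^ i = c := by
  rw [hq, ← pow_mul, ← iterateFrobenius_def, map_intCast]

theorem tr_add (hq : q = p ^ s) (m : ℕ) (a b : R) : tr q m (a + b) = tr q m a + tr q m b := by
  simp only [tr, add_pow_q hq, Finset.sum_add_distrib]

theorem tr_sub (hq : q = p ^ s) (m : ℕ) (a b : R) : tr q m (a - b) = tr q m a - tr q m b := by
  simp only [tr, sub_pow_q hq, Finset.sum_sub_distrib]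

theorem tr_neg (hq : q = p ^ s) (m : ℕ) (a : R) : tr q m (-a) = -tr q m a := by
  simp only [tr, neg_pow_q hq, Finset.sum_neg_distrib]

theorem tr_zero (hq : q = p ^ s) (m : ℕ) : tr q m (0 : R) = 0 := by
  simpa using tr_sub (R := R) hq m 0 0

theorem tr_pow_q (hq : q = p ^ s) (m i : ℕ) (a : R) : tr q m (a ^ q ^ i) = tr q m a ^ q ^ i := by
  rw [tr, tr, sum_pow_q hq]
  exact Finset.sum_congr rfl fun x _ => pow_right_comm a _ _

theorem tr_sum {ι : Type*} (hq : q = p ^ s) (m : ℕ) (t : Finset ι) (f : ι → R) :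
    tr q m (∑ x ∈ t, f x) = ∑ x ∈ t, tr q m (f x) := by
  simp only [tr, sum_pow_q hq]
  exact Finset.sum_comm

theorem tr_tr (hq : q = p ^ s) (m l : ℕ) (a : R) : tr q m (tr q l a) = tr q l (tr q m a) := by
  conv_lhs => rw [tr.eq_def q l, tr_sum hq]
  rw [tr.eq_def q l (tr q m a)]
  exact Finset.sum_congr rfl fun i _ => tr_pow_q hq m i a

theorem tr_pow_sub (hq : q = p ^ s) (m : ℕ) (a : R) : tr q m a ^ q - tr q m a = a ^ q ^ m - a := by
  have h := tr_pow_q hq m 1 a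
  rw [pow_one] at h
  have h1 := tr_add_left q 1 m a
  have h2 := tr_add_left q m 1 a
  rw [tr_one_left, pow_one] at h1
  rw [tr_one_left] at h2
  rw [← h]
  rw [add_comm] at h1
  rw [h2] at h1
  linear_combination -h1

theorem tr_intCast (hq : q = p ^ s) (m : ℕ) (c : ℤ) : tr q m (c : R) = m * c := by
  simp [tr, intCast_pow_q hq]

/-- For coprime `j` and `k`, a pair `(a, b)` with `tr j a = tr k b` has the form
`(tr k u, tr j u)`. The proof runs the Euclidean algorithm on `(j, k)`. -/
theorem exists_tr_eq (hq : q = p ^ s) {j k : ℕ} (hjk : Nat.Coprime j k) {a b : R}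
    (h : tr q j a = tr q k b) : ∃ u, tr q k u = a ∧ tr q j u = b := by
  induction hm : j + k using Nat.strong_induction_on generalizing j k a b with
  | _ m ih =>
    wlog hle : k ≤ j generalizing j k a b
    · obtain ⟨u, hu, hu'⟩ := this hjk.symm h.symm (by omega) (by omega)
      exact ⟨u, hu', hu⟩
    rcases Nat.eq_zero_or_pos k with rfl | hk
    · have hj : j = 1 := by simpa using hjk
      subst hj
      rw [tr_one_left, tr_zero_left] at h
      exact ⟨b, by rw [tr_zero_left, h], tr_one_left q b⟩
    · obtain ⟨d, rfl⟩ := Nat.exists_eq_add_of_le' hle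
      have hdk : Nat.Coprime d k := by simpa using hjk
      have h1 : tr q d a = tr q k (b - a ^ q ^ d) := by
        rw [tr_sub hq, ← h, tr_add_left, add_sub_cancel_right]
      obtain ⟨u, hu, hu'⟩ := ih (d + k) (by omega) hdk h1 rfl
      refine ⟨u, hu, ?_⟩
      rw [tr_add_left, hu', tr_pow_q hq, hu, sub_add_cancel]

theorem eq_zero_of_tr_eq_zero (hq : q = p ^ s) {j k : ℕ} (hjk : Nat.Coprime j k) {u : R}
    (hj : tr q j u = 0) (hk : tr q k u = 0) : u = 0 := by
  induction hm : j + k using Nat.strong_induction_on generalizing j k with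
  | _ m ih =>
    wlog hle : k ≤ j generalizing j k
    · exact this hjk.symm hk hj (by omega) (by omega)
    rcases Nat.eq_zero_or_pos k with rfl | hk0
    · have h1 : j = 1 := by simpa using hjk
      rwa [h1, tr_one_left] at hj
    · obtain ⟨d, rfl⟩ := Nat.exists_eq_add_of_le' hle
      have hdk : Nat.Coprime d k := by simpa using hjk
      refine ih (d + k) (by omega) hdk ?_ hk rfl
      rw [tr_add_left, tr_pow_q hq, hk] at hj
      have h0 : (0 : R) ^ q ^ d = 0 := by simpa using sub_pow_q (R := R) hq d 0 0
      rwa [h0, add_zero] at hj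

end Trace

/-! ### The polynomials defining the steps of the tower -/

section Polynomials

variable {K : Type*} [Field K]

theorem eval_trPoly (q m : ℕ) (a : K) : (trPoly K q m).eval a = tr q m a := by
  simp [trPoly, tr, eval_finsetSum]

theorem map_trPoly {L : Type*} [Field L] (f : K →+* L) (q m : ℕ) :
    (trPoly K q m).map f = trPoly L q m := by
  simp [trPoly, Polynomial.map_sum]

/-- The polynomial `Tr_k(T) ^ (q ^ j) - w Tr_j(T) + c`. -/
noncomputable def stepPoly (q j k : ℕ) (w c : K) : K[X] :=
  trPoly K q k ^ q ^ j - C w * trPoly K q j + C c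

theorem eval_stepPoly (q j k : ℕ) (w c a : K) :
    (stepPoly q j k w c).eval a = tr q k a ^ q ^ j - w * tr q j a + c := by
  simp [stepPoly, eval_trPoly]

theorem map_stepPoly {L : Type*} [Field L] (f : K →+* L) (q j k : ℕ) (w c : K) :
    (stepPoly q j k w c).map f = stepPoly q j k (f w) (f c) := by
  simp [stepPoly, map_trPoly]

variable {q : ℕ}

theorem natDegree_trPoly_le (hq : 1 ≤ q) (m : ℕ) :
    (trPoly K q (m + 1)).natDegree ≤ q ^ m := by
  refine natDegree_sum_le_of_forall_le _ _ fun i hi => ?_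
  rw [natDegree_X_pow]
  exact Nat.pow_le_pow_right hq (by simpa [Nat.lt_succ_iff] using hi)

theorem coeff_trPoly (hq : 2 ≤ q) (m : ℕ) : (trPoly K q (m + 1)).coeff (q ^ m) = 1 := by
  rw [trPoly, finsetSum_coeff, Finset.sum_range_succ, coeff_X_pow_self, Finset.sum_eq_zero,
    zero_add]
  intro i hi
  rw [coeff_X_pow, if_neg]
  exact (Nat.pow_lt_pow_right hq (Finset.mem_range.1 hi)).ne'

theorem monic_trPoly (hq : 2 ≤ q) (m : ℕ) : (trPoly K q (m + 1)).Monic :=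
  monic_of_natDegree_le_of_coeff_eq_one _ (natDegree_trPoly_le (by omega) m) (coeff_trPoly hq m)

theorem natDegree_trPoly (hq : 2 ≤ q) (m : ℕ) : (trPoly K q (m + 1)).natDegree = q ^ m :=
  natDegree_eq_of_le_of_coeff_ne_zero (natDegree_trPoly_le (by omega) m)
    (by rw [coeff_trPoly hq]; exact one_ne_zero)

theorem monic_stepPoly (hq : 2 ≤ q) {j k : ℕ} (hj : 1 ≤ j) (hk : 1 ≤ k) (w c : K) :
    (stepPoly q j k w c).Monic ∧ (stepPoly q j k w c).natDegree = q ^ (j + k - 1) := by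
  obtain ⟨j, rfl⟩ := Nat.exists_eq_add_of_le' hj
  obtain ⟨k, rfl⟩ := Nat.exists_eq_add_of_le' hk
  have h1 : (trPoly K q (k + 1) ^ q ^ (j + 1)).Monic := (monic_trPoly hq k).pow _
  have h2 : (trPoly K q (k + 1) ^ q ^ (j + 1)).natDegree = q ^ (j + 1 + (k + 1) - 1) := by
    rw [natDegree_pow, natDegree_trPoly hq, ← pow_add]; congr 1
  have h3 : (C w * trPoly K q (j + 1) - C c).natDegree <
      (trPoly K q (k + 1) ^ q ^ (j + 1)).natDegree := by
    rw [h2]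
    refine lt_of_le_of_lt (natDegree_sub_le_of_le ((natDegree_C_mul_le _ _).trans
      (natDegree_trPoly_le (by omega) j)) (by simp : _ ≤ q ^ j)) ?_
    rw [max_self]
    exact Nat.pow_lt_pow_right hq (by omega)
  have h4 : stepPoly q (j + 1) (k + 1) w c =
      trPoly K q (k + 1) ^ q ^ (j + 1) - (C w * trPoly K q (j + 1) - C c) := by
    rw [stepPoly]; ring
  rw [h4]
  exact ⟨h1.sub_of_left (degree_lt_degree h3), by rw [natDegree_sub_eq_left_of_natDegree_lt h3, h2]⟩

variable {p s : ℕ} [CharP K p]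

theorem derivative_stepPoly (hs : 1 ≤ s) (hq : q = p ^ s) {j k : ℕ} (hj : 1 ≤ j)
    (w c : K) : derivative (stepPoly q j k w c) = -C w := by
  have hq0 : (q : K) = 0 := by
    rw [hq, Nat.cast_pow, CharP.cast_eq_zero, zero_pow (by omega)]
  have h1 : ∀ i, 1 ≤ i → ((q ^ i : ℕ) : K) = 0 := by
    intro i hi
    rw [Nat.cast_pow, hq0, zero_pow (by omega)]
  have h2 : derivative (trPoly K q j) = 1 := by
    obtain ⟨j, rfl⟩ := Nat.exists_eq_add_of_le' hj
    rw [trPoly, derivative_sum, Finset.sum_range_succ', Finset.sum_eq_zero]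
    · simp
    · intro i _
      rw [derivative_X_pow, h1 _ (by omega), map_zero, zero_mul]
  simp [stepPoly, derivative_pow, hq0, h2, zero_pow (show j ≠ 0 by omega)]

theorem separable_stepPoly (hs : 1 ≤ s) (hq : q = p ^ s) {j k : ℕ} (hj : 1 ≤ j)
    {w : K} (hw : w ≠ 0) (c : K) : (stepPoly q j k w c).Separable := by
  rw [separable_def, derivative_stepPoly hs hq hj]
  exact isCoprime_one_right.of_isCoprime_of_dvd_right (Polynomial.isUnit_C.2 hw.isUnit).neg.dvd

end Polynomials

/-! ### Elements fixed by all embeddings -/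

section Fixed

/-- A separable element fixed by all embeddings of the field that it generates is rational. -/
theorem mem_range_algebraMap_of_forall_algHom {K Ω : Type*} [Field K] [Field Ω] [IsAlgClosed Ω]
    [Algebra K Ω] {f : K[X]} (hf : f.Separable) {g : Ω} (hg : aeval g f = 0)
    (h : ∀ φ : IntermediateField.adjoin K {g} →ₐ[K] Ω,
      φ (IntermediateField.AdjoinSimple.gen K g) = g) : g ∈ (algebraMap K Ω).range := by
  have hint : IsIntegral K g := IsAlgebraic.isIntegral ⟨f, hf.ne_zero, hg⟩
  have hsep : (minpoly K g).Separable := hf.of_dvd (minpoly.dvd K g hg)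
  rw [← minpoly.natDegree_eq_one_iff]
  refine le_antisymm ?_ (minpoly.natDegree_pos hint)
  rw [← card_rootSet_eq_natDegree (K := Ω) hsep (IsAlgClosed.splits _), Fintype.card_le_one_iff]
  have key : ∀ a : (minpoly K g).rootSet Ω, (a : Ω) = g := by
    intro a
    have ha : aeval (a : Ω) (minpoly K g) = 0 := aeval_eq_zero_of_mem_rootSet a.2
    have h1 := h ((IntermediateField.algHomAdjoinIntegralEquiv K hint).symm
      ⟨a, by rw [mem_aroots]; exact ⟨minpoly.ne_zero hint, ha⟩⟩)
    rw [IntermediateField.algHomAdjoinIntegralEquiv_symm_apply_gen] at h1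
    exact h1
  intro a b
  exact Subtype.ext ((key a).trans (key b).symm)

theorem mem_range_algebraMap_of_pow_card_eq {𝔽 Ω : Type*} [Field 𝔽] [Finite 𝔽] [Field Ω]
    [Algebra 𝔽 Ω] {c : Ω} (hc : c ^ Nat.card 𝔽 = c) : c ∈ (algebraMap 𝔽 Ω).range := by
  have := Fintype.ofFinite 𝔽
  rw [Nat.card_eq_fintype_card] at hc
  have h1 : (X ^ Fintype.card 𝔽 - X : 𝔽[X]) = ∏ a : 𝔽, (X - C a) := by
    have h2 := FiniteField.X_pow_card_sub_X_natDegree_eq 𝔽 (Fintype.one_lt_card (α := 𝔽))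
    rw [← prod_multiset_X_sub_C_of_monic_of_roots_card_eq
      (p := (X ^ Fintype.card 𝔽 - X : 𝔽[X])), FiniteField.roots_X_pow_card_sub_X]
    · rfl
    · exact monic_X_pow_sub (by rw [degree_X]; exact_mod_cast Fintype.one_lt_card)
    · rw [FiniteField.roots_X_pow_card_sub_X, h2]
      rfl
  have h2 := congrArg (aeval c) h1
  rw [map_prod, map_sub, map_pow, aeval_X, hc, sub_self] at h2
  obtain ⟨a, -, ha⟩ := Finset.prod_eq_zero_iff.1 h2.symm
  refine ⟨a, ?_⟩
  rw [map_sub, aeval_X, aeval_C, sub_eq_zero] at ha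
  exact ha.symm

end Fixed

/-! ### The kernel of the linear part of the step polynomials -/

section Kernel

variable {R : Type*} [CommRing R]

/-- The solutions of `Tr_k(v) ^ (q ^ j) = w Tr_j(v)`. -/
def trKer (q j k : ℕ) (w : R) : Set R := {v | tr q k v ^ q ^ j = w * tr q j v}

variable {p s q j k : ℕ} [ExpChar R p]

theorem sub_mem_trKer (hq : q = p ^ s) {w a b : R} (ha : a ∈ trKer q j k w)
    (hb : b ∈ trKer q j k w) : a - b ∈ trKer q j k w := by
  have ha' : tr q k a ^ q ^ j = w * tr q j a := ha
  have hb' : tr q k b ^ q ^ j = w * tr q j b := hb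
  change tr q k (a - b) ^ q ^ j = w * tr q j (a - b)
  rw [tr_sub hq, tr_sub hq, sub_pow_q hq, ha', hb', mul_sub]

theorem map_mem_trKer {S : Type*} [CommRing S] (f : R →+* S) {w v : R} (hv : v ∈ trKer q j k w) :
    f v ∈ trKer q j k (f w) := by
  have h := congrArg f hv
  rw [map_pow, map_mul, map_tr, map_tr] at h
  exact h

theorem mem_trKer_of_map {S : Type*} [CommRing S] {f : R →+* S} (hf : Function.Injective f)
    {w v : R} (hv : f v ∈ trKer q j k (f w)) : v ∈ trKer q j k w := by
  apply hf
  rw [map_pow, map_mul, map_tr, map_tr]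
  exact hv

/-- The kernel is a finite set with `q ^ (j + k - 1)` elements. -/
theorem exists_finset_trKer {Ω : Type*} [Field Ω] [IsAlgClosed Ω] [CharP Ω p] (hp : p.Prime)
    (hs : 1 ≤ s) (hq : q = p ^ s) (hj : 1 ≤ j) (hk : 1 ≤ k) {w : Ω} (hw : w ≠ 0) :
    ∃ V : Finset Ω, (∀ v, v ∈ V ↔ v ∈ trKer q j k w) ∧ V.card = q ^ (j + k - 1) := by
  classical
  have hq2 : 2 ≤ q := hq ▸ hp.two_le.trans (Nat.le_self_pow (by omega) p)
  obtain ⟨hm, hd⟩ := monic_stepPoly hq2 hj hk w 0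
  refine ⟨(stepPoly q j k w 0).roots.toFinset, fun v => ?_, ?_⟩
  · rw [Multiset.mem_toFinset, mem_roots hm.ne_zero, IsRoot.def, eval_stepPoly, add_zero,
      sub_eq_zero]
    rfl
  · rw [Multiset.toFinset_card_of_nodup (nodup_roots (separable_stepPoly hs hq hj hw 0)), ← hd]
    exact (splits_iff_card_roots.1 (IsAlgClosed.splits _))

end Kernel

/-! ### The pairing between the kernels of adjoint operators -/

section Pairing

variable {R : Type*} [CommRing R]

/-- A pairing between the solutions `g` of `Tr_j(g) ^ (q ^ k) = z Tr_k(g)` and the elements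
`T` with `Tr_j(T) = Tr_k(z T) ^ (q ^ j)`, with values in the fixed field of `x ↦ x ^ q`. -/
def pairing (q j k : ℕ) (z g T : R) : R :=
  ∑ i ∈ Finset.range j, tr q i (g ^ q ^ (k + (j - 1 - i)) * T) -
    ∑ i ∈ Finset.range k, tr q (i + j) (g ^ q ^ (k - 1 - i) * (z * T))

theorem map_pairing {S : Type*} [CommRing S] (f : R →+* S) (q j k : ℕ) (z g T : R) :
    f (pairing q j k z g T) = pairing q j k (f z) (f g) (f T) := by
  simp [pairing, map_tr]

variable {p s q j k : ℕ} [ExpChar R p]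

theorem pairing_pow_sub (hq : q = p ^ s) (z g T : R) :
    pairing q j k z g T ^ q - pairing q j k z g T =
      g ^ q ^ (j + k - 1) * (tr q j T - tr q k (z * T) ^ q ^ j) -
        T * (tr q j g ^ q ^ k - z * tr q k g) := by
  have hpow : ∀ (t : Finset ℕ) (f : ℕ → R), (∑ i ∈ t, f i) ^ q = ∑ i ∈ t, f i ^ q := by
    intro t f
    simpa using sum_pow_q hq 1 t f
  have hsub : ∀ a b : R, (a - b) ^ q = a ^ q - b ^ q := by
    intro a b
    simpa using sub_pow_q hq 1 a b
  have e1 : ∑ i ∈ Finset.range j, tr q i (g ^ q ^ (k + (j - 1 - i)) * T) ^ q -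
      ∑ i ∈ Finset.range j, tr q i (g ^ q ^ (k + (j - 1 - i)) * T) =
      g ^ q ^ (j + k - 1) * tr q j T - T * tr q j g ^ q ^ k := by
    have h : ∑ i ∈ Finset.range j, g ^ q ^ (k + (j - 1 - i)) = tr q j g ^ q ^ k := by
      rw [Finset.sum_range_reflect (fun i => g ^ q ^ (k + i)) j, ← tr_pow_q hq, tr]
      exact Finset.sum_congr rfl fun i _ => by rw [← pow_mul, ← pow_add]
    rw [← Finset.sum_sub_distrib, ← h, tr, Finset.mul_sum, Finset.mul_sum,
      ← Finset.sum_sub_distrib]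
    refine Finset.sum_congr rfl fun i hi => ?_
    have hi := Finset.mem_range.1 hi
    rw [tr_pow_sub hq, mul_pow, ← pow_mul, ← pow_add,
      show k + (j - 1 - i) + i = j + k - 1 by omega, mul_comm T]
  have e2 : ∑ i ∈ Finset.range k, tr q (i + j) (g ^ q ^ (k - 1 - i) * (z * T)) ^ q -
      ∑ i ∈ Finset.range k, tr q (i + j) (g ^ q ^ (k - 1 - i) * (z * T)) =
      g ^ q ^ (j + k - 1) * tr q k (z * T) ^ q ^ j - T * (z * tr q k g) := by
    have h : ∑ i ∈ Finset.range k, g ^ q ^ (k - 1 - i) = tr q k g :=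
      Finset.sum_range_reflect (fun i => g ^ q ^ i) k
    rw [← Finset.sum_sub_distrib, ← h, ← tr_pow_q hq, tr, Finset.mul_sum, Finset.mul_sum,
      Finset.mul_sum, ← Finset.sum_sub_distrib]
    refine Finset.sum_congr rfl fun i hi => ?_
    have hi := Finset.mem_range.1 hi
    rw [tr_pow_sub hq, mul_pow, ← pow_mul, ← pow_add,
      show k - 1 - i + (i + j) = j + k - 1 by omega, ← pow_mul, ← pow_add, add_comm j i]
    ring
  rw [pairing, hsub, hpow, hpow]
  linear_combination e1 - e2

/-- `f` is a polynomial function of `q`-degree less than `d`, with exponents the powers of `q`. -/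
def IsQPolyLT (q d : ℕ) (f : R → R) : Prop :=
  ∃ c : ℕ → R, ∀ T, f T = ∑ l ∈ Finset.range d, c l * T ^ q ^ l

theorem isQPolyLT_tr_mul {m d : ℕ} (h : m ≤ d) (a : R) :
    IsQPolyLT q d fun T => tr q m (a * T) := by
  refine ⟨fun l => if l < m then a ^ q ^ l else 0, fun T => ?_⟩
  simp only [tr, ite_mul, zero_mul, mul_pow]
  rw [← Finset.sum_filter]
  congr 1
  ext l
  simp only [Finset.mem_range, Finset.mem_filter]
  omega

theorem IsQPolyLT.sum {ι : Type*} {d : ℕ} (t : Finset ι) (f : ι → R → R)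
    (h : ∀ i ∈ t, IsQPolyLT q d (f i)) : IsQPolyLT q d fun T => ∑ i ∈ t, f i T := by
  choose! c hc using h
  refine ⟨fun l => ∑ i ∈ t, c i l, fun T => ?_⟩
  simp only [Finset.sum_mul]
  rw [Finset.sum_comm]
  exact Finset.sum_congr rfl fun i hi => hc i hi T

theorem IsQPolyLT.sub {d : ℕ} {f g : R → R} (hf : IsQPolyLT q d f) (hg : IsQPolyLT q d g) :
    IsQPolyLT q d fun T => f T - g T := by
  obtain ⟨c, hc⟩ := hf
  obtain ⟨e, he⟩ := hg
  refine ⟨fun l => c l - e l, fun T => ?_⟩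
  simp only [hc, he, sub_mul, Finset.sum_sub_distrib]

theorem IsQPolyLT.eq_zero_of_card {K : Type*} [Field K] (hq : 2 ≤ q) {d : ℕ} {f : K → K} {a : K}
    (hf : IsQPolyLT q d f) (S : Finset K) (hS : q ^ d < S.card)
    (h : ∀ T ∈ S, f T = a * T ^ q ^ d) : a = 0 := by
  obtain ⟨c, hc⟩ := hf
  let P : K[X] := ∑ l ∈ Finset.range d, C (c l) * X ^ q ^ l - C a * X ^ q ^ d
  have hdeg : P.natDegree ≤ q ^ d := by
    refine natDegree_sub_le_of_le (natDegree_sum_le_of_forall_le _ _ fun l hl => ?_)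
      (natDegree_C_mul_X_pow_le _ _) |>.trans (by rw [max_self])
    exact (natDegree_C_mul_X_pow_le _ _).trans
      (Nat.pow_le_pow_right (by omega) (Finset.mem_range.1 hl).le)
  have hP : P = 0 := by
    refine eq_zero_of_natDegree_lt_card_of_eval_eq_zero' P S (fun T hT => ?_) (hdeg.trans_lt hS)
    have := h T hT
    rw [hc, ← sub_eq_zero] at this
    simpa [P, eval_finsetSum] using this
  have h1 : P.coeff (q ^ d) = -a := by
    simp only [P, coeff_sub, finsetSum_coeff, coeff_C_mul_X_pow]
    rw [Finset.sum_eq_zero]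
    · simp
    · intro l hl
      rw [if_neg]
      exact (Nat.pow_lt_pow_right hq (Finset.mem_range.1 hl)).ne'
  rw [hP, coeff_zero] at h1
  exact neg_eq_zero.1 h1.symm

/-- The pairing is nondegenerate on the left. -/
theorem eq_zero_of_pairing_eq_zero {K : Type*} [Field K] (hq : 2 ≤ q) (hj : 1 ≤ j) (hk : 1 ≤ k)
    {z g : K} (hz : z ≠ 0) (S : Finset K) (hS : S.card = q ^ (j + k - 1))
    (h : ∀ T ∈ S, pairing q j k z g T = 0) : g = 0 := by
  obtain ⟨j, rfl⟩ := Nat.exists_eq_add_of_le' hj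
  obtain ⟨k, rfl⟩ := Nat.exists_eq_add_of_le' hk
  have hf : IsQPolyLT q (k + j) fun T =>
      (∑ i ∈ Finset.range (j + 1), tr q i (g ^ q ^ (k + 1 + (j + 1 - 1 - i)) * T) -
        ∑ i ∈ Finset.range k, tr q (i + (j + 1)) (g ^ q ^ (k + 1 - 1 - i) * z * T)) -
        tr q (k + j) (g * z * T) := by
    refine ((IsQPolyLT.sum _ _ fun i hi => isQPolyLT_tr_mul ?_ _).sub
      (IsQPolyLT.sum _ _ fun i hi => isQPolyLT_tr_mul ?_ _)).sub (isQPolyLT_tr_mul le_rfl _)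
    · have := Finset.mem_range.1 hi; omega
    · have := Finset.mem_range.1 hi; omega
  have h1 := hf.eq_zero_of_card (a := (g * z) ^ q ^ (k + j)) hq S
    (by rw [hS]; exact Nat.pow_lt_pow_right hq (by omega)) (fun T hT => ?_)
  · exact (mul_eq_zero.1 ((pow_eq_zero_iff (pow_ne_zero _ (by omega))).1 h1)).resolve_right hz
  · have h2 := h T hT
    rw [pairing, Finset.sum_range_succ _ k, show k + 1 - 1 - k = 0 by omega, pow_zero, pow_one,
      ← add_assoc, tr_add_left q (k + j) 1, tr_one_left, mul_pow] at h2
    simp only [mul_assoc] at h2 ⊢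
    rw [mul_pow]
    linear_combination h2

end Pairing

/-! ### Links of the tower -/

section BaseField

theorem pairing_sub {R : Type*} [CommRing R] {p s q : ℕ} [ExpChar R p] (hq : q = p ^ s) (j k : ℕ)
    (z g g' T : R) : pairing q j k z (g - g') T = pairing q j k z g T - pairing q j k z g' T := by
  simp only [pairing, sub_pow_q hq, sub_mul, tr_sub hq, Finset.sum_sub_distrib]
  ring

variable (𝔽 : Type*) {Ω : Type*} [Field 𝔽] [Field Ω] [Algebra 𝔽 Ω]

/-- The field generated by `w` and the solutions of `Tr_k(v) ^ (q ^ j) = w Tr_j(v)`. -/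
def baseField (q j k : ℕ) (w : Ω) : IntermediateField 𝔽 Ω :=
  IntermediateField.adjoin 𝔽 (insert w (trKer q j k w))

theorem mem_baseField (q j k : ℕ) (w : Ω) : w ∈ baseField 𝔽 q j k w :=
  IntermediateField.subset_adjoin _ _ (Set.mem_insert _ _)

theorem trKer_subset_baseField (q j k : ℕ) (w : Ω) : trKer q j k w ⊆ baseField 𝔽 q j k w :=
  fun _ hv => IntermediateField.subset_adjoin _ _ (Set.mem_insert_of_mem _ hv)

variable {𝔽}

theorem tr_mem {K : IntermediateField 𝔽 Ω} {a : Ω} (ha : a ∈ K) (q m : ℕ) : tr q m a ∈ K :=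
  sum_mem fun _ _ => pow_mem ha _

variable {p s q j k : ℕ} [CharP Ω p] [IsAlgClosed Ω] [Finite 𝔽]

/-- The elements of the kernel of the adjoint operator are generated by those of the kernel:
an embedding that fixes the latter preserves the pairing, which is nondegenerate. -/
theorem trKer_inv_subset (hp : p.Prime) (hs : 1 ≤ s) (hq : q = p ^ s) (hj : 1 ≤ j) (hk : 1 ≤ k)
    (hjk : Nat.Coprime j k) (hcard : Nat.card 𝔽 = q ^ (j + k)) {w : Ω} (hw : w ≠ 0) :
    trKer q k j w⁻¹ ⊆ (baseField 𝔽 q j k w : Set Ω) := by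
  classical
  intro g hg
  have := ExpChar.prime (R := Ω) hp
  have hq2 : 2 ≤ q := hq ▸ hp.two_le.trans (Nat.le_self_pow (by omega) p)
  let K := baseField 𝔽 q j k w
  have hwK : w ∈ K := mem_baseField 𝔽 q j k w
  have : CharP K p := (algebraMap K Ω).charP (algebraMap K Ω).injective p
  have hg' : tr q j g ^ q ^ k - w⁻¹ * tr q k g = 0 := sub_eq_zero.2 hg
  obtain ⟨V, hV, hVcard⟩ := exists_finset_trKer (Ω := Ω) hp hs hq hj hk hw
  let zK : K := ⟨w⁻¹, inv_mem hwK⟩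
  have hzK : zK ≠ 0 := fun h => inv_ne_zero hw (congrArg (algebraMap K Ω) h)
  suffices h : g ∈ (algebraMap K Ω).range by
    obtain ⟨c, rfl⟩ := h
    exact c.2
  refine mem_range_algebraMap_of_forall_algHom (f := stepPoly q k j zK 0)
    (separable_stepPoly hs hq hk hzK 0) ?_ ?_
  · rw [← eval_map_algebraMap, map_stepPoly, eval_stepPoly, map_zero, add_zero]
    exact hg'
  intro φ
  let L := IntermediateField.adjoin K {g}
  let γ : L := IntermediateField.AdjoinSimple.gen K g
  have hφK : ∀ a : K, φ (algebraMap K L a) = a := fun a => φ.commutes a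
  -- the difference of `g` and its conjugate lies in the kernel of the pairing
  rw [← sub_eq_zero]
  refine eq_zero_of_pairing_eq_zero hq2 hj hk (inv_ne_zero hw)
    (V.image fun v => tr q k v ^ q ^ j) ?_ ?_
  · rw [Finset.card_image_of_injOn, hVcard]
    intro a ha b hb hab
    have ha' := (hV a).1 ha
    have hb' := (hV b).1 hb
    have hab' : tr q k a ^ q ^ j = tr q k b ^ q ^ j := hab
    have h1 : tr q j a = tr q j b := by
      have h2 : w * tr q j a = w * tr q j b := by
        rw [← show tr q k a ^ q ^ j = w * tr q j a from ha', hab']; exact hb'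
      exact mul_left_cancel₀ hw h2
    have h3 : tr q k (a - b) = 0 := by
      refine (pow_eq_zero_iff (pow_ne_zero j (show q ≠ 0 by omega))).1 ?_
      rw [tr_sub hq, sub_pow_q hq, hab', sub_self]
    exact sub_eq_zero.1 (eq_zero_of_tr_eq_zero hq hjk (by rw [tr_sub hq, h1, sub_self]) h3)
  · intro T hT
    obtain ⟨v, hv, rfl⟩ := Finset.mem_image.1 hT
    have hvK : v ∈ K := trKer_subset_baseField 𝔽 q j k w ((hV v).1 hv)
    have hv' : tr q k v ^ q ^ j = w * tr q j v := (hV v).1 hv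
    set T := tr q k v ^ q ^ j
    have hTK : T ∈ K := pow_mem (tr_mem hvK q k) _
    have hT1 : tr q j T - tr q k (w⁻¹ * T) ^ q ^ j = 0 := by
      have h1 : w⁻¹ * T = tr q j v := by rw [hv', inv_mul_cancel_left₀ hw]
      rw [h1, tr_pow_q hq, tr_tr hq j k, sub_self]
    have hc := pairing_pow_sub hq (j := j) (k := k) w⁻¹ g T
    rw [hT1, hg', mul_zero, mul_zero, sub_zero, sub_eq_zero] at hc
    obtain ⟨a, ha⟩ := mem_range_algebraMap_of_pow_card_eq (𝔽 := 𝔽)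
      (hcard ▸ pow_pow_eq_of_pow_eq hc (j + k))
    let TK : K := ⟨T, hTK⟩
    have h1 : pairing q j k (algebraMap K L zK) γ (algebraMap K L TK) =
        algebraMap K L (algebraMap 𝔽 K a) := by
      apply (algebraMap L Ω).injective
      rw [map_pairing]
      exact ha.symm
    have h2 := congrArg φ h1
    have h3 : φ (pairing q j k (algebraMap K L zK) γ (algebraMap K L TK)) =
        pairing q j k w⁻¹ (φ γ) T := by
      have := map_pairing φ.toRingHom q j k (algebraMap K L zK) γ (algebraMap K L TK)
      refine this.trans ?_
      change pairing q j k (φ _) _ (φ _) = _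
      rw [hφK, hφK]
      rfl
    rw [h3, hφK] at h2
    rw [pairing_sub hq, sub_eq_zero]
    exact h2.trans ha

end BaseField

section Link

/-- Consecutive parameters `w = 1 / z_i` and `w' = 1 / z_(i + 1)` of the tower, related through
an element `u` by `r ^ (q ^ j) = w s` and `r = w' s ^ (q ^ k)`, for `r = Tr_k(u) + α` and
`s = Tr_j(u) - β`. -/
structure IsLink {Ω : Type*} [Field Ω] (q j k : ℕ) (α β : ℤ) (w w' u : Ω) : Prop where
  left_ne : tr q k u + α ≠ 0
  right_ne : tr q j u - β ≠ 0
  left_eq : (tr q k u + α) ^ q ^ j = w * (tr q j u - β)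
  right_eq : tr q k u + α = w' * (tr q j u - β) ^ q ^ k

variable {Ω : Type*} [Field Ω] {q j k p s : ℕ} {α β : ℤ} {w w' u : Ω}

theorem IsLink.ne_zero (h : IsLink q j k α β w w' u) : w ≠ 0 := by
  rintro rfl
  have := h.left_eq
  rw [zero_mul] at this
  exact h.left_ne (eq_zero_of_pow_eq_zero this)

theorem IsLink.ne_zero' (h : IsLink q j k α β w w' u) : w' ≠ 0 := by
  rintro rfl
  exact h.left_ne (by rw [h.right_eq, zero_mul])

/-- Links can be read backwards, with `j` and `k` exchanged. -/
theorem IsLink.symm [ExpChar Ω p] (hq : q = p ^ s) (h : IsLink q j k α β w w' u) :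
    IsLink q k j β α w'⁻¹ w⁻¹ (-u) := by
  have e1 : tr q j (-u) + β = -(tr q j u - β) := by rw [tr_neg hq]; ring
  have e2 : tr q k (-u) - α = -(tr q k u + α) := by rw [tr_neg hq]; ring
  refine ⟨?_, ?_, ?_, ?_⟩
  · rw [e1]; exact neg_ne_zero.2 h.right_ne
  · rw [e2]; exact neg_ne_zero.2 h.left_ne
  · rw [e1, e2, neg_pow_q hq, h.right_eq, mul_neg, inv_mul_cancel_left₀ h.ne_zero']
  · rw [e1, e2, neg_pow_q hq, h.left_eq, mul_neg, inv_mul_cancel_left₀ h.ne_zero]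

/-- The parameter `u` of a link is a root of a step polynomial. -/
theorem IsLink.eval_eq_zero [ExpChar Ω p] (hq : q = p ^ s) (h : IsLink q j k α β w w' u) :
    (stepPoly q j k w (α + β * w)).eval u = 0 := by
  have := h.left_eq
  rw [add_pow_q hq, intCast_pow_q hq] at this
  rw [eval_stepPoly]
  linear_combination this

theorem tr_sub_tr_eq_one [ExpChar Ω p] (hq : q = p ^ s) (hαβ : j * α + k * β = 1) (u : Ω) :
    tr q j (tr q k u + α) - tr q k (tr q j u - β) = 1 := by
  rw [tr_add hq, tr_sub hq, tr_tr hq j k, tr_intCast hq, tr_intCast hq]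
  have : ((j * α + k * β : ℤ) : Ω) = 1 := by rw [hαβ, Int.cast_one]
  push_cast at this
  linear_combination this

theorem pow_add_eq_of_tr_sub_tr [ExpChar Ω p] (hq : q = p ^ s) {a b : Ω}
    (h : tr q j a - tr q k b = 1) : a ^ q ^ j + b = b ^ q ^ k + a := by
  have h1 := tr_pow_sub hq j a
  have h2 := tr_pow_sub hq k b
  have h3 : (tr q j a - tr q k b) ^ q = 1 := by rw [h, one_pow]
  have h4 : (tr q j a - tr q k b) ^ q = tr q j a ^ q - tr q k b ^ q := by
    simpa using sub_pow_q hq 1 (tr q j a) (tr q k b)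
  rw [h4] at h3
  linear_combination h3 - h1 + h2 - h

/-- The map `v ↦ c ^ q - c`, with `c = Tr_k(v) / r`, from the kernel attached to `w` to the one
attached to `w'`. -/
theorem IsLink.map_trKer [ExpChar Ω p] (hq : q = p ^ s) (hαβ : j * α + k * β = 1)
    (h : IsLink q j k α β w w' u) {v : Ω} (hv : v ∈ trKer q j k w) :
    (tr q k v / (tr q k u + α)) ^ q - tr q k v / (tr q k u + α) ∈ trKer q j k w' := by
  have h1 := tr_sub_tr_eq_one hq hαβ u
  obtain ⟨hr, hs, hl, hr'⟩ := h
  set a := tr q k v with ha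
  set r := tr q k u + α
  set t := tr q j u - β
  have hv' : a ^ q ^ j = w * tr q j v := hv
  set c := a / r with hc
  have hac : a = r * c := (mul_div_cancel₀ a hr).symm
  -- `Tr_j (r c) = Tr_k (t c ^ (q ^ j))`
  have hb : tr q j v = t * c ^ q ^ j := by
    have hw : w ≠ 0 := by
      rintro rfl
      rw [zero_mul] at hl
      exact hr (eq_zero_of_pow_eq_zero hl)
    apply mul_left_cancel₀ hw
    rw [← hv', hac, mul_pow, hl, mul_assoc]
  have h2 : tr q j (r * c) = tr q k (t * c ^ q ^ j) := by
    rw [← hac, ← hb, ha, tr_tr hq]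
  have h3 : (r * c) ^ q ^ j + t * c ^ q ^ j = (t * c ^ q ^ j) ^ q ^ k + r * c := by
    have e1 := tr_pow_sub hq j (r * c)
    have e2 := tr_pow_sub hq k (t * c ^ q ^ j)
    rw [h2] at e1
    linear_combination e2 - e1
  have h4 := pow_add_eq_of_tr_sub_tr hq h1
  have key : t ^ q ^ k * ((c ^ q ^ k) ^ q ^ j - c ^ q ^ j) = r * (c ^ q ^ j - c) := by
    rw [mul_pow, mul_pow, ← pow_mul c, mul_comm (q ^ j), pow_mul] at h3
    linear_combination (c ^ q ^ j) * h4 - h3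
  have h5 : ∀ m, tr q m (c ^ q - c) = c ^ q ^ m - c := by
    intro m
    have := tr_pow_q hq m 1 c
    rw [pow_one] at this
    rw [tr_sub hq, this, tr_pow_sub hq]
  change tr q k (c ^ q - c) ^ q ^ j = w' * tr q j (c ^ q - c)
  rw [h5, h5, sub_pow_q hq]
  have ht : t ^ q ^ k ≠ 0 := pow_ne_zero _ hs
  apply mul_left_cancel₀ ht
  rw [key, hr']
  ring

theorem IsLink.map_trKer_injOn [ExpChar Ω p] (hq : q = p ^ s) (hjk : Nat.Coprime j k)
    (hαβ : j * α + k * β = 1) (h : IsLink q j k α β w w' u) :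
    Set.InjOn (fun v => (tr q k v / (tr q k u + α)) ^ q - tr q k v / (tr q k u + α))
      (trKer q j k w) := by
  intro a ha b hb hab
  have h1 := tr_sub_tr_eq_one hq hαβ u
  have hv := sub_mem_trKer hq ha hb
  rw [← sub_eq_zero]
  set v := a - b with hvab
  have hv' : tr q k v ^ q ^ j = w * tr q j v := hv
  set r := tr q k u + α
  set t := tr q j u - β
  set c := tr q k v / r with hc
  have hac : tr q k v = r * c := (mul_div_cancel₀ _ h.left_ne).symm
  have hcq : c ^ q = c := by
    have e : c = tr q k a / r - tr q k b / r := by rw [hc, hvab, tr_sub hq, sub_div]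
    have e2 : c ^ q = (tr q k a / r) ^ q - (tr q k b / r) ^ q := by
      rw [e]
      simpa using sub_pow_q hq 1 (tr q k a / r) (tr q k b / r)
    have hab' : (tr q k a / r) ^ q - tr q k a / r = (tr q k b / r) ^ q - tr q k b / r := hab
    rw [e2, e]
    linear_combination hab'
  have hb' : tr q j v = c * t := by
    apply mul_left_cancel₀ h.ne_zero
    rw [← hv', hac, mul_pow, h.left_eq, pow_pow_eq_of_pow_eq hcq]
    ring
  have hc0 : c = 0 := by
    have e : tr q j (tr q k v) = tr q k (tr q j v) := tr_tr hq j k v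
    rw [hac, hb', mul_comm r, tr_mul_of_pow_eq hcq, tr_mul_of_pow_eq hcq] at e
    have : c * (tr q j r - tr q k t) = 0 := by linear_combination e
    rwa [h1, mul_one] at this
  exact eq_zero_of_tr_eq_zero hq hjk (by rw [hb', hc0, zero_mul]) (by rw [hac, hc0, mul_zero])

end Link

section LinkFields

/-- The data common to all links: `q` is a power of the characteristic `p`, the field `𝔽` has
`q ^ (j + k)` elements, `j` and `k` are coprime, with Bézout coefficients `α` and `β`. -/
structure IsLinkData (𝔽 : Type*) (p s q j k : ℕ) (α β : ℤ) : Prop where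
  prime : p.Prime
  one_le : 1 ≤ s
  eq_pow : q = p ^ s
  left_pos : 1 ≤ j
  right_pos : 1 ≤ k
  coprime : Nat.Coprime j k
  bezout : j * α + k * β = 1
  card : Nat.card 𝔽 = q ^ (j + k)

theorem IsLinkData.symm {𝔽 : Type*} {p s q j k : ℕ} {α β : ℤ}
    (D : IsLinkData 𝔽 p s q j k α β) : IsLinkData 𝔽 p s q k j β α :=
  ⟨D.prime, D.one_le, D.eq_pow, D.right_pos, D.left_pos, D.coprime.symm,
    by rw [add_comm]; exact D.bezout, by rw [add_comm]; exact D.card⟩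

theorem IsLinkData.two_le {𝔽 : Type*} {p s q j k : ℕ} {α β : ℤ}
    (D : IsLinkData 𝔽 p s q j k α β) : 2 ≤ q := by
  rw [D.eq_pow]
  exact D.prime.two_le.trans (Nat.le_self_pow (by have := D.one_le; omega) p)

variable {𝔽 Ω : Type*} [Field 𝔽] [Field Ω] [Algebra 𝔽 Ω] {q j k p s : ℕ} {α β : ℤ} {w w' u : Ω}

theorem IsLink.mem_left (h : IsLink q j k α β w w' u) {K : IntermediateField 𝔽 Ω} (hu : u ∈ K) :
    w ∈ K := by
  have : w = (tr q k u + α) ^ q ^ j / (tr q j u - β) := by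
    rw [h.left_eq, mul_div_cancel_right₀ _ h.right_ne]
  rw [this]
  exact div_mem (pow_mem (add_mem (tr_mem hu q k) (intCast_mem K α)) _)
    (sub_mem (tr_mem hu q j) (intCast_mem K β))

theorem IsLink.mem_right (h : IsLink q j k α β w w' u) {K : IntermediateField 𝔽 Ω} (hu : u ∈ K) :
    w' ∈ K := by
  have : w' = (tr q k u + α) / (tr q j u - β) ^ q ^ k := by
    rw [h.right_eq, mul_div_cancel_right₀ _ (pow_ne_zero _ h.right_ne)]
  rw [this]
  exact div_mem (add_mem (tr_mem hu q k) (intCast_mem K α))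
    (pow_mem (sub_mem (tr_mem hu q j) (intCast_mem K β)) _)

variable [IsAlgClosed Ω] [CharP Ω p]

/-- The kernel attached to `w'` is the image of the kernel attached to `w` under an injective map
defined over `𝔽(w, u)`, since both kernels have the same finite number of elements. -/
theorem IsLink.baseField_le (D : IsLinkData 𝔽 p s q j k α β) (h : IsLink q j k α β w w' u)
    {K : IntermediateField 𝔽 Ω} (hK : baseField 𝔽 q j k w ≤ K) (hu : u ∈ K) :
    baseField 𝔽 q j k w' ≤ K := by
  classical
  have := ExpChar.prime (R := Ω) D.prime
  refine IntermediateField.adjoin_le_iff.2 (Set.insert_subset (h.mem_right hu) ?_)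
  obtain ⟨V, hV, hVcard⟩ := exists_finset_trKer (Ω := Ω) D.prime D.one_le D.eq_pow D.left_pos
    D.right_pos h.ne_zero
  obtain ⟨V', hV', hVcard'⟩ := exists_finset_trKer (Ω := Ω) D.prime D.one_le D.eq_pow D.left_pos
    D.right_pos h.ne_zero'
  have himage : V.image (fun v => (tr q k v / (tr q k u + α)) ^ q - tr q k v / (tr q k u + α)) =
      V' := by
    refine Finset.eq_of_subset_of_card_le (fun x hx => ?_) ?_
    · obtain ⟨v, hv, rfl⟩ := Finset.mem_image.1 hx
      exact (hV' _).2 (h.map_trKer D.eq_pow D.bezout ((hV v).1 hv))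
    · rw [hVcard', Finset.card_image_of_injOn, hVcard]
      intro a ha b hb
      exact h.map_trKer_injOn D.eq_pow D.coprime D.bezout
        ((hV a).1 ha) ((hV b).1 hb)
  intro x hx
  rw [← hV', ← himage, Finset.mem_image] at hx
  obtain ⟨v, hv, rfl⟩ := hx
  have hvK : v ∈ K := hK (trKer_subset_baseField 𝔽 q j k w ((hV v).1 hv))
  have hc : tr q k v / (tr q k u + α) ∈ K :=
    div_mem (tr_mem hvK q k) (add_mem (tr_mem hu q k) (intCast_mem K α))
  exact sub_mem (pow_mem hc _) hc

variable [Finite 𝔽]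

/-- The kernels attached to `w` and, with `j` and `k` exchanged, to `1 / w` belong to adjoint
operators and generate the same field. -/
theorem baseField_inv (D : IsLinkData 𝔽 p s q j k α β) (hw : w ≠ 0) :
    baseField 𝔽 q k j w⁻¹ = baseField 𝔽 q j k w := by
  refine le_antisymm ?_ ?_
  · refine IntermediateField.adjoin_le_iff.2 (Set.insert_subset
      (inv_mem (mem_baseField 𝔽 q j k w)) (trKer_inv_subset D.prime D.one_le D.eq_pow D.left_pos
        D.right_pos D.coprime D.card hw))
  · have h := inv_mem (mem_baseField 𝔽 q k j w⁻¹)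
    rw [inv_inv] at h
    have h2 := trKer_inv_subset D.prime D.one_le D.eq_pow D.right_pos
        D.left_pos D.symm.coprime D.symm.card (inv_ne_zero hw)
    rw [inv_inv] at h2
    exact IntermediateField.adjoin_le_iff.2 (Set.insert_subset h h2)

theorem IsLink.baseField_le' (D : IsLinkData 𝔽 p s q j k α β) (h : IsLink q j k α β w w' u)
    {K : IntermediateField 𝔽 Ω} (hK : baseField 𝔽 q j k w' ≤ K) (hu : u ∈ K) :
    baseField 𝔽 q j k w ≤ K := by
  have := ExpChar.prime (R := Ω) D.prime
  rw [← baseField_inv D h.ne_zero]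
  refine (h.symm D.eq_pow).baseField_le D.symm ?_ (neg_mem hu)
  rwa [baseField_inv D h.ne_zero']

/-- The parameter `u` of a link is generated over the base field by `w'`: a conjugate of `u` gives
a conjugate `ζ r` of `r` with `ζ` in `𝔽`, and for `ζ ≠ 1` this would make `r` rational. -/
theorem IsLink.mem_of_mem_right (D : IsLinkData 𝔽 p s q j k α β) (h : IsLink q j k α β w w' u)
    {K : IntermediateField 𝔽 Ω} (hK : baseField 𝔽 q j k w ≤ K) (hw' : w' ∈ K) : u ∈ K := by
  have := ExpChar.prime (R := Ω) D.prime
  have hq := D.eq_pow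
  have : CharP K p := (algebraMap K Ω).charP (algebraMap K Ω).injective p
  have := ExpChar.prime (R := K) D.prime
  have hwK : w ∈ K := hK (mem_baseField 𝔽 q j k w)
  by_cases hr : tr q k u + α ∈ K
  · have hs : tr q j u - β ∈ K := by
      have : tr q j u - β = (tr q k u + α) ^ q ^ j / w := by
        rw [h.left_eq, mul_div_cancel_left₀ _ h.ne_zero]
      rw [this]
      exact div_mem (pow_mem hr _) hwK
    have ha : tr q k u ∈ K := by simpa using sub_mem hr (intCast_mem K α)
    have hb : tr q j u ∈ K := by simpa using add_mem hs (intCast_mem K β)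
    have hab : tr q j (⟨_, ha⟩ : K) = tr q k (⟨_, hb⟩ : K) := by
      apply (algebraMap K Ω).injective
      rw [map_tr, map_tr]
      exact tr_tr hq j k u
    obtain ⟨v, hv, hv'⟩ := exists_tr_eq hq D.coprime hab
    have hv1 := congrArg (algebraMap K Ω) hv
    have hv1' := congrArg (algebraMap K Ω) hv'
    rw [map_tr] at hv1 hv1'
    have hvu : algebraMap K Ω v - u = 0 := by
      refine eq_zero_of_tr_eq_zero hq D.coprime ?_ ?_
      · rw [tr_sub hq, hv1']; exact sub_self _
      · rw [tr_sub hq, hv1]; exact sub_self _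
    rw [← sub_eq_zero.1 hvu]
    exact v.2
  let wK : K := ⟨w, hwK⟩
  have hwK0 : wK ≠ 0 := fun e => h.ne_zero (congrArg (algebraMap K Ω) e)
  suffices hu : u ∈ (algebraMap K Ω).range by
    obtain ⟨c, hc⟩ := hu
    rw [← hc]
    exact c.2
  refine mem_range_algebraMap_of_forall_algHom (f := stepPoly q j k wK (α + β * wK))
    (separable_stepPoly D.one_le hq D.left_pos hwK0 _) ?_ ?_
  · rw [← eval_map_algebraMap, map_stepPoly]
    have e := h.eval_eq_zero hq
    rw [map_add, map_mul, map_intCast, map_intCast]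
    exact e
  intro φ
  let L := IntermediateField.adjoin K {u}
  let γ : L := IntermediateField.AdjoinSimple.gen K u
  have hγ : algebraMap L Ω γ = u := rfl
  have hφK : ∀ a : K, φ (algebraMap K L a) = a := fun a => φ.commutes a
  have hLK : ∀ a : K, algebraMap L Ω (algebraMap K L a) = a := fun a => rfl
  have hφtr : ∀ m, φ (tr q m γ) = tr q m (φ γ) := fun m => map_tr φ.toRingHom q m γ
  -- the conjugate satisfies the same equations
  have hl : (tr q k (φ γ) + α) ^ q ^ j = w * (tr q j (φ γ) - β) := by
    have e : (tr q k γ + (α : L)) ^ q ^ j = algebraMap K L wK * (tr q j γ - (β : L)) := by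
      apply (algebraMap L Ω).injective
      rw [map_pow, map_mul, map_add, map_sub, map_tr, map_tr, hγ, hLK, map_intCast, map_intCast]
      exact h.left_eq
    have e' := congrArg φ e
    rwa [map_pow, map_mul, map_add, map_sub, hφtr, hφtr, hφK, map_intCast, map_intCast] at e'
  have hr' : tr q k (φ γ) + α = w' * (tr q j (φ γ) - β) ^ q ^ k := by
    have e : tr q k γ + (α : L) = algebraMap K L ⟨w', hw'⟩ * (tr q j γ - (β : L)) ^ q ^ k := by
      apply (algebraMap L Ω).injective
      rw [map_mul, map_pow, map_add, map_sub, map_tr, map_tr, hγ, hLK, map_intCast, map_intCast]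
      exact h.right_eq
    have e' := congrArg φ e
    rwa [map_mul, map_pow, map_add, map_sub, hφtr, hφtr, hφK, map_intCast, map_intCast] at e'
  change φ γ = u
  set u' := φ γ
  have hpow : ∀ y : Ω, (tr q k y + α) ^ q ^ j = w * (tr q j y - β) →
      tr q k y + α = w' * (tr q j y - β) ^ q ^ k →
      w' * (tr q k y + α) ^ q ^ (j + k) = w ^ q ^ k * (tr q k y + α) := by
    intro y h1 h2
    rw [pow_add, pow_mul, h1, mul_pow, h2]
    ring
  set r := tr q k u + α with hrdef
  set r' := tr q k u' + α with hrdef'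
  have hζ : (r' / r) ^ q ^ (j + k) = r' / r := by
    have e1 := hpow u h.left_eq h.right_eq
    have e2 := hpow u' hl hr'
    have hw0 := h.ne_zero'
    have hr0 : r ≠ 0 := h.left_ne
    rw [div_pow, div_eq_div_iff (pow_ne_zero _ hr0) hr0]
    apply mul_left_cancel₀ hw0
    linear_combination r * e2 - r' * e1
  obtain ⟨a, ha⟩ := mem_range_algebraMap_of_pow_card_eq (𝔽 := 𝔽) (D.card ▸ hζ)
  have hζK : r' / r ∈ K := ha ▸ K.algebraMap_mem a
  have hv : u' - u ∈ trKer q j k w := by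
    change tr q k (u' - u) ^ q ^ j = w * tr q j (u' - u)
    have e : tr q k (u' - u) = r' - r := by rw [tr_sub hq, hrdef, hrdef']; ring
    rw [e, sub_pow_q hq, hl, h.left_eq, tr_sub hq]
    ring
  have hvK := hK (trKer_subset_baseField 𝔽 q j k w hv)
  have hrr : tr q k (u' - u) = r' - r := by rw [tr_sub hq, hrdef, hrdef']; ring
  have hζ1 : r' = r := by
    by_contra hne
    apply hr
    have hr0 : r ≠ 0 := h.left_ne
    have hne' : r' / r - 1 ≠ 0 := by
      rw [sub_ne_zero, Ne, div_eq_one_iff_eq hr0]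
      exact hne
    have e : r = tr q k (u' - u) / (r' / r - 1) := by
      rw [hrr, eq_div_iff hne']
      field_simp
    rw [e]
    exact div_mem (tr_mem hvK q k) (sub_mem hζK (one_mem K))
  have hss : tr q j (u' - u) = 0 := by
    apply mul_left_cancel₀ h.ne_zero
    have e := hl
    rw [hζ1, h.left_eq] at e
    rw [tr_sub hq]
    linear_combination -e
  exact sub_eq_zero.1 (eq_zero_of_tr_eq_zero hq D.coprime hss (by rw [hrr, hζ1, sub_self]))

end LinkFields

section Transcendence

variable {𝔽 Ω : Type*} [Field 𝔽] [Field Ω] [Algebra 𝔽 Ω] {q j k p s : ℕ} {α β : ℤ} {w w' u : Ω}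
  [CharP Ω p]

/-- If `w'` is algebraic over `𝔽`, so is `u`, as a root of the step polynomial of the reversed link,
and therefore also `w`. -/
theorem IsLink.transcendental (D : IsLinkData 𝔽 p s q j k α β) (h : IsLink q j k α β w w' u)
    (hw : Transcendental 𝔽 w) : Transcendental 𝔽 w' := by
  have := ExpChar.prime (R := Ω) D.prime
  intro hw'
  apply hw
  let A := algebraicClosure 𝔽 Ω
  have hwA : w' ∈ A := mem_algebraicClosure_iff.2 hw'
  let c : A := (⟨w', hwA⟩ : A)⁻¹
  have hu : IsAlgebraic A (-u) := by
    refine ⟨stepPoly q k j c (β + α * c),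
      (monic_stepPoly D.two_le D.right_pos D.left_pos _ _).1.ne_zero, ?_⟩
    rw [← eval_map_algebraMap, map_stepPoly, map_add, map_mul, map_intCast, map_intCast]
    exact (h.symm D.eq_pow).eval_eq_zero D.eq_pow
  have hu' : -u ∈ A := mem_algebraicClosure_iff.2 (hu.restrictScalars 𝔽)
  exact mem_algebraicClosure_iff.1 (h.mem_left (neg_mem_iff.1 hu'))

end Transcendence

section TowerLink

variable {Ω : Type*} [Field Ω] {q j k p s : ℕ} {α β : ℤ}

/-- Consecutive members of a tower sequence give rise to a link. The element `u` is obtained from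
`r = y / x ^ (q ^ k)` and `s = - y ^ (q ^ j) / x` by the Euclidean algorithm. -/
theorem exists_isLink [ExpChar Ω p] (hs : 1 ≤ s) (hp : 2 ≤ p) (hq : q = p ^ s)
    (hjk : Nat.Coprime j k) (hαβ : j * α + k * β = 1) {x y : Ω}
    (h : TowerEquation q (j + k) k x y) :
    ∃ u, IsLink q j k α β (-x ^ (q ^ (j + k) - 1))⁻¹ (-y ^ (q ^ (j + k) - 1))⁻¹ u := by
  have hq2 : 2 ≤ q := hq ▸ hp.trans (Nat.le_self_pow (by omega) p)
  have hpos : ∀ m, q ^ m ≠ 0 := fun m => pow_ne_zero m (by omega)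
  have hE : tr q j (y / x ^ q ^ k) - tr q k (-(y ^ q ^ j / x)) = 1 := by
    rw [tr_neg hq, sub_neg_eq_add, ← h]
    simp only [tr, div_pow, ← pow_mul, ← pow_add, Nat.add_sub_cancel]
  have hx : x ≠ 0 := by
    rintro rfl
    rw [zero_pow (hpos k), div_zero, div_zero, neg_zero, tr_zero hq, tr_zero hq, sub_zero] at hE
    exact zero_ne_one hE
  have hy : y ≠ 0 := by
    rintro rfl
    rw [zero_pow (hpos j), zero_div, zero_div, neg_zero, tr_zero hq, tr_zero hq, sub_zero] at hE
    exact zero_ne_one hE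
  set r := y / x ^ q ^ k with hr
  set t := -(y ^ q ^ j / x) with ht
  have hpair : tr q j (r - α) = tr q k (t + β) := by
    have e : ((j * α + k * β : ℤ) : Ω) = 1 := by rw [hαβ, Int.cast_one]
    push_cast at e
    rw [tr_sub hq, tr_add hq, tr_intCast hq, tr_intCast hq]
    linear_combination hE - e
  obtain ⟨u, hu, hu'⟩ := exists_tr_eq hq hjk hpair
  have hr' : tr q k u + α = r := by rw [hu]; ring
  have ht' : tr q j u - β = t := by rw [hu']; ring
  have hN : q ^ (j + k) = q ^ (j + k) - 1 + 1 := by have := hpos (j + k); omega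
  refine ⟨u, ?_, ?_, ?_, ?_⟩
  · rw [hr']; exact div_ne_zero hy (pow_ne_zero _ hx)
  · rw [ht']; exact neg_ne_zero.2 (div_ne_zero (pow_ne_zero _ hy) hx)
  · have e : x ^ q ^ (j + k) = x ^ (q ^ (j + k) - 1) * x := by rw [← pow_succ, ← hN]
    rw [hr', ht', hr, ht, div_pow, ← pow_mul, ← pow_add, add_comm k j, e, inv_neg]
    field_simp
  · have e : y ^ q ^ (j + k) = y ^ (q ^ (j + k) - 1) * y := by rw [← pow_succ, ← hN]
    rw [hr', ht', hr, ht, neg_pow_q hq, div_pow, ← pow_mul, ← pow_add, e, inv_neg]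
    field_simp

end TowerLink

/-! ### Local behaviour of the roots of the step polynomials -/

section LocalRoots

variable {E : Type*} [Field E] {Q : ValuationSubring E} {p s q j k : ℕ}

theorem tr_mem_valuationSubring {a : E} (ha : a ∈ Q) (q m : ℕ) : tr q m a ∈ Q :=
  sum_mem fun _ _ => pow_mem ha _

theorem tr_mem_nonunits (hq : q ≠ 0) {a : E} (ha : a ∈ Q.nonunits) (m : ℕ) :
    tr q m a ∈ Q.nonunits := by
  refine sum_mem fun i _ => ?_
  obtain ⟨l, hl⟩ := Nat.exists_eq_succ_of_ne_zero (pow_ne_zero i hq)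
  rw [hl, pow_succ]
  exact mul_mem_nonunits (pow_mem (Q.nonunits_subset ha) l) ha

theorem intCast_mem_valuationSubring (c : ℤ) : (c : E) ∈ Q := intCast_mem Q c

theorem mem_of_eval_stepPoly_eq_zero (hq2 : 2 ≤ q) (hj : 1 ≤ j) (hk : 1 ≤ k) {w c y : E}
    (hw : w ∈ Q) (hc : c ∈ Q) (h : (stepPoly q j k w c).eval y = 0) : y ∈ Q := by
  have htr : ∀ m, trPoly E q m ∈ lifts (algebraMap Q E) := fun m =>
    sum_mem fun i _ => X_pow_mem_lifts (algebraMap Q E) _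
  have hlift : stepPoly q j k w c ∈ lifts (algebraMap Q E) := by
    have e : stepPoly q j k w c =
        trPoly E q k ^ q ^ j + C (-w) * trPoly E q j + C c := by
      rw [stepPoly, C_neg]; ring
    rw [e]
    exact add_mem (add_mem (pow_mem (htr k) _)
      (mul_mem (C_mem_lifts (algebraMap Q E) ⟨-w, neg_mem hw⟩) (htr j)))
      (C_mem_lifts (algebraMap Q E) ⟨c, hc⟩)
  obtain ⟨g, hg, -, hm⟩ := lifts_and_natDegree_eq_and_monic hlift (monic_stepPoly hq2 hj hk w c).1
  have hint : IsIntegral Q y := by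
    refine ⟨g, hm, ?_⟩
    rw [eval₂_eq_eval_map, hg, h]
  obtain ⟨x, hx⟩ := IsIntegrallyClosed.isIntegral_iff.1 hint
  rw [← hx]
  exact x.2

variable [IsDiscreteValuationRing Q]

theorem le_ord_tr {a : E} (ha : a ∈ Q) (hq : q ≠ 0) (m : ℕ) : ord Q a ≤ ord Q (tr q m a) := by
  induction m with
  | zero => rw [tr_zero_left, ord_zero]; exact le_top
  | succ m ih =>
    rw [tr_add_left, tr_one_left]
    refine le_trans (le_min ih ?_) (min_le_ord_add (tr_mem_valuationSubring ha q m)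
      (pow_mem ha _))
    rw [ord_pow ha]
    exact le_mul_of_one_le_left' (by exact_mod_cast Nat.one_le_iff_ne_zero.2 (pow_ne_zero m hq))

/-- On the maximal ideal the linear term dominates in `Tr_m`. -/
theorem ord_tr (hq2 : 2 ≤ q) {a : E} (ha : a ∈ Q.nonunits) {m : ℕ} (hm : 1 ≤ m) :
    ord Q (tr q m a) = ord Q a ∧ (q : ℕ∞) * ord Q a ≤ ord Q (tr q m a - a) := by
  obtain ⟨m, rfl⟩ := Nat.exists_eq_add_of_le hm
  have haQ := Q.nonunits_subset ha
  have e : tr q (1 + m) a - a = tr q m (a ^ q) := by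
    rw [tr_add_left, tr_one_left, pow_one]; ring
  have h2 : (q : ℕ∞) * ord Q a ≤ ord Q (tr q (1 + m) a - a) := by
    rw [e, ← ord_pow haQ]
    exact le_ord_tr (pow_mem haQ q) (by omega) m
  refine ⟨?_, h2⟩
  by_cases ha0 : a = 0
  · subst ha0
    have : tr q (1 + m) (0 : E) = 0 :=
      Finset.sum_eq_zero fun i _ => zero_pow (pow_ne_zero i (by omega))
    rw [this]
  · obtain ⟨l, hl⟩ := ENat.ne_top_iff_exists.1 (ord_ne_top (Q := Q) ha0)
    have h1 := one_le_ord_iff.2 ha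
    rw [← hl] at h1
    have hl1 : 1 ≤ l := by exact_mod_cast h1
    have hlt : ord Q a < ord Q (tr q (1 + m) a - a) := by
      refine lt_of_lt_of_le ?_ h2
      rw [← hl]
      exact_mod_cast (by nlinarith : l < q * l)
    have := ord_add_eq haQ (sub_mem (tr_mem_valuationSubring haQ q (1 + m)) haQ) hlt
    rwa [add_sub_cancel] at this

/-- All the nonzero elements of the kernel in the maximal ideal have the same order. -/
theorem ord_of_mem_trKer (hq2 : 2 ≤ q) (hj : 1 ≤ j) (hk : 1 ≤ k) {w v : E} (hw : w ∈ Q)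
    (hv : v ∈ trKer q j k w) (hvm : v ∈ Q.nonunits) :
    (q ^ j : ℕ) * ord Q v = ord Q w + ord Q v := by
  have hvQ := Q.nonunits_subset hvm
  have h : tr q k v ^ q ^ j = w * tr q j v := hv
  have := congrArg (ord Q) h
  rwa [ord_pow (tr_mem_valuationSubring hvQ q k), ord_mul hw (tr_mem_valuationSubring hvQ q j),
    (ord_tr hq2 hvm hk).1, (ord_tr hq2 hvm hj).1] at this

/-- Away from the zeros of `w`, the kernel meets the maximal ideal trivially. -/
theorem eq_zero_of_mem_trKer (hq2 : 2 ≤ q) (hj : 1 ≤ j) (hk : 1 ≤ k) {w v : E} (hw : w ∉ Q.nonunits)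
    (hv : v ∈ trKer q j k w) (hvm : v ∈ Q.nonunits) : v = 0 := by
  have hw0 : w ≠ 0 := by rintro rfl; exact hw Q.nonunits.zero_mem
  have hz : w⁻¹ ∈ Q := by
    by_contra h
    exact hw ((ValuationSubring.mem_nonunits_iff_or Q).2 (Or.inr h))
  have hvQ := Q.nonunits_subset hvm
  have h : w⁻¹ * tr q k v ^ q ^ j = tr q j v := by
    have e : tr q k v ^ q ^ j = w * tr q j v := hv
    rw [e, inv_mul_cancel_left₀ hw0]
  have := congrArg (ord Q) h
  rw [ord_mul hz (pow_mem (tr_mem_valuationSubring hvQ q k) _),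
    ord_pow (tr_mem_valuationSubring hvQ q k), (ord_tr hq2 hvm hk).1, (ord_tr hq2 hvm hj).1] at this
  by_contra hv0
  obtain ⟨l, hl⟩ := ENat.ne_top_iff_exists.1 (ord_ne_top (Q := Q) hv0)
  have h1 := one_le_ord_iff.2 hvm
  rw [← hl] at this h1
  have hl1 : 1 ≤ l := by exact_mod_cast h1
  have h2 : ((q ^ j : ℕ) : ℕ∞) * (l : ℕ∞) ≤ l := le_add_self.trans this.le
  have h3 : q ^ j * l ≤ l := by exact_mod_cast h2
  have h4 : 2 ≤ q ^ j := hq2.trans (Nat.le_self_pow (by omega) q)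
  nlinarith

/-- Modulo higher order terms, the elements of the kernel in the maximal ideal satisfy
`v ^ (q ^ j) = w v`. Hence the ratio of two of them reduces to a solution of `x ^ (q ^ j) = x`. -/
theorem div_pow_sub_div_mem_nonunits [ExpChar E p] (hq : q = p ^ s) (hq2 : 2 ≤ q) (hj : 1 ≤ j)
    (hk : 1 ≤ k) {w v v₀ : E} (hw : w ∈ Q.nonunits) (hv : v ∈ trKer q j k w) (hvm : v ∈ Q.nonunits)
    (hv₀ : v₀ ∈ trKer q j k w) (hvm₀ : v₀ ∈ Q.nonunits) (h0 : v₀ ≠ 0) (hord : ord Q v₀ ≤ ord Q v) :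
    (v / v₀) ^ q ^ j - v / v₀ ∈ Q.nonunits := by
  have hwQ := Q.nonunits_subset hw
  obtain ⟨l, hl⟩ := ENat.ne_top_iff_exists.1 (ord_ne_top (Q := Q) h0)
  have hl1 : 1 ≤ l := by
    have h1 := one_le_ord_iff.2 hvm₀
    rw [← hl] at h1
    exact_mod_cast h1
  have hv0Q := Q.nonunits_subset hvm₀
  have hvQ := Q.nonunits_subset hvm
  have hqj : q ^ j ≠ 0 := pow_ne_zero _ (by omega)
  have hw1 : ord Q w + l = (q ^ j : ℕ) * l := by
    rw [hl]; exact (ord_of_mem_trKer hq2 hj hk hwQ hv₀ hvm₀).symm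
  -- the estimate for a single element
  have key : ∀ x ∈ trKer q j k w, x ∈ Q.nonunits → ord Q v₀ ≤ ord Q x →
      ((q ^ j * l + 1 : ℕ) : ℕ∞) ≤ ord Q (x ^ q ^ j - w * x) := by
    intro x hx hxm hxo
    have hxQ := Q.nonunits_subset hxm
    have hx' : tr q k x ^ q ^ j = w * tr q j x := hx
    have e : x ^ q ^ j - w * x = w * (tr q j x - x) - (tr q k x - x) ^ q ^ j := by
      rw [sub_pow_q hq, hx']; ring
    have hqx : ((q * l : ℕ) : ℕ∞) ≤ (q : ℕ∞) * ord Q x := by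
      rw [Nat.cast_mul, hl]; gcongr
    have m1 : tr q j x - x ∈ Q := sub_mem (tr_mem_valuationSubring hxQ q j) hxQ
    have m2 : tr q k x - x ∈ Q := sub_mem (tr_mem_valuationSubring hxQ q k) hxQ
    rw [e]
    refine le_trans (le_min ?_ ?_) (min_le_ord_sub (Q.mul_mem _ _ hwQ m1) (pow_mem m2 _))
    · rw [ord_mul hwQ m1]
      have h1 : ((q * l : ℕ) : ℕ∞) ≤ ord Q (tr q j x - x) := hqx.trans (ord_tr hq2 hxm hj).2
      have h2 : ((l + 1 : ℕ) : ℕ∞) ≤ ord Q (tr q j x - x) :=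
        le_trans (by exact_mod_cast (by nlinarith : l + 1 ≤ q * l)) h1
      calc ((q ^ j * l + 1 : ℕ) : ℕ∞) = ord Q w + ((l + 1 : ℕ) : ℕ∞) := by
            push_cast at hw1 ⊢
            rw [← add_assoc, hw1]
        _ ≤ _ := by gcongr
    · rw [ord_pow m2]
      have h1 : ((q * l : ℕ) : ℕ∞) ≤ ord Q (tr q k x - x) := hqx.trans (ord_tr hq2 hxm hk).2
      have h2 : ((l + 1 : ℕ) : ℕ∞) ≤ ord Q (tr q k x - x) :=
        le_trans (by exact_mod_cast (by nlinarith : l + 1 ≤ q * l)) h1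
      calc ((q ^ j * l + 1 : ℕ) : ℕ∞) ≤ ((q ^ j : ℕ) : ℕ∞) * ((l + 1 : ℕ) : ℕ∞) := by
            exact_mod_cast (by have := Nat.pos_of_ne_zero hqj; nlinarith)
        _ ≤ _ := by gcongr
  have k1 := key v hv hvm hord
  have k2 := key v₀ hv₀ hvm₀ le_rfl
  have m1 : v ^ q ^ j - w * v ∈ Q := sub_mem (pow_mem hvQ _) (Q.mul_mem _ _ hwQ hvQ)
  have m2 : v₀ ^ q ^ j - w * v₀ ∈ Q := sub_mem (pow_mem hv0Q _) (Q.mul_mem _ _ hwQ hv0Q)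
  have hden : v₀ ^ (q ^ j + 1) ≠ 0 := pow_ne_zero _ h0
  have e : (v / v₀) ^ q ^ j - v / v₀ =
      ((v ^ q ^ j - w * v) * v₀ - v * (v₀ ^ q ^ j - w * v₀)) / v₀ ^ (q ^ j + 1) := by
    have : v₀ ^ q ^ j ≠ 0 := pow_ne_zero _ h0
    rw [div_pow, pow_succ]
    field_simp
    ring
  have hnum : ((q ^ j * l + 1 + l : ℕ) : ℕ∞) ≤
      ord Q ((v ^ q ^ j - w * v) * v₀ - v * (v₀ ^ q ^ j - w * v₀)) := by
    refine le_trans (le_min ?_ ?_) (min_le_ord_sub (Q.mul_mem _ _ m1 hv0Q) (Q.mul_mem _ _ hvQ m2))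
    · rw [ord_mul m1 hv0Q, ← hl, Nat.cast_add _ l]
      gcongr
    · rw [ord_mul hvQ m2, Nat.cast_add _ l, add_comm]
      gcongr
      rwa [hl]
  have hdord : ord Q (v₀ ^ (q ^ j + 1)) = ((q ^ j * l + l : ℕ) : ℕ∞) := by
    rw [ord_pow hv0Q, ← hl]; push_cast; ring
  have hmem := sub_mem (Q.mul_mem _ _ m1 hv0Q) (Q.mul_mem _ _ hvQ m2)
  obtain ⟨-, h3⟩ := div_mem_and_ord_div hmem (pow_mem hv0Q (q ^ j + 1)) hden (by
    rw [hdord]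
    exact le_trans (by exact_mod_cast (by omega)) hnum)
  rw [e, ← one_le_ord_iff]
  rw [hdord] at h3
  rw [← h3, show q ^ j * l + 1 + l = 1 + (q ^ j * l + l) by ring, Nat.cast_add 1] at hnum
  have := (ENat.add_le_add_iff_right (ENat.natCast_ne_top _)).1 hnum
  exact_mod_cast this

end LocalRoots

section LocalRoots

variable {E : Type*} [Field E] {Q : ValuationSubring E} {p s q j k : ℕ}

/-- Away from the zeros of `w` a split step polynomial has an integral root: otherwise the
logarithmic derivative at `0` would lie in the maximal ideal, but `w⁻¹` times the linear
coefficient is `-1`. -/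
theorem exists_integral_root [CharP E p] (hs : 1 ≤ s) (hq : q = p ^ s) (hq2 : 2 ≤ q) (hj : 1 ≤ j)
    {w c : E} (hw : w ∉ Q.nonunits) (hc : c / w ∈ Q) (hsplit : (stepPoly q j k w c).Splits) :
    ∃ y ∈ Q, (stepPoly q j k w c).eval y = 0 := by
  have hw0 : w ≠ 0 := by rintro rfl; exact hw Q.nonunits.zero_mem
  by_contra! hno
  have h0 := hno 0 Q.zero_mem
  have h1 := hsplit.eval_derivative_div_eval_of_ne_zero h0
  rw [derivative_stepPoly hs hq hj] at h1
  have hm : ((stepPoly q j k w c).roots.map fun r => 1 / (0 - r)).sum ∈ Q.nonunits := by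
    refine multiset_sum_mem _ fun x hx => ?_
    obtain ⟨r, hr, rfl⟩ := Multiset.mem_map.1 hx
    have hrQ : r ∉ Q := fun h => hno r h (isRoot_of_mem_roots hr)
    rw [zero_sub, one_div, ValuationSubring.inv_mem_nonunits_iff]
    exact Or.inr fun h => hrQ (neg_mem_iff.1 h)
  have htr : ∀ m, tr q m (0 : E) = 0 := fun m =>
    Finset.sum_eq_zero fun i _ => zero_pow (pow_ne_zero i (by omega))
  have he : (stepPoly q j k w c).eval 0 = c := by
    rw [eval_stepPoly, htr, htr, zero_pow (pow_ne_zero j (by omega)), mul_zero, sub_zero, zero_add]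
  rw [he] at h0 h1
  rw [← h1, eval_neg, eval_C] at hm
  have := mul_mem_nonunits hc hm
  rw [neg_div, mul_neg, div_mul_div_comm, mul_comm, div_self (mul_ne_zero hw0 h0)] at this
  exact one_notMem_nonunits (by simpa using Q.nonunits.neg_mem this)

variable [IsDiscreteValuationRing Q]

/-- On the maximal ideal `x - x ^ N` has the same order as `x`. -/
theorem ord_sub_pow {N : ℕ} (hN : 2 ≤ N) {x : E} (hx : x ∈ Q.nonunits) :
    ord Q (x - x ^ N) = ord Q x := by
  have hxQ := Q.nonunits_subset hx
  by_cases h0 : x = 0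
  · rw [h0, zero_pow (by omega), sub_zero]
  obtain ⟨l, hl⟩ := ENat.ne_top_iff_exists.1 (ord_ne_top (Q := Q) h0)
  have h1 := one_le_ord_iff.2 hx
  rw [← hl] at h1
  have hl1 : 1 ≤ l := by exact_mod_cast h1
  refine ord_sub_eq hxQ (pow_mem hxQ _) ?_
  rw [ord_pow hxQ, ← hl]
  exact_mod_cast (by nlinarith : l < N * l)

theorem ord_eq_of_mem_trKer (hq2 : 2 ≤ q) (hj : 1 ≤ j) (hk : 1 ≤ k) {w v v₀ : E} (hw : w ∈ Q)
    (hv : v ∈ trKer q j k w) (hvm : v ∈ Q.nonunits) (hv0 : v ≠ 0) (hv₀ : v₀ ∈ trKer q j k w)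
    (hvm₀ : v₀ ∈ Q.nonunits) (h0 : v₀ ≠ 0) : ord Q v = ord Q v₀ := by
  have h1 := ord_of_mem_trKer hq2 hj hk hw hv hvm
  have h2 := ord_of_mem_trKer hq2 hj hk hw hv₀ hvm₀
  obtain ⟨l, hl⟩ := ENat.ne_top_iff_exists.1 (ord_ne_top (Q := Q) hv0)
  obtain ⟨l₀, hl₀⟩ := ENat.ne_top_iff_exists.1 (ord_ne_top (Q := Q) h0)
  rw [← hl] at h1 ⊢
  rw [← hl₀] at h2 ⊢
  obtain ⟨m, hm⟩ := ENat.ne_top_iff_exists.1 (show ord Q w ≠ ⊤ by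
    intro h
    rw [h, top_add, ← Nat.cast_mul] at h1
    exact ENat.natCast_ne_top _ h1)
  rw [← hm] at h1 h2
  have h1' : q ^ j * l = m + l := by exact_mod_cast h1
  have h2' : q ^ j * l₀ = m + l₀ := by exact_mod_cast h2
  have h4 : 2 ≤ q ^ j := hq2.trans (Nat.le_self_pow (by omega) q)
  obtain ⟨d, hd⟩ := Nat.exists_eq_add_of_le h4
  rw [hd] at h1' h2'
  have : (1 + d) * l = (1 + d) * l₀ := by nlinarith
  have := Nat.eq_of_mul_eq_mul_left (by omega) this
  rw [this]

/-- An element of the kernel in the maximal ideal is zero if it has larger order than another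
one. -/
theorem eq_zero_of_div_mem_nonunits (hq2 : 2 ≤ q) (hj : 1 ≤ j) (hk : 1 ≤ k) {w v v₀ : E}
    (hw : w ∈ Q) (hv : v ∈ trKer q j k w) (hvm : v ∈ Q.nonunits) (hv₀ : v₀ ∈ trKer q j k w)
    (hvm₀ : v₀ ∈ Q.nonunits) (h0 : v₀ ≠ 0) (h : v / v₀ ∈ Q.nonunits) : v = 0 := by
  by_contra hne
  have e1 := ord_eq_of_mem_trKer hq2 hj hk hw hv hvm hne hv₀ hvm₀ h0
  have e2 := (div_mem_and_ord_div (Q.nonunits_subset hvm) (Q.nonunits_subset hvm₀) h0 e1.ge).2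
  have e3 := one_le_ord_iff.2 h
  rw [e1] at e2
  obtain ⟨l, hl⟩ := ENat.ne_top_iff_exists.1 (ord_ne_top (Q := Q) h0)
  rw [← hl] at e2
  have e4 : ord Q (v / v₀) = 0 := by
    have : ord Q (v / v₀) + l ≤ 0 + l := by rw [zero_add]; exact e2.le
    exact le_antisymm ((ENat.add_le_add_iff_right (ENat.natCast_ne_top l)).1 this) zero_le
  rw [e4] at e3
  exact absurd e3 (by simp)

/-- At a zero of `w` the kernel meets the maximal ideal in at most `q ^ j` elements. -/
theorem card_le_of_subset_trKer [ExpChar E p] (hq : q = p ^ s) (hq2 : 2 ≤ q) (hj : 1 ≤ j)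
    (hk : 1 ≤ k) {w : E} (hw : w ∈ Q.nonunits) (S : Finset E)
    (hS : ∀ v ∈ S, v ∈ trKer q j k w ∧ v ∈ Q.nonunits) : S.card ≤ q ^ j := by
  classical
  have hwQ := Q.nonunits_subset hw
  by_cases hS0 : ∃ v₀ ∈ S, v₀ ≠ 0
  swap
  · push Not at hS0
    refine le_trans (Finset.card_le_one.2 fun a ha b hb => ?_) (Nat.one_le_pow _ _ (by omega))
    rw [hS0 a ha, hS0 b hb]
  obtain ⟨v₀, hv₀S, h0⟩ := hS0
  obtain ⟨hv₀, hvm₀⟩ := hS v₀ hv₀S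
  have hv₀Q := Q.nonunits_subset hvm₀
  have hle : ∀ v, v ∈ trKer q j k w → v ∈ Q.nonunits → ord Q v₀ ≤ ord Q v := by
    intro v hv hvm
    by_cases hv0 : v = 0
    · rw [hv0, ord_zero]; exact le_top
    · exact (ord_eq_of_mem_trKer hq2 hj hk hwQ hv hvm hv0 hv₀ hvm₀ h0).ge
  have hdiv : ∀ v ∈ S, v / v₀ ∈ Q := fun v hv =>
    (div_mem_and_ord_div (Q.nonunits_subset (hS v hv).2) hv₀Q h0
      (hle v (hS v hv).1 (hS v hv).2)).1
  let f : E → IsLocalRing.ResidueField Q := fun v =>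
    if h : v / v₀ ∈ Q then IsLocalRing.residue Q ⟨v / v₀, h⟩ else 0
  have hf : ∀ v ∈ S, ∀ h : v / v₀ ∈ Q, f v = IsLocalRing.residue Q ⟨v / v₀, h⟩ :=
    fun v _ h => dif_pos h
  have hinj : Set.InjOn f S := by
    intro a ha b hb hab
    rw [hf a ha (hdiv a ha), hf b hb (hdiv b hb), ← sub_eq_zero, ← map_sub,
      IsLocalRing.residue_eq_zero_iff, ← ValuationSubring.coe_mem_nonunits_iff] at hab
    have hab' : (a - b) / v₀ ∈ Q.nonunits := by rw [sub_div]; exact hab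
    exact sub_eq_zero.1 (eq_zero_of_div_mem_nonunits hq2 hj hk hwQ
      (sub_mem_trKer hq (hS a ha).1 (hS b hb).1) (Q.nonunits.sub_mem (hS a ha).2 (hS b hb).2) hv₀
      hvm₀ h0 hab')
  let P : (IsLocalRing.ResidueField Q)[X] := X ^ q ^ j - X
  have hq4 : 1 < q ^ j := hq2.trans (Nat.le_self_pow (by omega) q)
  have hdeg : P.natDegree = q ^ j := FiniteField.X_pow_card_sub_X_natDegree_eq _ hq4
  have hP0 : P ≠ 0 := FiniteField.X_pow_card_sub_X_ne_zero _ hq4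
  calc S.card = (S.image f).card := (Finset.card_image_of_injOn hinj).symm
    _ ≤ P.roots.toFinset.card := by
      refine Finset.card_le_card fun x hx => ?_
      obtain ⟨v, hv, rfl⟩ := Finset.mem_image.1 hx
      rw [Multiset.mem_toFinset, mem_roots hP0, IsRoot.def, hf v hv (hdiv v hv)]
      simp only [P, eval_sub, eval_pow, eval_X]
      rw [← map_pow, ← map_sub, IsLocalRing.residue_eq_zero_iff,
        ← ValuationSubring.coe_mem_nonunits_iff]
      exact div_pow_sub_div_mem_nonunits hq hq2 hj hk hw (hS v hv).1 (hS v hv).2 hv₀ hvm₀ h0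
        (hle v (hS v hv).1 (hS v hv).2)
    _ ≤ Multiset.card P.roots := Multiset.toFinset_card_le _
    _ ≤ q ^ j := hdeg ▸ card_roots' P

end LocalRoots

/-! ### Weak ramification of the basic steps -/

section Base

variable {H E : Type*} [Field H] [Field E] [Algebra H E]

theorem card_le_card_mul_card_stabilizer [FiniteDimensional H E] (G : Subgroup (E ≃ₐ[H] E)) (a : E)
    (S : Finset E) (hS : ∀ σ ∈ G, σ a ∈ S) (N : Subgroup (E ≃ₐ[H] E))
    (hN : ∀ σ ∈ G, σ a = a → σ ∈ N) : Nat.card G ≤ S.card * Nat.card N := by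
  classical
  let τ : S → E ≃ₐ[H] E := fun b => if h : ∃ σ ∈ G, σ a = b then h.choose else 1
  have hτ : ∀ σ (hσ : σ ∈ G), τ ⟨σ a, hS σ hσ⟩ ∈ G ∧ τ ⟨σ a, hS σ hσ⟩ a = σ a := by
    intro σ hσ
    have h : ∃ σ' ∈ G, σ' a = σ a := ⟨σ, hσ, rfl⟩
    have e : τ ⟨σ a, hS σ hσ⟩ = h.choose := dif_pos h
    rw [e]
    exact h.choose_spec
  let f : G → S × N := fun σ => (⟨σ.1 a, hS σ σ.2⟩, ⟨(τ ⟨σ.1 a, hS σ σ.2⟩)⁻¹ * σ.1, by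
    obtain ⟨h1, h2⟩ := hτ σ σ.2
    refine hN _ (G.mul_mem (G.inv_mem h1) σ.2) ?_
    rw [AlgEquiv.mul_apply]
    exact (congrArg _ h2).symm.trans (AlgEquiv.symm_apply_apply _ _)⟩)
  have hf : Function.Injective f := by
    intro σ σ' h
    have h1 : (⟨σ.1 a, hS σ σ.2⟩ : S) = ⟨σ'.1 a, hS σ' σ'.2⟩ := congrArg Prod.fst h
    have h2 := congrArg Subtype.val (congrArg Prod.snd h)
    simp only [f] at h2
    rw [h1] at h2
    exact Subtype.ext (mul_left_cancel h2)
  refine (Nat.card_le_card_of_injective f hf).trans_eq ?_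
  rw [Nat.card_prod, Nat.card_eq_fintype_card, Fintype.card_coe]

variable {p s q j k : ℕ} {α β : ℤ} {w : E}

theorem sub_mem_trKer_of_eval_eq_zero [ExpChar E p] (hq : q = p ^ s) {c y y' : E}
    (hy : (stepPoly q j k w c).eval y = 0) (hy' : (stepPoly q j k w c).eval y' = 0) :
    y - y' ∈ trKer q j k w := by
  rw [eval_stepPoly] at hy hy'
  change tr q k (y - y') ^ q ^ j = w * tr q j (y - y')
  rw [tr_sub hq, tr_sub hq, sub_pow_q hq]
  linear_combination hy - hy'

theorem eval_add_eq_zero [ExpChar E p] (hq : q = p ^ s) {c y v : E}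
    (hy : (stepPoly q j k w c).eval y = 0) (hv : v ∈ trKer q j k w) :
    (stepPoly q j k w c).eval (y + v) = 0 := by
  rw [eval_stepPoly] at hy ⊢
  have hv' : tr q k v ^ q ^ j = w * tr q j v := hv
  rw [tr_add hq, tr_add hq, add_pow_q hq]
  linear_combination hy + hv'

/-- The element `y - y ^ N`, for a root `y` of the step polynomial and `N` a power of `p` with
`a ^ N ≡ a` at a zero of `w`, has order `ord w / q ^ j`. -/
theorem ord_root_sub_pow {𝔽 : Type*} [CharP E p] (D : IsLinkData 𝔽 p s q j k α β)
    {Q : ValuationSubring E} [IsDiscreteValuationRing Q] {m : ℕ} (hN2 : 2 ≤ p ^ m)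
    (hN : ∀ a ∈ Q, a ^ p ^ m - a ∈ Q.nonunits) (hw : w ∈ Q.nonunits) {y : E} (hyQ : y ∈ Q)
    (hy : (stepPoly q j k w (α + β * w)).eval y = 0) :
    (q ^ j : ℕ) * ord Q (y - y ^ p ^ m) = ord Q w := by
  have := ExpChar.prime (R := E) D.prime
  have hq := D.eq_pow
  have hq0 : q ≠ 0 := by have := D.two_le; omega
  set r := tr q k y + α with hr
  set t := tr q j y - β with ht
  have hl : r ^ q ^ j = w * t := by
    rw [eval_stepPoly] at hy
    rw [hr, ht, add_pow_q hq, intCast_pow_q hq]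
    linear_combination hy
  have htQ : t ∈ Q := sub_mem (tr_mem_valuationSubring hyQ q j) (intCast_mem_valuationSubring β)
  have hwt : w * t ∈ Q.nonunits := by rw [mul_comm]; exact mul_mem_nonunits htQ hw
  have htu : t ∉ Q.nonunits := by
    intro h
    have hrm : r ∈ Q.nonunits := mem_nonunits_of_pow (n := q ^ j) (by rw [hl]; exact hwt)
    have h1 := tr_sub_tr_eq_one hq D.bezout y
    apply one_notMem_nonunits (Q := Q)
    rw [← h1]
    exact Q.nonunits.sub_mem (tr_mem_nonunits hq0 hrm j) (tr_mem_nonunits hq0 h k)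
  have hε : y - y ^ p ^ m ∈ Q.nonunits := sub_mem_nonunits_symm (hN y hyQ)
  have htrε : tr q k (y - y ^ p ^ m) = r - r ^ p ^ m := by
    have e1 : tr q k (y ^ p ^ m) = tr q k y ^ p ^ m := by
      rw [tr, tr, sum_pow_char_pow p]
      exact Finset.sum_congr rfl fun i _ => pow_right_comm y _ _
    have e2 : ((α : E)) ^ p ^ m = α := by rw [← iterateFrobenius_def, map_intCast]
    rw [tr_sub hq, e1, hr, add_pow_expChar_pow, e2]
    ring
  have h2 : tr q k (y - y ^ p ^ m) ^ q ^ j = w * t - (w * t) ^ p ^ m := by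
    rw [htrε, sub_pow_q hq, ← pow_mul, mul_comm (p ^ m), pow_mul, hl]
  have h3 := congrArg (ord Q) h2
  rw [ord_sub_pow hN2 hwt, ord_pow (tr_mem_valuationSubring (Q.nonunits_subset hε) q k),
    (ord_tr D.two_le hε D.right_pos).1, ord_mul (Q.nonunits_subset hw) htQ,
    ord_eq_zero_iff.2 htu, add_zero] at h3
  exact h3

end Base

section BaseMain

variable {𝔽 H E : Type*} [Field H] [Field E] [Algebra H E] [FiniteDimensional H E] [IsGalois H E]
  {Q : ValuationSubring E} [IsDiscreteValuationRing Q] {p s q j k : ℕ} [CharP E p] {α β : ℤ}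
  {w y : E}

/-- At a zero of `w` the second ramification group of the splitting field of the step polynomial
contains no nontrivial automorphism that fixes the kernel. The stabilizer `Γ` in the inertia group
of an element `v₀` of the kernel is an elementary abelian `p`-group, and `ord v₀ ≤ |Γ|`. If an
element of `Γ` violated weak ramification, the subgroup fixing a root that it moves would have
order at least `ord v₀ / q ^ j`, which is too large for the quotient of `v₀` by the element
`y - y ^ N`. -/
theorem eq_one_of_mem_nonunits (D : IsLinkData 𝔽 p s q j k α β) (hres : HasFiniteResidue p Q)
    (hw : w ∈ Q.nonunits) (hw0 : w ≠ 0) (hwfix : ∀ σ : E ≃ₐ[H] E, σ w = w)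
    (hy : (stepPoly q j k w (α + β * w)).eval y = 0)
    (hgen : ∀ σ : E ≃ₐ[H] E, (∀ v ∈ trKer q j k w, σ v = v) → σ y = y → σ = 1)
    (hram : ord Q w ≤ Nat.card (inertiaAt H Q)) {σ : E ≃ₐ[H] E} (hσ : σ ∈ inertiaAt H Q)
    (hσV : ∀ v ∈ trKer q j k w, σ v = v) (h3 : ∀ a ∈ Q, 3 ≤ ord Q (σ a - a)) : σ = 1 := by
  classical
  have := ExpChar.prime (R := E) D.prime
  have hq := D.eq_pow
  have hq2 := D.two_le
  have hj := D.left_pos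
  have hk := D.right_pos
  have hwQ := Q.nonunits_subset hw
  have hc : (α : E) + β * w ∈ Q := add_mem (intCast_mem_valuationSubring α)
    (Q.mul_mem _ _ (intCast_mem_valuationSubring β) hwQ)
  set P := stepPoly q j k w (α + β * w) with hP
  have hrootQ : ∀ x, P.eval x = 0 → x ∈ Q := fun x hx =>
    mem_of_eval_stepPoly_eq_zero hq2 hj hk hwQ hc hx
  have hrootσ : ∀ (τ : E ≃ₐ[H] E) x, P.eval x = 0 → P.eval (τ x) = 0 := by
    intro τ x hx
    have e : P.map (τ : E →+* E) = P := by
      rw [hP, map_stepPoly, map_add, map_mul, map_intCast, map_intCast]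
      change stepPoly q j k (τ w) (α + β * τ w) = _
      rw [hwfix]
    have := congrArg (τ : E →+* E) hx
    rwa [← eval_map_apply, e, map_zero] at this
  -- displacements of roots
  have hdisp : ∀ τ ∈ inertiaAt H Q, ∀ x, P.eval x = 0 →
      τ x - x ∈ trKer q j k w ∧ τ x - x ∈ Q.nonunits := fun τ hτ x hx =>
    ⟨sub_mem_trKer_of_eval_eq_zero hq (hrootσ τ x hx) hx, hτ.2 x (hrootQ x hx)⟩
  by_cases hv0 : σ y = y
  · exact hgen σ hσV hv0
  set v₀ := σ y - y with hv₀def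
  have h0 : v₀ ≠ 0 := sub_ne_zero.2 hv0
  obtain ⟨hv₀, hvm₀⟩ := hdisp σ hσ y hy
  have hv₀Q := Q.nonunits_subset hvm₀
  obtain ⟨l, hl⟩ := ENat.ne_top_iff_exists.1 (ord_ne_top (Q := Q) h0)
  obtain ⟨m, hm⟩ := ENat.ne_top_iff_exists.1 (ord_ne_top (Q := Q) hw0)
  have hml : q ^ j * l = m + l := by
    have := ord_of_mem_trKer hq2 hj hk hwQ hv₀ hvm₀
    rw [← hv₀def, ← hl, ← hm] at this
    exact_mod_cast this
  -- the inertia group permutes the elements of the kernel in the maximal ideal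
  have hker : ∀ τ ∈ inertiaAt H Q, ∀ v ∈ trKer q j k w, v ∈ Q.nonunits →
      τ v ∈ trKer q j k w ∧ τ v ∈ Q.nonunits := by
    intro τ hτ v hv hvm
    refine ⟨?_, ?_⟩
    · have := map_mem_trKer (τ : E →+* E) hv
      change τ v ∈ trKer q j k (τ w) at this
      rwa [hwfix] at this
    · rw [← one_le_ord_iff, ord_apply_of_mem_inertiaAt hτ, one_le_ord_iff]
      exact hvm
  let S₀ : Finset E := (stepPoly q j k w 0).roots.toFinset.filter (· ∈ Q.nonunits)
  have hS₀ : ∀ v, v ∈ S₀ ↔ v ∈ trKer q j k w ∧ v ∈ Q.nonunits := by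
    intro v
    rw [Finset.mem_filter, Multiset.mem_toFinset,
      mem_roots (monic_stepPoly hq2 hj hk w 0).1.ne_zero, IsRoot.def, eval_stepPoly, add_zero,
      sub_eq_zero]
    rfl
  have hS₀card : S₀.card ≤ q ^ j := card_le_of_subset_trKer hq hq2 hj hk hw S₀ fun v => (hS₀ v).1
  -- the stabilizer of `v₀`
  let Γ : Subgroup (E ≃ₐ[H] E) := inertiaAt H Q ⊓ MulAction.stabilizer (E ≃ₐ[H] E) v₀
  have hΓ : ∀ τ, τ ∈ Γ ↔ τ ∈ inertiaAt H Q ∧ τ v₀ = v₀ := fun τ => Iff.rfl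
  have hΓV : ∀ τ ∈ Γ, ∀ v ∈ trKer q j k w, v ∈ Q.nonunits → τ v = v := by
    intro τ hτ v hv hvm
    obtain ⟨hτI, hτ0⟩ := (hΓ τ).1 hτ
    obtain ⟨h1, h2⟩ := hker τ hτI v hv hvm
    have hle : ord Q v₀ ≤ ord Q v := by
      by_cases hv0 : v = 0
      · rw [hv0, ord_zero]; exact le_top
      · exact (ord_eq_of_mem_trKer hq2 hj hk hwQ hv hvm hv0 hv₀ hvm₀ h0).ge
    have h4 := hτI.2 _ (div_mem_and_ord_div (Q.nonunits_subset hvm) hv₀Q h0 hle).1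
    rw [map_div₀, hτ0, ← sub_div] at h4
    exact sub_eq_zero.1 (eq_zero_of_div_mem_nonunits hq2 hj hk hwQ (sub_mem_trKer hq h1 hv)
      (Q.nonunits.sub_mem h2 hvm) hv₀ hvm₀ h0 h4)
  have hone : ∀ τ : E ≃ₐ[H] E, (∀ x, P.eval x = 0 → τ x = x) → τ = 1 := by
    intro τ hτ
    refine hgen τ (fun v hv => ?_) (hτ y hy)
    have h1 := hτ _ (eval_add_eq_zero hq hy hv)
    rw [map_add, hτ y hy] at h1
    exact add_left_cancel h1
  have hΓp : IsPGroup p Γ := by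
    rintro ⟨τ, hτ⟩
    refine ⟨1, Subtype.ext ?_⟩
    rw [pow_one]
    refine hone _ fun x hx => ?_
    obtain ⟨h1, h2⟩ := hdisp τ ((hΓ τ).1 hτ).1 x hx
    have h4 := hΓV τ hτ _ h1 h2
    have hpow : ∀ n : ℕ, (τ ^ n) x = x + n * (τ x - x) := by
      intro n
      induction n with
      | zero => simp
      | succ n ih =>
        rw [pow_succ', AlgEquiv.mul_apply, ih, map_add, map_mul, map_natCast, h4]
        push_cast
        ring
    have := hpow p
    rw [CharP.cast_eq_zero, zero_mul, add_zero] at this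
    exact this
  by_contra hσ1
  have hσΓ : σ ∈ Γ := (hΓ σ).2 ⟨hσ, hσV _ hv₀⟩
  obtain ⟨t, ht, ht1⟩ := exists_ord_eq_one Q
  obtain ⟨σ', hσ'Γ, hσ'1, hσ'3, hmax⟩ := exists_maximal_ord_apply_sub hσΓ hσ1 (h3 t ht)
  obtain ⟨x, hx, hσ'x⟩ : ∃ x, P.eval x = 0 ∧ σ' x ≠ x := by
    by_contra! h
    exact hσ'1 (hone σ' h)
  have hxQ := hrootQ x hx
  have hσ'I := ((hΓ σ').1 hσ'Γ).1
  -- the subgroup fixing the root `x`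
  let N : Subgroup (E ≃ₐ[H] E) := Γ ⊓ MulAction.stabilizer (E ≃ₐ[H] E) x
  have hN : ∀ τ, τ ∈ N ↔ τ ∈ Γ ∧ τ x = x := fun τ => Iff.rfl
  have hcard1 : Nat.card (inertiaAt H Q) ≤ (q ^ j - 1) * Nat.card Γ := by
    refine (card_le_card_mul_card_stabilizer (inertiaAt H Q) v₀ (S₀.erase 0) (fun τ hτ => ?_) Γ
      fun τ hτ h => ⟨hτ, h⟩).trans (Nat.mul_le_mul_right _ ?_)
    · refine Finset.mem_erase.2 ⟨by simpa using h0, (hS₀ _).2 (hker τ hτ v₀ hv₀ hvm₀)⟩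
    · rw [Finset.card_erase_of_mem]
      · exact Nat.sub_le_sub_right hS₀card 1
      · refine (hS₀ 0).2 ⟨?_, Q.nonunits.zero_mem⟩
        have := sub_mem_trKer hq hv₀ hv₀
        rwa [sub_self] at this
  have hcard2 : Nat.card Γ ≤ q ^ j * Nat.card N := by
    refine (card_le_card_mul_card_stabilizer Γ x (S₀.image (x + ·)) (fun τ hτ => ?_) N
      fun τ hτ h => ⟨hτ, h⟩).trans (Nat.mul_le_mul_right _ (Finset.card_image_le.trans hS₀card))
    exact Finset.mem_image.2 ⟨τ x - x, (hS₀ _).2 (hdisp τ ((hΓ τ).1 hτ).1 x hx), by ring⟩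
  -- the test element `v₀ / ε`
  obtain ⟨M, hM, hres'⟩ := id hres
  have hN2 : 2 ≤ p ^ M := D.prime.two_le.trans (Nat.le_self_pow (by omega) p)
  set ε := x - x ^ p ^ M with hε
  have hεm : ε ∈ Q.nonunits := sub_mem_nonunits_symm (hres' x hxQ)
  have hεQ := Q.nonunits_subset hεm
  have hεord := ord_root_sub_pow D hN2 hres' hw hxQ hx
  rw [← hε, ← hm] at hεord
  have hε0 : ε ≠ 0 := by
    intro h
    rw [h, ord_zero, ENat.mul_top (by exact_mod_cast pow_ne_zero j (by omega))] at hεord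
    exact ENat.natCast_ne_top m hεord.symm
  obtain ⟨e, he⟩ := ENat.ne_top_iff_exists.1 (ord_ne_top (Q := Q) hε0)
  rw [← he] at hεord
  have hem : q ^ j * e = m := by exact_mod_cast hεord
  have hqj : 2 ≤ q ^ j := hq2.trans (Nat.le_self_pow (by omega) q)
  have hel : e ≤ l := by nlinarith
  obtain ⟨hd1, hd2⟩ := hdisp σ' hσ'I x hx
  have hδ : σ' ε - ε = (σ' x - x) - (σ' x - x) ^ p ^ M := by
    rw [hε, map_sub, map_pow, sub_pow_expChar_pow]; ring
  have hδord : ord Q (σ' ε - ε) = l := by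
    rw [hδ, ord_sub_pow hN2 hd2, hl]
    exact ord_eq_of_mem_trKer hq2 hj hk hwQ hd1 hd2 (sub_ne_zero.2 hσ'x) hv₀ hvm₀ h0
  have hζQ := (div_mem_and_ord_div hv₀Q hεQ hε0 (by rw [← he, ← hl]; exact_mod_cast hel)).1
  have hlem := two_mul_card_lt_ord_apply_sub D.prime hres inf_le_left hΓp ht ht1 hσ'Γ hσ'3 hmax
    (N : Set (E ≃ₐ[H] E)).toFinset (fun τ hτ => ((hN τ).1 (Set.mem_toFinset.1 hτ)).1)
    (Set.mem_toFinset.2 (one_mem N)) hζQ (fun τ hτ => by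
      obtain ⟨h1, h2⟩ := (hN τ).1 (Set.mem_toFinset.1 hτ)
      rw [map_div₀, ((hΓ τ).1 h1).2, hε, map_sub, map_pow, h2])
  have hNcard : (N : Set (E ≃ₐ[H] E)).toFinset.card = Nat.card N := by
    rw [Set.toFinset_card, Nat.card_eq_fintype_card]; rfl
  rw [hNcard] at hlem
  have hσ'εQ : σ' ε ∈ Q := (hσ'I.1 ε).2 hεQ
  have hσ'ε0 : σ' ε ≠ 0 := by simpa using hε0
  have hζord : ord Q (σ' (v₀ / ε) - v₀ / ε) + (e + e) = l + l := by
    have h1 : (σ' (v₀ / ε) - v₀ / ε) * (ε * σ' ε) = -(v₀ * (σ' ε - ε)) := by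
      rw [map_div₀, ((hΓ σ').1 hσ'Γ).2]
      field_simp
      ring
    have h2 := congrArg (ord Q) h1
    rwa [ord_neg, ord_mul (sub_mem ((hσ'I.1 _).2 hζQ) hζQ) (Q.mul_mem _ _ hεQ hσ'εQ),
      ord_mul hεQ hσ'εQ, ord_apply_of_mem_inertiaAt hσ'I, ord_mul hv₀Q (sub_mem hσ'εQ hεQ), hδord,
      ← he, ← hl] at h2
  obtain ⟨g, hg⟩ := ENat.ne_top_iff_exists.1 (show ord Q (σ' (v₀ / ε) - v₀ / ε) ≠ ⊤ by
    intro h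
    rw [h, top_add] at hζord
    exact ENat.natCast_ne_top (l + l) (by exact_mod_cast hζord.symm))
  rw [← hg] at hζord hlem
  have hge : g + (e + e) = l + l := by exact_mod_cast hζord
  have hNg : 2 * Nat.card N + 1 ≤ g := by exact_mod_cast hlem
  rw [← hm] at hram
  have hmI : m ≤ Nat.card (inertiaAt H Q) := by exact_mod_cast hram
  -- `l ≤ |Γ| ≤ q ^ j |N|` and `q ^ j g = 2 l`
  obtain ⟨b, hb⟩ := Nat.exists_eq_add_of_le hqj
  have hlΓ : l ≤ Nat.card Γ := by
    have h1 : (1 + b) * l ≤ (1 + b) * Nat.card Γ := by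
      have h2 : q ^ j - 1 = 1 + b := by omega
      rw [h2] at hcard1
      refine le_trans ?_ (hmI.trans hcard1)
      rw [hb] at hml
      nlinarith
    exact Nat.le_of_mul_le_mul_left h1 (by omega)
  have hqg : q ^ j * g = 2 * l := by
    have h1 : q ^ j * g + (m + m) = (m + l) + (m + l) := by
      rw [← hem, ← mul_add, ← mul_add, hge, hem, mul_add, hml]
    omega
  have h5 : q ^ j * (2 * Nat.card N + 1) ≤ q ^ j * g := Nat.mul_le_mul_left _ hNg
  nlinarith

/-- Weak ramification of the splitting field of a step polynomial over the field generated by the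
kernel. -/
theorem eq_one_of_step (D : IsLinkData 𝔽 p s q j k α β) (hres : HasFiniteResidue p Q)
    (hw0 : w ≠ 0) (hwfix : ∀ σ : E ≃ₐ[H] E, σ w = w)
    (hsplit : (stepPoly q j k w (α + β * w)).Splits)
    (hy : (stepPoly q j k w (α + β * w)).eval y = 0)
    (hgen : ∀ σ : E ≃ₐ[H] E, (∀ v ∈ trKer q j k w, σ v = v) → σ y = y → σ = 1)
    (hram : w ∈ Q.nonunits → ord Q w ≤ Nat.card (inertiaAt H Q)) {σ : E ≃ₐ[H] E}
    (hσ : σ ∈ inertiaAt H Q) (hσV : ∀ v ∈ trKer q j k w, σ v = v)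
    (h3 : ∀ a ∈ Q, 3 ≤ ord Q (σ a - a)) : σ = 1 := by
  by_cases hw : w ∈ Q.nonunits
  · exact eq_one_of_mem_nonunits D hres hw hw0 hwfix hy hgen (hram hw) hσ hσV h3
  have := ExpChar.prime (R := E) D.prime
  have hq := D.eq_pow
  have hz : w⁻¹ ∈ Q := by
    by_contra h
    exact hw ((ValuationSubring.mem_nonunits_iff_or Q).2 (Or.inr h))
  have hc : ((α : E) + β * w) / w ∈ Q := by
    rw [add_div, mul_div_cancel_right₀ _ hw0, div_eq_mul_inv]
    exact add_mem (Q.mul_mem _ _ (intCast_mem_valuationSubring α) hz)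
      (intCast_mem_valuationSubring β)
  obtain ⟨x, hxQ, hx⟩ := exists_integral_root D.one_le hq D.two_le D.left_pos hw hc hsplit
  have hσx : (stepPoly q j k w (α + β * w)).eval (σ x) = 0 := by
    have e : (stepPoly q j k w (α + β * w)).map (σ : E →+* E) = stepPoly q j k w (α + β * w) := by
      rw [map_stepPoly, map_add, map_mul, map_intCast, map_intCast]
      change stepPoly q j k (σ w) (α + β * σ w) = _
      rw [hwfix]
    have := congrArg (σ : E →+* E) hx
    rwa [← eval_map_apply, e, map_zero] at this
  have h0 := eq_zero_of_mem_trKer D.two_le D.left_pos D.right_pos hw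
    (sub_mem_trKer_of_eval_eq_zero hq hσx hx) (hσ.2 x hxQ)
  refine hgen σ hσV ?_
  have h1 := hσV _ (sub_mem_trKer_of_eval_eq_zero hq hy hx)
  rw [map_sub, sub_eq_zero.1 h0] at h1
  exact sub_left_injective h1

end BaseMain

/-! ### Zeros of a generator of a rational function field -/

section Generator

variable {𝔽 H : Type*} [Field 𝔽] [Field H] [Algebra 𝔽 H] {P : ValuationSubring H} {w : H}

theorem aeval_mem_valuationSubring (hP : ∀ c : 𝔽, algebraMap 𝔽 H c ∈ P) (hw : w ∈ P) (f : 𝔽[X]) :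
    aeval w f ∈ P := by
  rw [aeval_eq_sum_range]
  refine sum_mem fun i _ => ?_
  rw [Algebra.smul_def]
  exact P.mul_mem _ _ (hP _) (pow_mem hw i)

variable [IsDiscreteValuationRing P]

theorem exists_ord_aeval_eq (hP : ∀ c : 𝔽, algebraMap 𝔽 H c ∈ P) (hw : w ∈ P.nonunits) {f : 𝔽[X]}
    (hf : f ≠ 0) : ∃ a : ℕ, ord P (aeval w f) = a * ord P w := by
  have hwP := P.nonunits_subset hw
  obtain ⟨g, hg, hdvd⟩ := exists_eq_pow_rootMultiplicity_mul_and_not_dvd f hf 0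
  rw [C_0, sub_zero] at hg hdvd
  refine ⟨rootMultiplicity 0 f, ?_⟩
  have hgu : aeval w g ∉ P.nonunits := by
    intro h
    rw [X_dvd_iff] at hdvd
    rw [← divX_mul_X_add g, map_add, map_mul, aeval_X, aeval_C] at h
    have h1 := mul_mem_nonunits (aeval_mem_valuationSubring hP hwP g.divX) hw
    have h2 := P.nonunits.sub_mem h h1
    rw [add_sub_cancel_left] at h2
    have h3 := mul_mem_nonunits (hP (g.coeff 0)⁻¹) h2
    rw [← map_mul, inv_mul_cancel₀ hdvd, map_one] at h3
    exact one_notMem_nonunits h3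
  conv_lhs => rw [hg]
  rw [map_mul, map_pow, aeval_X, ord_mul (pow_mem hwP _) (aeval_mem_valuationSubring hP hwP g),
    ord_pow hwP, ord_eq_zero_iff.2 hgu, add_zero]

/-- A generator of a rational function field has order at most `1` at each of its zeros. -/
theorem ord_generator_le_one (hP : ∀ c : 𝔽, algebraMap 𝔽 H c ∈ P)
    (hgen : IntermediateField.adjoin 𝔽 {w} = ⊤) (hw : w ∈ P.nonunits) (hw0 : w ≠ 0) :
    ord P w ≤ 1 := by
  have hwP := P.nonunits_subset hw
  obtain ⟨π, hπ, hπ1⟩ := exists_ord_eq_one P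
  have hmem : π ∈ IntermediateField.adjoin 𝔽 {w} := hgen ▸ IntermediateField.mem_top
  obtain ⟨f, g, hfg⟩ := (IntermediateField.mem_adjoin_simple_iff 𝔽 π).1 hmem
  have hπ0 : π ≠ 0 := by rintro rfl; rw [ord_zero] at hπ1; exact absurd hπ1 (by simp)
  have hg0 : aeval w g ≠ 0 := by rintro h; rw [h, div_zero] at hfg; exact hπ0 hfg
  have hf0 : aeval w f ≠ 0 := by rintro h; rw [h, zero_div] at hfg; exact hπ0 hfg
  obtain ⟨a, ha⟩ := exists_ord_aeval_eq hP hw (f := f) (by rintro rfl; simp at hf0)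
  obtain ⟨b, hb⟩ := exists_ord_aeval_eq hP hw (f := g) (by rintro rfl; simp at hg0)
  have h := congrArg (ord P) ((eq_div_iff hg0).1 hfg)
  rw [ord_mul hπ (aeval_mem_valuationSubring hP hwP g), hπ1, ha, hb] at h
  obtain ⟨l, hl⟩ := ENat.ne_top_iff_exists.1 (ord_ne_top (Q := P) hw0)
  rw [← hl] at h ⊢
  have h' : 1 + b * l = a * l := by exact_mod_cast h
  have hdvd : l ∣ 1 := (Nat.dvd_add_left (Dvd.intro_left b rfl)).1 (h' ▸ Dvd.intro_left a rfl)
  rw [Nat.dvd_one.1 hdvd]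
  rfl

/-- At a zero of a generator `w` of a rational function field `H` the order of `w` in a Galois
extension is at most the order of the inertia group. -/
theorem ord_algebraMap_generator_le {E : Type*} [Field E] [Algebra 𝔽 E] [Algebra H E]
    [IsScalarTower 𝔽 H E] [FiniteDimensional H E] [IsGalois H E] {Q : ValuationSubring E}
    [IsDiscreteValuationRing Q] {p : ℕ} (hp : p.Prime) (hres : HasFiniteResidue p Q)
    (hQ : IsPlace 𝔽 Q) {w : H} (hgen : IntermediateField.adjoin 𝔽 {w} = ⊤) (hw0 : w ≠ 0)
    (hw : algebraMap H E w ∈ Q.nonunits) :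
    ord Q (algebraMap H E w) ≤ Nat.card (inertiaAt H Q) := by
  have := isDVR_below (F := H) Q
  have hP : ∀ c : 𝔽, algebraMap 𝔽 H c ∈ below H Q := fun c => by
    rw [ValuationSubring.mem_comap, ← IsScalarTower.algebraMap_apply]
    exact hQ.1 c
  have hw' := (algebraMap_mem_nonunits_iff Q).1 hw
  rw [ord_algebraMap ((below H Q).nonunits_subset hw'), ramIdx_eq_card_inertiaAt hp hres]
  calc (Nat.card (inertiaAt H Q) : ℕ∞) * ord (below H Q) w
      ≤ Nat.card (inertiaAt H Q) * 1 := by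
        gcongr
        exact ord_generator_le_one hP hgen hw' hw0
    _ = _ := mul_one _

end Generator

/-! ### Function fields and their weakly ramified extensions -/

section FunctionField

/-- `E` is a finite separable extension of a rational function field over `𝔽`. -/
def IsFunctionField (𝔽 E : Type*) [Field 𝔽] [Field E] [Algebra 𝔽 E] : Prop :=
  ∃ t : E, Transcendental 𝔽 t ∧ FiniteDimensional (IntermediateField.adjoin 𝔽 {t}) E ∧
    Algebra.IsSeparable (IntermediateField.adjoin 𝔽 {t}) E

variable {𝔽 F E : Type*} [Field 𝔽] [Field F] [Field E] [Algebra 𝔽 F] [Algebra 𝔽 E]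

theorem IsFunctionField.of_adjoin_eq_top {t : F} (ht : Transcendental 𝔽 t)
    (h : IntermediateField.adjoin 𝔽 {t} = ⊤) : IsFunctionField 𝔽 F := by
  refine ⟨t, ht, ?_, ?_⟩
  · rw [h]
    exact Module.Finite.of_surjective
      ((IsScalarTower.toAlgHom (⊤ : IntermediateField 𝔽 F) (⊤ : IntermediateField 𝔽 F)
        F).toLinearMap) fun x => ⟨⟨x, IntermediateField.mem_top⟩, rfl⟩
  · rw [h]
    exact ⟨fun x => isSeparable_algebraMap (K := F)
      (⟨x, IntermediateField.mem_top⟩ : (⊤ : IntermediateField 𝔽 F))⟩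

theorem IsFunctionField.of_finite [Algebra F E] [IsScalarTower 𝔽 F E] [FiniteDimensional F E]
    [Algebra.IsSeparable F E] (h : IsFunctionField 𝔽 F) : IsFunctionField 𝔽 E := by
  obtain ⟨t, ht, hfin, hsep⟩ := h
  let K₀ := IntermediateField.adjoin 𝔽 {t}
  let K₁ := IntermediateField.adjoin 𝔽 {algebraMap F E t}
  have hle : ∀ x : K₀, algebraMap F E x ∈ K₁ := by
    intro x
    have h1 : K₀ ≤ K₁.comap (IsScalarTower.toAlgHom 𝔽 F E) :=
      IntermediateField.adjoin_simple_le_iff.2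
        (IntermediateField.mem_adjoin_simple_self 𝔽 (algebraMap F E t))
    exact h1 x.2
  let φ : K₀ →+* K₁ := ((algebraMap F E).comp (algebraMap K₀ F)).codRestrict K₁ hle
  let _ : Algebra K₀ K₁ := φ.toAlgebra
  have : IsScalarTower K₀ K₁ E := IsScalarTower.of_algebraMap_eq fun x => rfl
  have : FiniteDimensional K₀ E := FiniteDimensional.trans K₀ F E
  have : Algebra.IsSeparable K₀ E := Algebra.IsSeparable.trans K₀ F E
  exact ⟨algebraMap F E t, (transcendental_algebraMap_iff (algebraMap F E).injective).2 ht,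
    Module.Finite.of_restrictScalars_finite K₀ K₁ E,
    Algebra.isSeparable_tower_top_of_isSeparable K₀ K₁ E⟩

theorem IsFunctionField.isDVR_and_hasFiniteResidue [Finite 𝔽] {p s : ℕ} (hs : 1 ≤ s)
    (hcard : Nat.card 𝔽 = p ^ s) (h : IsFunctionField 𝔽 E) {Q : ValuationSubring E}
    (hQ : IsPlace 𝔽 Q) : IsDiscreteValuationRing Q ∧ HasFiniteResidue p Q := by
  obtain ⟨t, ht, hfin, hsep⟩ := h
  exact hQ.isDVR_and_hasFiniteResidue hs hcard ht

end FunctionField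

section FixedField

variable {F E : Type*} [Field F] [Field E] [Algebra F E] {σ : E ≃ₐ[F] E}

theorem mem_fixedField_zpowers {x : E} :
    x ∈ IntermediateField.fixedField (Subgroup.zpowers σ) ↔ σ x = x := by
  refine ⟨fun h => h ⟨σ, Subgroup.mem_zpowers σ⟩, ?_⟩
  rintro h ⟨_, n, rfl⟩
  exact MulAction.mem_stabilizer_iff.1 (zpow_mem
    (MulAction.mem_stabilizer_iff.2 h : σ ∈ MulAction.stabilizer _ _) n)

theorem eq_one_of_fixedField_eq_top
    (h : IntermediateField.fixedField (Subgroup.zpowers σ) = ⊤) : σ = 1 := by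
  ext x
  exact mem_fixedField_zpowers.1 (h ▸ IntermediateField.mem_top)

end FixedField

section WeakExtension

/-- `E / F` is a finite Galois `p`-extension, weakly ramified at all places. -/
def IsWeakExtension (p : ℕ) (𝔽 F E : Type*) [Field 𝔽] [Field F] [Field E] [Algebra 𝔽 E]
    [Algebra F E] : Prop :=
  IsGaloisPExtension p F E ∧ ∀ Q : ValuationSubring E, IsPlace 𝔽 Q → IsWeaklyRamifiedAt F Q

variable {𝔽 F E : Type*} [Field 𝔽] [Field F] [Field E] [Algebra 𝔽 E] [Algebra F E]

theorem IsWeakExtension.isTwoBounded [Finite 𝔽] {p s : ℕ} [CharP E p] (hp : p.Prime)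
    (hs : 1 ≤ s) (hcard : Nat.card 𝔽 = p ^ s) (hE : IsFunctionField 𝔽 E)
    (h : IsWeakExtension p 𝔽 F E) : IsTwoBounded 𝔽 F E := by
  intro Q hQ
  obtain ⟨⟨_, _, hG⟩, hw⟩ := h
  obtain ⟨_, hres⟩ := hE.isDVR_and_hasFiniteResidue hs hcard hQ
  exact diffExponent_eq_of_isWeaklyRamifiedAt hp hres hG (hw Q hQ)

variable {L : Type*} [Field L] [Algebra F L] [Algebra L E] [IsScalarTower F L E]

theorem IsWeakExtension.tower_top {p : ℕ} (h : IsWeakExtension p 𝔽 F E) :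
    IsWeakExtension p 𝔽 L E := by
  obtain ⟨⟨_, _, hG⟩, hw⟩ := h
  exact ⟨⟨FiniteDimensional.right F L E, IsGalois.tower_top_of_isGalois F L E,
    hG.of_injective (AlgEquiv.restrictScalarsHom F) (AlgEquiv.restrictScalars_injective F)⟩,
    fun Q hQ => (hw Q hQ).tower_top⟩

variable [Algebra 𝔽 L]

theorem IsPlace.below [IsScalarTower 𝔽 L E] [Algebra.IsAlgebraic L E] {Q : ValuationSubring E}
    (hQ : IsPlace 𝔽 Q) : IsPlace 𝔽 (below L Q) := by
  refine ⟨fun c => ?_, below_ne_top Q hQ.2⟩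
  rw [ValuationSubring.mem_comap, ← IsScalarTower.algebraMap_apply]
  exact hQ.1 c

variable {L' : Type*} [Field L'] [Algebra 𝔽 L'] [Algebra F L'] [Algebra L' E]
  [IsScalarTower F L' E]

/-- The composite of two weakly ramified Galois `p`-extensions of a function field. -/
theorem IsWeakExtension.composite [Finite 𝔽] [Algebra 𝔽 F] [IsScalarTower 𝔽 F E]
    [IsScalarTower 𝔽 L E] [IsScalarTower 𝔽 L' E] {p s : ℕ} (hp : p.Prime) (hs : 1 ≤ s)
    (hcard : Nat.card 𝔽 = p ^ s) (hF : IsFunctionField 𝔽 F) (h : IsWeakExtension p 𝔽 F L)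
    (h' : IsWeakExtension p 𝔽 F L')
    (hgen : (IsScalarTower.toAlgHom F L E).fieldRange ⊔ (IsScalarTower.toAlgHom F L' E).fieldRange =
      ⊤) : IsWeakExtension p 𝔽 F E := by
  obtain ⟨⟨_, _, hG⟩, hw⟩ := h
  obtain ⟨⟨_, _, hG'⟩, hw'⟩ := h'
  have hfin : FiniteDimensional F E ∧ IsGalois F E := by
    let e := AlgEquiv.ofInjectiveField (IsScalarTower.toAlgHom F L E)
    let e' := AlgEquiv.ofInjectiveField (IsScalarTower.toAlgHom F L' E)
    have i1 : FiniteDimensional F (IsScalarTower.toAlgHom F L E).fieldRange :=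
      Module.Finite.equiv e.toLinearEquiv
    have i2 : FiniteDimensional F (IsScalarTower.toAlgHom F L' E).fieldRange :=
      Module.Finite.equiv e'.toLinearEquiv
    have i3 : IsGalois F (IsScalarTower.toAlgHom F L E).fieldRange := IsGalois.of_algEquiv e
    have i4 : IsGalois F (IsScalarTower.toAlgHom F L' E).fieldRange := IsGalois.of_algEquiv e'
    have i5 : IsGalois F ((IsScalarTower.toAlgHom F L E).fieldRange ⊔
      (IsScalarTower.toAlgHom F L' E).fieldRange : IntermediateField F E) := {}
    have i6 := IntermediateField.finiteDimensional_sup (IsScalarTower.toAlgHom F L E).fieldRange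
      (IsScalarTower.toAlgHom F L' E).fieldRange
    rw [hgen] at i5 i6
    exact ⟨Module.Finite.equiv (IntermediateField.topEquiv (F := F) (E := E)).toLinearEquiv,
      IsGalois.of_algEquiv (IntermediateField.topEquiv (F := F) (E := E))⟩
  obtain ⟨_, _⟩ := hfin
  have hone : ∀ σ : E ≃ₐ[F] E, (∀ x : L, σ (algebraMap L E x) = algebraMap L E x) →
      (∀ x : L', σ (algebraMap L' E x) = algebraMap L' E x) → σ = 1 := by
    intro σ h1 h2
    refine eq_one_of_fixedField_eq_top (top_le_iff.1 (hgen ▸ sup_le ?_ ?_))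
    · rintro _ ⟨x, rfl⟩
      exact mem_fixedField_zpowers.2 (h1 x)
    · rintro _ ⟨x, rfl⟩
      exact mem_fixedField_zpowers.2 (h2 x)
  have hGE : IsPGroup p (E ≃ₐ[F] E) := by
    intro σ
    obtain ⟨n, hn⟩ := hG (σ.restrictNormal L)
    obtain ⟨n', hn'⟩ := hG' (σ.restrictNormal L')
    refine ⟨n + n', hone _ (fun x => ?_) fun x => ?_⟩
    · rw [← AlgEquiv.restrictNormal_commutes]
      have : (σ ^ p ^ (n + n')).restrictNormal L = 1 := by
        have h1 := map_pow (AlgEquiv.restrictNormalHom (F := F) (K₁ := E) L) σ (p ^ (n + n'))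
        refine h1.trans ?_
        change (σ.restrictNormal L) ^ p ^ (n + n') = 1
        rw [pow_add, pow_mul, hn, one_pow]
      rw [this, AlgEquiv.one_apply]
    · rw [← AlgEquiv.restrictNormal_commutes]
      have : (σ ^ p ^ (n + n')).restrictNormal L' = 1 := by
        have h1 := map_pow (AlgEquiv.restrictNormalHom (F := F) (K₁ := E) L') σ (p ^ (n + n'))
        refine h1.trans ?_
        change (σ.restrictNormal L') ^ p ^ (n + n') = 1
        rw [pow_add, mul_comm, pow_mul, hn', one_pow]
      rw [this, AlgEquiv.one_apply]
  refine ⟨⟨‹_›, ‹_›, hGE⟩, fun Q hQ => ?_⟩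
  have := FiniteDimensional.right F L E
  have := FiniteDimensional.right F L' E
  obtain ⟨_, hres⟩ := hF.of_finite.isDVR_and_hasFiniteResidue hs hcard hQ
  exact IsWeaklyRamifiedAt.composite hp hres hGE (hw _ hQ.below) (hw' _ hQ.below) hone

end WeakExtension

/-! ### Weakly ramified steps between subfields -/

section Step

variable {𝔽 Ω : Type*} [Field 𝔽] [Field Ω] [Algebra 𝔽 Ω]

/-- The inclusion of intermediate fields, as an algebra structure. -/
abbrev inclusionAlgebra {A B : IntermediateField 𝔽 Ω} (h : A ≤ B) : Algebra A B :=
  (IntermediateField.inclusion h).toRingHom.toAlgebra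

/-- `B` is a weakly ramified finite Galois `p`-extension of `A`. -/
def IsWeakStep (p : ℕ) (A B : IntermediateField 𝔽 Ω) : Prop :=
  ∃ h : A ≤ B, letI := inclusionAlgebra h; IsWeakExtension p 𝔽 A B

/-- A subfield of `B` that contains `A` and a set of generators of `B` over `A` is all of `B`. -/
theorem eq_top_of_generators {A B : IntermediateField 𝔽 Ω} (h : A ≤ B) {S : Set Ω} (hSB : S ⊆ B)
    (hB : B ≤ A ⊔ IntermediateField.adjoin 𝔽 S) :
    letI := inclusionAlgebra h
    ∀ T : IntermediateField A B, (∀ x (hx : x ∈ B), x ∈ S → (⟨x, hx⟩ : B) ∈ T) → T = ⊤ := by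
  let _ := inclusionAlgebra h
  intro T hT
  have : IsScalarTower 𝔽 A B := IsScalarTower.of_algebraMap_eq fun _ => rfl
  let T' : IntermediateField 𝔽 Ω := (T.restrictScalars 𝔽).map B.val
  have h1 : A ⊔ IntermediateField.adjoin 𝔽 S ≤ T' := by
    refine sup_le (fun x hx => ?_) (IntermediateField.adjoin_le_iff.2 fun x hx => ?_)
    · exact ⟨⟨x, h hx⟩, T.algebraMap_mem ⟨x, hx⟩, rfl⟩
    · exact ⟨⟨x, hSB hx⟩, hT x (hSB hx) hx, rfl⟩
  rw [eq_top_iff]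
  intro x _
  obtain ⟨y, hy, hyx⟩ := h1 (hB x.2)
  have : y = x := Subtype.ext hyx
  rw [← this]
  exact hy

theorem adjoin_gen_eq_top (w : Ω) : IntermediateField.adjoin 𝔽
    {(⟨w, IntermediateField.mem_adjoin_simple_self 𝔽 w⟩ : IntermediateField.adjoin 𝔽 {w})} = ⊤ := by
  set T := IntermediateField.adjoin 𝔽
    {(⟨w, IntermediateField.mem_adjoin_simple_self 𝔽 w⟩ : IntermediateField.adjoin 𝔽 {w})} with hT
  have h1 : IntermediateField.adjoin 𝔽 {w} ≤ T.map (IntermediateField.adjoin 𝔽 {w}).val :=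
    IntermediateField.adjoin_simple_le_iff.2
      ⟨_, IntermediateField.mem_adjoin_simple_self 𝔽 _, rfl⟩
  rw [eq_top_iff]
  intro x _
  obtain ⟨y, hy, hyx⟩ := h1 x.2
  have : y = x := Subtype.ext hyx
  rw [← this]
  exact hy

variable {p : ℕ}

theorem IsWeakStep.tower_top {A B C : IntermediateField 𝔽 Ω} (h : IsWeakStep p A C) (hAB : A ≤ B)
    (hBC : B ≤ C) : IsWeakStep p B C := by
  obtain ⟨hAC, hw⟩ := h
  refine ⟨hBC, ?_⟩
  let _ := inclusionAlgebra hAC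
  let _ := inclusionAlgebra hAB
  let _ := inclusionAlgebra hBC
  have : IsScalarTower A B C := IsScalarTower.of_algebraMap_eq fun _ => rfl
  exact IsWeakExtension.tower_top (F := A) hw

theorem IsWeakStep.isFunctionField {A B : IntermediateField 𝔽 Ω} (h : IsWeakStep p A B)
    (hA : IsFunctionField 𝔽 A) : IsFunctionField 𝔽 B := by
  obtain ⟨hAB, ⟨_, _, _⟩, _⟩ := h
  let _ := inclusionAlgebra hAB
  have : IsScalarTower 𝔽 A B := IsScalarTower.of_algebraMap_eq fun _ => rfl
  exact hA.of_finite

theorem IsWeakStep.sup [Finite 𝔽] {s : ℕ} (hp : p.Prime) (hs : 1 ≤ s)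
    (hcard : Nat.card 𝔽 = p ^ s) {A B C : IntermediateField 𝔽 Ω} (hA : IsFunctionField 𝔽 A)
    (hB : IsWeakStep p A B) (hC : IsWeakStep p A C) : IsWeakStep p A (B ⊔ C) := by
  obtain ⟨hAB, hB⟩ := hB
  obtain ⟨hAC, hC⟩ := hC
  have hAD : A ≤ B ⊔ C := hAB.trans le_sup_left
  refine ⟨hAD, ?_⟩
  let _ := inclusionAlgebra hAB
  let _ := inclusionAlgebra hAC
  let _ := inclusionAlgebra hAD
  let _ := inclusionAlgebra (le_sup_left : B ≤ B ⊔ C)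
  let _ := inclusionAlgebra (le_sup_right : C ≤ B ⊔ C)
  have : IsScalarTower 𝔽 A (B ⊔ C : IntermediateField 𝔽 Ω) :=
    IsScalarTower.of_algebraMap_eq fun _ => rfl
  have : IsScalarTower 𝔽 B (B ⊔ C : IntermediateField 𝔽 Ω) :=
    IsScalarTower.of_algebraMap_eq fun _ => rfl
  have : IsScalarTower 𝔽 C (B ⊔ C : IntermediateField 𝔽 Ω) :=
    IsScalarTower.of_algebraMap_eq fun _ => rfl
  have : IsScalarTower A B (B ⊔ C : IntermediateField 𝔽 Ω) :=
    IsScalarTower.of_algebraMap_eq fun _ => rfl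
  have : IsScalarTower A C (B ⊔ C : IntermediateField 𝔽 Ω) :=
    IsScalarTower.of_algebraMap_eq fun _ => rfl
  refine IsWeakExtension.composite hp hs hcard hA hB hC ?_
  have hS : (B : Set Ω) ∪ C ⊆ (B ⊔ C : IntermediateField 𝔽 Ω) := by
    rintro x (hx | hx)
    · exact SetLike.le_def.1 le_sup_left hx
    · exact SetLike.le_def.1 le_sup_right hx
  refine eq_top_of_generators hAD hS ?_ _ ?_
  · refine le_trans (sup_le ?_ ?_) le_sup_right
    · exact fun x hx => IntermediateField.subset_adjoin _ _ (Or.inl hx)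
    · exact fun x hx => IntermediateField.subset_adjoin _ _ (Or.inr hx)
  · rintro x hx (h | h)
    · have hT := le_sup_left (a := (IsScalarTower.toAlgHom A B
        (B ⊔ C : IntermediateField 𝔽 Ω)).fieldRange) (b := (IsScalarTower.toAlgHom A C
        (B ⊔ C : IntermediateField 𝔽 Ω)).fieldRange)
      exact hT ⟨⟨x, h⟩, rfl⟩
    · have hT := le_sup_right (a := (IsScalarTower.toAlgHom A B
        (B ⊔ C : IntermediateField 𝔽 Ω)).fieldRange) (b := (IsScalarTower.toAlgHom A C
        (B ⊔ C : IntermediateField 𝔽 Ω)).fieldRange)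
      exact hT ⟨⟨x, h⟩, rfl⟩

variable {s q j k : ℕ} {α β : ℤ} [IsAlgClosed Ω] [CharP Ω p]

/-- The extension generated by the roots of a step polynomial is Galois, and the polynomial splits
there. -/
theorem isGalois_of_stepPoly (hs : 1 ≤ s) (hq : q = p ^ s) (hq2 : 2 ≤ q) (hj : 1 ≤ j)
    (hk : 1 ≤ k) {A B : IntermediateField 𝔽 Ω} (h : A ≤ B) {w c : Ω} (hw : w ∈ A) (hc : c ∈ A)
    (hw0 : w ≠ 0) (hroots : ∀ x, (stepPoly q j k w c).eval x = 0 → x ∈ B)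
    (hgen : B ≤ A ⊔ IntermediateField.adjoin 𝔽 {x | (stepPoly q j k w c).eval x = 0}) :
    letI := inclusionAlgebra h
    FiniteDimensional A B ∧ IsGalois A B ∧
      (stepPoly q j k (⟨w, h hw⟩ : B) ⟨c, h hc⟩).Splits := by
  let _ := inclusionAlgebra h
  have : CharP A p := (algebraMap A Ω).charP (algebraMap A Ω).injective p
  let wA : A := ⟨w, hw⟩
  have hwA : wA ≠ 0 := fun e => hw0 (congrArg (algebraMap A Ω) e)
  let f : A[X] := stepPoly q j k wA ⟨c, hc⟩
  have hsep : f.Separable := separable_stepPoly hs hq hj hwA _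
  have hfB : f.map (algebraMap A B) = stepPoly q j k ⟨w, h hw⟩ ⟨c, h hc⟩ :=
    map_stepPoly _ _ _ _ _ _
  have hfΩ : (stepPoly q j k (⟨w, h hw⟩ : B) ⟨c, h hc⟩).map (algebraMap B Ω) =
      stepPoly q j k w c := map_stepPoly _ _ _ _ _ _
  have hne : stepPoly q j k w c ≠ 0 := (monic_stepPoly hq2 hj hk w c).1.ne_zero
  have hsplit : (stepPoly q j k (⟨w, h hw⟩ : B) ⟨c, h hc⟩).Splits := by
    refine Splits.of_splits_map (algebraMap B Ω) (IsAlgClosed.splits _) fun a ha => ?_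
    rw [hfΩ, mem_roots hne] at ha
    exact ⟨⟨a, hroots a ha⟩, rfl⟩
  have : f.IsSplittingField A B := by
    rw [isSplittingField_iff_intermediateField, hfB]
    refine ⟨hsplit, eq_top_of_generators h hroots hgen _ fun x hx hxS => ?_⟩
    refine IntermediateField.subset_adjoin _ _ ?_
    rw [mem_rootSet_of_ne hsep.ne_zero, ← eval_map_algebraMap, hfB]
    apply (algebraMap B Ω).injective
    rw [← eval_map_apply, hfΩ, map_zero]
    exact hxS
  exact ⟨IsSplittingField.finiteDimensional B f, IsGalois.of_separable_splitting_field hsep,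
    hsplit⟩

end Step

/-! ### The step attached to a link -/

section BaseStep

theorem IsLinkData.card_eq_pow {𝔽 : Type*} {p s q j k : ℕ} {α β : ℤ}
    (D : IsLinkData 𝔽 p s q j k α β) : 1 ≤ s * (j + k) ∧ Nat.card 𝔽 = p ^ (s * (j + k)) := by
  refine ⟨Nat.mul_pos D.one_le (by have := D.left_pos; omega), ?_⟩
  rw [D.card, D.eq_pow, pow_mul]

variable {𝔽 Ω : Type*} [Field 𝔽] [Field Ω] [Algebra 𝔽 Ω] {p s q j k : ℕ} {α β : ℤ}
  {w w' u c : Ω}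

theorem mem_trKer_iff_eval_eq_zero {v : Ω} :
    v ∈ trKer q j k w ↔ (stepPoly q j k w 0).eval v = 0 := by
  rw [eval_stepPoly, add_zero, sub_eq_zero]
  rfl

theorem adjoin_le_baseField (𝔽 : Type*) {Ω : Type*} [Field 𝔽] [Field Ω] [Algebra 𝔽 Ω]
    (q j k : ℕ) (w : Ω) : IntermediateField.adjoin 𝔽 {w} ≤ baseField 𝔽 q j k w :=
  IntermediateField.adjoin_simple_le_iff.2 (mem_baseField 𝔽 q j k w)

theorem isFunctionField_adjoin (hw : Transcendental 𝔽 w) :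
    IsFunctionField 𝔽 (IntermediateField.adjoin 𝔽 {w}) := by
  refine .of_adjoin_eq_top ?_ (adjoin_gen_eq_top w)
  rw [← transcendental_algebraMap_iff (algebraMap (IntermediateField.adjoin 𝔽 {w}) Ω).injective]
  exact hw

/-- The conjugates of a root `u` of the step polynomial differ from `u` by elements of the kernel,
so the automorphisms that fix the kernel have order dividing `p`. -/
theorem isPGroup_of_eval_eq_zero [CharP Ω p] [ExpChar Ω p] (hq : q = p ^ s)
    {A B : IntermediateField 𝔽 Ω} (h : A ≤ B) (hw : w ∈ A) (hc : c ∈ A) (hV : trKer q j k w ⊆ A)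
    (hu : u ∈ B)
    (hu0 : (stepPoly q j k w c).eval u = 0) (hB : B ≤ A ⊔ IntermediateField.adjoin 𝔽 {u}) :
    letI := inclusionAlgebra h
    IsPGroup p (B ≃ₐ[A] B) := by
  let _ := inclusionAlgebra h
  intro σ
  refine ⟨1, eq_one_of_fixedField_eq_top ?_⟩
  refine eq_top_of_generators h (Set.singleton_subset_iff.2 hu) hB _ ?_
  rintro x hx rfl
  let y : B := ⟨x, hx⟩
  rw [pow_one]
  refine mem_fixedField_zpowers.2 ?_
  change (σ ^ p) y = y
  have : CharP B p := (algebraMap B Ω).charP (algebraMap B Ω).injective p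
  have : ExpChar B p := (algebraMap B Ω).expChar (algebraMap B Ω).injective p
  let wB : B := ⟨w, h hw⟩
  let cB : B := ⟨c, h hc⟩
  have hmap : (stepPoly q j k wB cB).map (algebraMap B Ω) = stepPoly q j k w c :=
    map_stepPoly _ _ _ _ _ _
  have hy : (stepPoly q j k wB cB).eval y = 0 := by
    apply (algebraMap B Ω).injective
    rw [← eval_map_apply, hmap, map_zero]
    exact hu0
  have hσy : (stepPoly q j k wB cB).eval (σ y) = 0 := by
    have e : (stepPoly q j k wB cB).map (σ : B →+* B) = stepPoly q j k wB cB := by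
      rw [map_stepPoly]
      exact congrArg₂ _ (σ.commutes ⟨w, hw⟩) (σ.commutes ⟨c, hc⟩)
    have := congrArg (σ : B →+* B) hy
    rwa [← eval_map_apply, e, map_zero] at this
  have hv := sub_mem_trKer_of_eval_eq_zero hq hσy hy
  set v := σ y - y with hvdef
  have hvA : (v : Ω) ∈ A := hV (map_mem_trKer (algebraMap B Ω) hv)
  have hσv : σ v = v := σ.commutes ⟨v, hvA⟩
  have hn : ∀ n : ℕ, (σ ^ n) y = y + n * v := by
    intro n
    induction n with
    | zero => simp
    | succ n ih =>
      rw [pow_succ', AlgEquiv.mul_apply, ih, map_add, map_mul, map_natCast, hσv,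
        show σ y = y + v by rw [hvdef]; ring]
      push_cast
      ring
  rw [hn, CharP.cast_eq_zero, zero_mul, add_zero]

variable [IsAlgClosed Ω] [CharP Ω p]

theorem isFunctionField_baseField (D : IsLinkData 𝔽 p s q j k α β) (hw : Transcendental 𝔽 w) :
    IsFunctionField 𝔽 (baseField 𝔽 q j k w) := by
  have hw0 : w ≠ 0 := by
    rintro rfl
    exact hw isAlgebraic_zero
  have hle := adjoin_le_baseField 𝔽 q j k w
  let _ := inclusionAlgebra hle
  have : IsScalarTower 𝔽 (IntermediateField.adjoin 𝔽 {w}) (baseField 𝔽 q j k w) :=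
    IsScalarTower.of_algebraMap_eq fun _ => rfl
  obtain ⟨_, _, _⟩ := isGalois_of_stepPoly (c := 0) D.one_le D.eq_pow D.two_le D.left_pos
    D.right_pos hle (IntermediateField.mem_adjoin_simple_self 𝔽 w) (zero_mem _) hw0
    (fun x hx => trKer_subset_baseField 𝔽 q j k w (mem_trKer_iff_eval_eq_zero.2 hx)) (by
      refine IntermediateField.adjoin_le_iff.2 (Set.insert_subset ?_ fun v hv => ?_)
      · exact SetLike.le_def.1 le_sup_left (IntermediateField.mem_adjoin_simple_self 𝔽 w)
      · exact SetLike.le_def.1 le_sup_right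
          (IntermediateField.subset_adjoin _ _ (mem_trKer_iff_eval_eq_zero.1 hv)))
  exact (isFunctionField_adjoin hw).of_finite

/-- Adjoining the parameter of a link to the base field of its left end is a weakly ramified
step. -/
theorem IsLink.isWeakStep [Finite 𝔽] (D : IsLinkData 𝔽 p s q j k α β)
    (h : IsLink q j k α β w w' u) (hw : Transcendental 𝔽 w) :
    IsWeakStep p (baseField 𝔽 q j k w) (baseField 𝔽 q j k w ⊔ IntermediateField.adjoin 𝔽 {u}) := by
  have := ExpChar.prime (R := Ω) D.prime
  have hq := D.eq_pow
  set H := IntermediateField.adjoin 𝔽 {w} with hHdef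
  set A := baseField 𝔽 q j k w with hAdef
  set B := A ⊔ IntermediateField.adjoin 𝔽 {u} with hBdef
  have hHA : H ≤ A := adjoin_le_baseField 𝔽 q j k w
  have hAB : A ≤ B := le_sup_left
  have hHB : H ≤ B := hHA.trans hAB
  have hwH : w ∈ H := IntermediateField.mem_adjoin_simple_self 𝔽 w
  have hcH : α + β * w ∈ H := add_mem (intCast_mem H α) (mul_mem (intCast_mem H β) hwH)
  have hVA : trKer q j k w ⊆ A := trKer_subset_baseField 𝔽 q j k w
  have huB : u ∈ B := SetLike.le_def.1 le_sup_right (IntermediateField.mem_adjoin_simple_self 𝔽 u)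
  have hu0 := h.eval_eq_zero hq
  let _ := inclusionAlgebra hHA
  let _ := inclusionAlgebra hAB
  let _ := inclusionAlgebra hHB
  have : IsScalarTower 𝔽 H A := IsScalarTower.of_algebraMap_eq fun _ => rfl
  have : IsScalarTower 𝔽 A B := IsScalarTower.of_algebraMap_eq fun _ => rfl
  have : IsScalarTower 𝔽 H B := IsScalarTower.of_algebraMap_eq fun _ => rfl
  have : IsScalarTower H A B := IsScalarTower.of_algebraMap_eq fun _ => rfl
  have : CharP B p := (algebraMap B Ω).charP (algebraMap B Ω).injective p
  have : CharP H p := (algebraMap H Ω).charP (algebraMap H Ω).injective p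
  -- the generators of `B` over `H`
  have hBS : B ≤ H ⊔ IntermediateField.adjoin 𝔽 (insert u (trKer q j k w)) := by
    refine sup_le (IntermediateField.adjoin_le_iff.2 (Set.insert_subset ?_ fun v hv => ?_))
      (IntermediateField.adjoin_simple_le_iff.2 ?_)
    · exact SetLike.le_def.1 le_sup_left hwH
    · exact SetLike.le_def.1 le_sup_right
        (IntermediateField.subset_adjoin _ _ (Set.mem_insert_of_mem _ hv))
    · exact SetLike.le_def.1 le_sup_right
        (IntermediateField.subset_adjoin _ _ (Set.mem_insert _ _))
  obtain ⟨hfin, hgal, hsplit⟩ := isGalois_of_stepPoly D.one_le hq D.two_le D.left_pos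
    D.right_pos hHB hwH hcH h.ne_zero (fun x hx => by
      have := hAB (hVA (sub_mem_trKer_of_eval_eq_zero hq hx hu0))
      simpa using add_mem this huB) (by
      refine hBS.trans (sup_le le_sup_left
        (IntermediateField.adjoin_le_iff.2 (Set.insert_subset ?_ fun v hv => ?_)))
      · exact SetLike.le_def.1 le_sup_right (IntermediateField.subset_adjoin _ _ hu0)
      · have h1 := IntermediateField.subset_adjoin 𝔽
          {x | (stepPoly q j k w (α + β * w)).eval x = 0} (eval_add_eq_zero hq hu0 hv)
        have h2 := IntermediateField.subset_adjoin 𝔽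
          {x | (stepPoly q j k w (α + β * w)).eval x = 0} hu0
        have h3 := sub_mem h1 h2
        rw [add_sub_cancel_left] at h3
        exact SetLike.le_def.1 le_sup_right h3)
  have hfinA : FiniteDimensional A B := FiniteDimensional.right H A B
  have hgalA : IsGalois A B := IsGalois.tower_top_of_isGalois H A B
  refine ⟨hAB, ⟨hfinA, hgalA, isPGroup_of_eval_eq_zero hq hAB (hHA hwH) (hHA hcH) hVA huB hu0
    le_rfl⟩, fun Q hQ => ?_⟩
  obtain ⟨hs', hcard'⟩ := D.card_eq_pow
  have hff : IsFunctionField 𝔽 B := (isFunctionField_adjoin hw).of_finite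
  obtain ⟨_, hres⟩ := hff.isDVR_and_hasFiniteResidue hs' hcard' hQ
  rw [isWeaklyRamifiedAt_iff]
  intro σ hσ h3
  let wH : H := ⟨w, hwH⟩
  let wB : B := ⟨w, hHB hwH⟩
  let y : B := ⟨u, huB⟩
  have hwH0 : wH ≠ 0 := fun e => h.ne_zero (congrArg (algebraMap H Ω) e)
  have hwB0 : wB ≠ 0 := fun e => h.ne_zero (congrArg (algebraMap B Ω) e)
  have hcB : (⟨α + β * w, hHB hcH⟩ : B) = α + β * wB := by
    apply (algebraMap B Ω).injective
    rw [map_add, map_mul, map_intCast, map_intCast]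
    rfl
  rw [hcB] at hsplit
  have hy : (stepPoly q j k wB (α + β * wB)).eval y = 0 := by
    apply (algebraMap B Ω).injective
    rw [← eval_map_apply, map_stepPoly, map_zero, map_add, map_mul, map_intCast, map_intCast]
    exact hu0
  have hmem : ∀ v : B, v ∈ trKer q j k wB ↔ (v : Ω) ∈ trKer q j k w := fun v =>
    ⟨fun hv => map_mem_trKer (algebraMap B Ω) hv,
      fun hv => mem_trKer_of_map (algebraMap B Ω).injective hv⟩
  have hgen : ∀ τ : B ≃ₐ[H] B, (∀ v ∈ trKer q j k wB, τ v = v) → τ y = y → τ = 1 := by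
    intro τ hτ hτy
    refine eq_one_of_fixedField_eq_top (eq_top_of_generators hHB
      (Set.insert_subset huB fun v hv => hAB (hVA hv)) hBS _ ?_)
    rintro x hx (rfl | hxV)
    · exact mem_fixedField_zpowers.2 hτy
    · exact mem_fixedField_zpowers.2 (hτ _ ((hmem ⟨x, hx⟩).2 hxV))
  have h1 : σ.restrictScalars H = 1 :=
    eq_one_of_step D hres hwB0 (fun τ => τ.commutes wH) hsplit hy hgen
      (fun hwQ => ord_algebraMap_generator_le D.prime hres hQ (adjoin_gen_eq_top w) hwH0 hwQ)
      hσ (fun v hv => σ.commutes ⟨v, hVA ((hmem v).1 hv)⟩) h3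
  ext x
  exact congrArg Subtype.val (DFunLike.congr_fun h1 x)

/-- Adjoining the parameter of a link to the base field of its right end gives the same field and
is a weakly ramified step as well, by the symmetry of links. -/
theorem IsLink.isWeakStep_right [Finite 𝔽] (D : IsLinkData 𝔽 p s q j k α β)
    (h : IsLink q j k α β w w' u) (hw : Transcendental 𝔽 w) :
    IsWeakStep p (baseField 𝔽 q j k w') (baseField 𝔽 q j k w ⊔ IntermediateField.adjoin 𝔽 {u}) := by
  have := ExpChar.prime (R := Ω) D.prime
  have hw' : Transcendental 𝔽 w'⁻¹ := fun ha => h.transcendental D hw (by simpa using ha.inv)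
  have h1 := (h.symm D.eq_pow).isWeakStep D.symm hw'
  rw [baseField_inv D h.ne_zero'] at h1
  have hadj : IntermediateField.adjoin 𝔽 {-u} = IntermediateField.adjoin 𝔽 {u} := by
    refine le_antisymm (IntermediateField.adjoin_simple_le_iff.2
      (neg_mem (IntermediateField.mem_adjoin_simple_self 𝔽 u)))
      (IntermediateField.adjoin_simple_le_iff.2 ?_)
    simpa using neg_mem (IntermediateField.mem_adjoin_simple_self 𝔽 (-u))
  have hu : ∀ A : IntermediateField 𝔽 Ω, u ∈ A ⊔ IntermediateField.adjoin 𝔽 {u} := fun A =>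
    SetLike.le_def.1 le_sup_right (IntermediateField.mem_adjoin_simple_self 𝔽 u)
  have heq : baseField 𝔽 q j k w' ⊔ IntermediateField.adjoin 𝔽 {u} =
      baseField 𝔽 q j k w ⊔ IntermediateField.adjoin 𝔽 {u} :=
    le_antisymm (sup_le (h.baseField_le D le_sup_left (hu _)) le_sup_right)
      (sup_le (h.baseField_le' D le_sup_left (hu _)) le_sup_right)
  rwa [hadj, heq] at h1

end BaseStep

/-! ### The pyramid of composite fields -/

section Pyramid

variable {𝔽 Ω : Type*} [Field 𝔽] [Field Ω] [Algebra 𝔽 Ω] {p s q j k : ℕ} {α β : ℤ} {w u : ℕ → Ω}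

/-- The field generated by the base field of `w a` and the parameters `u a, …, u (a + m - 1)`. -/
def pyramid (𝔽 : Type*) {Ω : Type*} [Field 𝔽] [Field Ω] [Algebra 𝔽 Ω] (q j k : ℕ) (w u : ℕ → Ω)
    (a m : ℕ) : IntermediateField 𝔽 Ω :=
  baseField 𝔽 q j k (w a) ⊔ IntermediateField.adjoin 𝔽 (u '' Set.Ico a (a + m))

theorem pyramid_zero (a : ℕ) : pyramid 𝔽 q j k w u a 0 = baseField 𝔽 q j k (w a) := by
  simp [pyramid]

theorem pyramid_one (a : ℕ) : pyramid 𝔽 q j k w u a 1 =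
    baseField 𝔽 q j k (w a) ⊔ IntermediateField.adjoin 𝔽 {u a} := by
  rw [pyramid, ← Order.succ_eq_add_one, Order.Ico_succ_right, Set.Icc_self, Set.image_singleton]

theorem mem_pyramid {a m b : ℕ} (h1 : a ≤ b) (h2 : b < a + m) :
    u b ∈ pyramid 𝔽 q j k w u a m :=
  SetLike.le_def.1 le_sup_right
    (IntermediateField.subset_adjoin _ _ ⟨b, Set.mem_Ico.2 ⟨h1, h2⟩, rfl⟩)

theorem pyramid_mono {a m m' : ℕ} (h : m ≤ m') :
    pyramid 𝔽 q j k w u a m ≤ pyramid 𝔽 q j k w u a m' :=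
  sup_le_sup_left (IntermediateField.adjoin.mono _ _ _
    (Set.image_mono (Set.Ico_subset_Ico_right (by omega)))) _

theorem pyramid_le {a m : ℕ} {K : IntermediateField 𝔽 Ω} (hK : baseField 𝔽 q j k (w a) ≤ K)
    (h : ∀ b, a ≤ b → b < a + m → u b ∈ K) : pyramid 𝔽 q j k w u a m ≤ K := by
  refine sup_le hK (IntermediateField.adjoin_le_iff.2 ?_)
  rintro _ ⟨b, hb, rfl⟩
  exact h b hb.1 hb.2

variable [IsAlgClosed Ω] [CharP Ω p]

theorem baseField_le_pyramid (D : IsLinkData 𝔽 p s q j k α β)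
    (hu : ∀ a, IsLink q j k α β (w a) (w (a + 1)) (u a)) (a : ℕ) {m i : ℕ} (h : i ≤ m) :
    baseField 𝔽 q j k (w (a + i)) ≤ pyramid 𝔽 q j k w u a m := by
  induction i with
  | zero => exact le_sup_left
  | succ i ih =>
    exact (hu (a + i)).baseField_le D (ih (by omega)) (mem_pyramid (by omega) (by omega))

theorem pyramid_succ_le (D : IsLinkData 𝔽 p s q j k α β)
    (hu : ∀ a, IsLink q j k α β (w a) (w (a + 1)) (u a)) (a m : ℕ) :
    pyramid 𝔽 q j k w u (a + 1) m ≤ pyramid 𝔽 q j k w u a (m + 1) :=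
  pyramid_le (baseField_le_pyramid D hu a (by omega))
    fun _ h1 h2 => mem_pyramid (by omega) (by omega)

theorem pyramid_add_two (D : IsLinkData 𝔽 p s q j k α β)
    (hu : ∀ a, IsLink q j k α β (w a) (w (a + 1)) (u a)) (a m : ℕ) :
    pyramid 𝔽 q j k w u a (m + 2) =
      pyramid 𝔽 q j k w u a (m + 1) ⊔ pyramid 𝔽 q j k w u (a + 1) (m + 1) := by
  refine le_antisymm (pyramid_le (le_sup_left.trans le_sup_left) fun b h1 h2 => ?_)
    (sup_le (pyramid_mono (by omega)) (pyramid_succ_le D hu a (m + 1)))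
  by_cases hb : b = a
  · exact SetLike.le_def.1 le_sup_left (mem_pyramid (by omega) (by omega))
  · exact SetLike.le_def.1 le_sup_right (mem_pyramid (by omega) (by omega))

/-- Every edge of the pyramid is a weakly ramified step: a step from the level `m + 1` to the level
`m + 2` is the upper half of a composite of two steps from the level `m` to the level `m + 1`. -/
theorem isWeakStep_pyramid [Finite 𝔽] (D : IsLinkData 𝔽 p s q j k α β)
    (hu : ∀ a, IsLink q j k α β (w a) (w (a + 1)) (u a)) (hw : Transcendental 𝔽 (w 0)) (m : ℕ) :
    ∀ a, IsFunctionField 𝔽 (pyramid 𝔽 q j k w u a m) ∧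
      IsWeakStep p (pyramid 𝔽 q j k w u a m) (pyramid 𝔽 q j k w u a (m + 1)) ∧
      IsWeakStep p (pyramid 𝔽 q j k w u (a + 1) m) (pyramid 𝔽 q j k w u a (m + 1)) := by
  have hwt : ∀ a, Transcendental 𝔽 (w a) := by
    intro a
    induction a with
    | zero => exact hw
    | succ a ih => exact (hu a).transcendental D ih
  obtain ⟨hs', hcard'⟩ := D.card_eq_pow
  induction m with
  | zero =>
    intro a
    rw [pyramid_zero, pyramid_zero, zero_add, pyramid_one]
    exact ⟨isFunctionField_baseField D (hwt a), (hu a).isWeakStep D (hwt a),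
      (hu a).isWeakStep_right D (hwt a)⟩
  | succ m ih =>
    intro a
    have h := IsWeakStep.sup D.prime hs' hcard' (ih (a + 1)).1 (ih a).2.2 (ih (a + 1)).2.1
    rw [← pyramid_add_two D hu] at h
    exact ⟨(ih a).2.1.isFunctionField (ih a).1,
      h.tower_top (pyramid_succ_le D hu a m) (pyramid_mono (by omega)),
      h.tower_top (pyramid_mono (by omega)) (pyramid_succ_le D hu a (m + 1))⟩

end Pyramid

/-! ### The tower -/

section ExtendScalars

variable {𝔽 Ω : Type*} [Field 𝔽] [Field Ω] [Algebra 𝔽 Ω] {p s : ℕ} {A B : IntermediateField 𝔽 Ω}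

/-- The algebra structures on `B`, as the extension of scalars and through the inclusion, agree. -/
theorem IsWeakStep.isWeakExtension (h : IsWeakStep p A B) (hle : A ≤ B) :
    IsWeakExtension p 𝔽 A (IntermediateField.extendScalars hle) := by
  obtain ⟨_, h⟩ := h
  exact h

theorem IsWeakStep.isTwoBounded [Finite 𝔽] [CharP Ω p] (hp : p.Prime) (hs : 1 ≤ s)
    (hcard : Nat.card 𝔽 = p ^ s) (hB : IsFunctionField 𝔽 B) (h : IsWeakStep p A B) (hle : A ≤ B) :
    IsTwoBounded 𝔽 A (IntermediateField.extendScalars hle) := by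
  have : CharP (IntermediateField.extendScalars hle) p :=
    (algebraMap (IntermediateField.extendScalars hle) Ω).charP
      (FaithfulSMul.algebraMap_injective _ _) p
  exact (h.isWeakExtension hle).isTwoBounded hp hs hcard hB

end ExtendScalars

section Tower

variable {𝔽 Ω : Type*} [Field 𝔽] [Field Ω] [Algebra 𝔽 Ω] {p s q j k : ℕ} {α β : ℤ} {x u : ℕ → Ω}

theorem isRoot_f₁_iff {t : Ω} :
    (f₁ q (j + k) k x).IsRoot t ↔ t ∈ trKer q j k (z q (j + k) x 1)⁻¹ := by
  rw [IsRoot, f₁, Nat.add_sub_cancel, eval_add, eval_mul, eval_pow, eval_neg, eval_C, eval_trPoly,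
    eval_trPoly, neg_mul, neg_add_eq_zero, eq_comm]
  rfl

theorem M_eq_baseField :
    M 𝔽 q (j + k) k x = baseField 𝔽 q j k (z q (j + k) x 1)⁻¹ := by
  have hroots : {t | (f₁ q (j + k) k x).IsRoot t} = trKer q j k (z q (j + k) x 1)⁻¹ :=
    Set.ext fun _ => isRoot_f₁_iff
  rw [M, hroots, H, Set.Icc_self, Set.image_singleton]
  refine le_antisymm (sup_le (IntermediateField.adjoin_simple_le_iff.2 ?_)
    (IntermediateField.adjoin.mono _ _ _ (Set.subset_insert _ _)))
    (IntermediateField.adjoin_le_iff.2 (Set.insert_subset ?_ fun v hv => ?_))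
  · simpa using inv_mem (mem_baseField 𝔽 q j k (z q (j + k) x 1)⁻¹)
  · exact SetLike.le_def.1 le_sup_left
      (inv_mem (IntermediateField.mem_adjoin_simple_self 𝔽 _))
  · exact SetLike.le_def.1 le_sup_right (IntermediateField.subset_adjoin _ _ hv)

/-- The fields `H'_i` form the left side of the pyramid, which starts at `M`. -/
theorem H'_succ_eq_pyramid [IsAlgClosed Ω] [CharP Ω p] [Finite 𝔽]
    (D : IsLinkData 𝔽 p s q j k α β)
    (hu : ∀ a, IsLink q j k α β (z q (j + k) x (a + 1))⁻¹ (z q (j + k) x (a + 1 + 1))⁻¹ (u a))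
    (m : ℕ) : H' 𝔽 q (j + k) k x (m + 1) =
      pyramid 𝔽 q j k (fun a => (z q (j + k) x (a + 1))⁻¹) u 0 m := by
  refine le_antisymm (sup_le ?_ (IntermediateField.adjoin_le_iff.2 ?_)) ?_
  · rw [M_eq_baseField]
    exact le_sup_left
  · rintro _ ⟨i, ⟨hi1, hi2⟩, rfl⟩
    have h := baseField_le_pyramid D hu 0 (show i - 1 ≤ m by omega) (mem_baseField 𝔽 q j k _)
    have h' := inv_mem h
    rwa [inv_inv, zero_add, Nat.sub_add_cancel hi1] at h'
  · have hz : ∀ a ≤ m, (z q (j + k) x (a + 1))⁻¹ ∈ H' 𝔽 q (j + k) k x (m + 1) := fun a ha =>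
      SetLike.le_def.1 le_sup_right (inv_mem (IntermediateField.subset_adjoin _ _
        ⟨a + 1, Set.mem_Icc.2 ⟨by omega, by omega⟩, rfl⟩))
    have hle : ∀ a ≤ m, baseField 𝔽 q j k (z q (j + k) x (a + 1))⁻¹ ≤
        H' 𝔽 q (j + k) k x (m + 1) := by
      intro a
      induction a with
      | zero =>
        intro _
        rw [zero_add, ← M_eq_baseField]
        exact le_sup_left
      | succ a ih =>
        intro ha
        have h1 := ih (by omega)
        exact (hu a).baseField_le D h1 ((hu a).mem_of_mem_right D h1 (hz (a + 1) ha))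
    exact pyramid_le (hle 0 (by omega)) fun b _ hb =>
      (hu b).mem_of_mem_right D (hle b (by omega)) (hz (b + 1) (by omega))

end Tower

end GaloisTower

theorem mainTheorem5 (p s q n k : ℕ) (hp : p.Prime) (hs : 1 ≤ s) (hq : q = p ^ s)
    (hn : 2 ≤ n) (hk : 1 ≤ k) (hkn : k < n) (hgcd : Nat.gcd k (n - k) = 1)
    {𝔽 Ω : Type*} [Field 𝔽] [Finite 𝔽] (hcard : Nat.card 𝔽 = q ^ n)
    [Field Ω] [Algebra 𝔽 Ω] [IsAlgClosed Ω]
    (x : ℕ → Ω) (hx : GaloisTower.IsTowerSequence 𝔽 q n k x) :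
    ∀ i : ℕ, 1 < i →
      GaloisTower.IsGaloisPExtension p
        (GaloisTower.H' 𝔽 q n k x i) (GaloisTower.H'Step 𝔽 q n k x i) ∧
      GaloisTower.IsTwoBounded 𝔽
        (GaloisTower.H' 𝔽 q n k x i) (GaloisTower.H'Step 𝔽 q n k x i) := by
  obtain ⟨j, rfl⟩ : ∃ j, n = j + k := ⟨n - k, by omega⟩
  rw [Nat.add_sub_cancel] at hgcd
  have hcop : Nat.Coprime j k := Nat.Coprime.symm hgcd
  have hbez : (j : ℤ) * Int.gcdA j k + k * Int.gcdB j k = 1 := by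
    rw [← Int.gcd_eq_gcd_ab, Int.gcd_natCast_natCast, hcop.gcd_eq_one, Nat.cast_one]
  have D : GaloisTower.IsLinkData 𝔽 p s q j k (Int.gcdA j k) (Int.gcdB j k) :=
    ⟨hp, hs, hq, by omega, hk, hcop, hbez, hcard⟩
  obtain ⟨hs', hcard'⟩ := D.card_eq_pow
  have : Fact p.Prime := ⟨hp⟩
  have : CharP 𝔽 p := by
    have := Fintype.ofFinite 𝔽
    exact charP_of_card_eq_prime_pow (Nat.card_eq_fintype_card (α := 𝔽) ▸ hcard')
  have : CharP Ω p := charP_of_injective_algebraMap (algebraMap 𝔽 Ω).injective p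
  have := ExpChar.prime (R := Ω) hp
  have hlink : ∀ a, ∃ u, GaloisTower.IsLink q j k (Int.gcdA j k) (Int.gcdB j k)
      (GaloisTower.z q (j + k) x (a + 1))⁻¹ (GaloisTower.z q (j + k) x (a + 1 + 1))⁻¹ u :=
    fun a => GaloisTower.exists_isLink hs hp.two_le hq hcop hbez (hx.equation (a + 1) (by omega))
  -- the generators of the pyramid
  choose u hu using hlink
  have hw : Transcendental 𝔽 (GaloisTower.z q (j + k) x (0 + 1))⁻¹ := by
    intro h
    have h1 : IsAlgebraic 𝔽 (x 1 ^ (q ^ (j + k) - 1)) := by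
      have := h.inv.neg
      rwa [inv_inv, GaloisTower.z, neg_neg] at this
    have hpos : 0 < q ^ (j + k) - 1 :=
      Nat.sub_pos_of_lt (Nat.one_lt_pow (by omega) (by have := D.two_le; omega))
    exact hx.transcendental (h1.of_pow hpos)
  intro i hi
  obtain ⟨m, rfl⟩ : ∃ m, i = m + 1 := ⟨i - 1, by omega⟩
  obtain ⟨hff, hstep, -⟩ := GaloisTower.isWeakStep_pyramid (u := u)
    (w := fun a => (GaloisTower.z q (j + k) x (a + 1))⁻¹) D hu hw m 0
  have hff' := hstep.isFunctionField hff
  rw [← GaloisTower.H'_succ_eq_pyramid D hu, ← GaloisTower.H'_succ_eq_pyramid D hu] at hstep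
  rw [← GaloisTower.H'_succ_eq_pyramid D hu] at hff'
  have hle := GaloisTower.H'_le_succ 𝔽 q (j + k) k x (m + 1)
  exact ⟨(hstep.isWeakExtension hle).1, hstep.isTwoBounded hp hs' hcard' hff' hle⟩
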